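/- Let $M$ be a smooth (finite-dimensional, Hausdorff, second countable) manifold without boundary, let $A\to M$ be a smooth real vector bundle of finite rank, and let $J\subset\mathbb R$ be an interval with more than one point. Let $A_t=(A,[\cdot,\cdot]_t,\rho_t)$, $t\in J$, be a smooth family of Lie algebroid structures on $A$; that is, each $[\cdot,\cdot]_t$ is an $\mathbb R$-bilinear Lie bracket on $\Gamma(A)$, each anchor $\rho_t:A\to TM$ is a vector bundle map with $[\alpha,f\beta]_t=f[\alpha,\beta]_t+\rho_t(\alpha)(f)\,\beta$, the map $(t,x)\mapsto[\alpha,\beta]_t(x)$ is smooth on $J\times M$ for all $\alpha,\beta\in\Gamma(A)$, and $(t,v)\mapsto\rho_t(v)$ is smooth on $J\times A$. For a Lie algebroid structure on $A$ with bracket $[\cdot,\cdot]$, the deformation complex $C^n_{\mathrm{def}}(A)$, $n\ge 1$, consists of the alternating $\mathbb R$-multilinear maps $D:\Gamma(A)^n\to\Gamma(A)$ for which there is an alternating $C^\infty(M)$-multilinear map $\sigma_D:\Gamma(A)^{n-1}\to\mathfrak X(M)$ (the symbol) with $$D(s_1,\dots,s_{n-1},f s_n)=f\,D(s_1,\dots,s_n)+\sigma_D(s_1,\dots,s_{n-1})(f)\,s_n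 ,$$ and the coboundary is $$\delta(D)(\alpha_0,\dots,\alpha_n)=\sum_i(-1)^i[\alpha_i,D(\alpha_0,\dots,\widehat{\alpha_i},\dots,\alpha_n)]+\sum_{i<j}(-1)^{i+j}D([\alpha_i,\alpha_j],\alpha_0,\dots,\widehat{\alpha_i},\dots,\widehat{\alpha_j},\dots,\alpha_n).$$ Then for every $t\in J$ and $\alpha,\beta\in\Gamma(A)$ the derivative $$c_t(\alpha,\beta)=\frac{d}{dt}[\alpha,\beta]_t$$ exists pointwise (one-sided at an end point of $J$ belonging to $J$) and is a smooth section, and $c_t$ is a cocycle in $C^2_{\mathrm{def}}(A_t)$. If, moreover, $M$ is compact, the following are equivalent: (i) The family $(A_t)_{t\in J}$ is trivial, i.e. equivalent to a constant family: there are a Lie algebroid structure $B$ on the vector bundle $A$ and Lie algebroid isomorphisms $h_t:A_t\to B$, $t\in J$ (vector bundle automorphisms of $A$ covering diffeomorphisms of $M$ and compatible with brackets and anchors), such that $(t,v)\mapsto h_t(v)$ is smooth on $J\times A$. (ii) The classes $[c_t]\in H^2_{\mathrm{def}}(A_t)$ vanish smoothly with respect to $t$: there is a family of cochains $D_t\in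 C^1_{\mathrm{def}}(A_t)$, $t\in J$, such that $(t,x)\mapsto D_t(\alpha)(x)$ is smooth on $J\times M$ for every $\alpha\in\Gamma(A)$ and $c_t=\delta(D_t)$ for all $t\in J$, where $\delta$ is the coboundary of $C^*_{\mathrm{def}}(A_t)$. -/

import Mathlib

open Bundle Set
open scoped Manifold ContDiff Bundle

noncomputable section

namespace LieAlgd

variable {E : Type*} [NormedAddCommGroup E] [NormedSpace ℝ E]
  {H : Type*} [TopologicalSpace H] (I : ModelWithCorners ℝ E H)
  {M : Type*} [TopologicalSpace M] [ChartedSpace H M]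
  (F : Type*) [NormedAddCommGroup F] [NormedSpace ℝ F]
  (V : M → Type*) [TopologicalSpace (TotalSpace F V)]
  [∀ x, AddCommGroup (V x)] [∀ x, Module ℝ (V x)] [∀ x, TopologicalSpace (V x)]
  [FiberBundle F V]

/-- The algebra `C^∞(M)` of smooth real functions on `M`. -/
abbrev Fun (I : ModelWithCorners ℝ E H) (M : Type*) [TopologicalSpace M] [ChartedSpace H M] :
    Type _ :=
  C^∞⟮I, M; 𝓘(ℝ, ℝ), ℝ⟯

/-- The space `Γ(A)` of smooth sections of the bundle `A` with fibers `V x`. -/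
abbrev Sec : Type _ := Cₛ^∞⟮I; F, V⟯

/-- The space `𝔛(M)` of smooth vector fields on `M`. -/
abbrev VF (I : ModelWithCorners ℝ E H) (M : Type*) [TopologicalSpace M] [ChartedSpace H M]
    [IsManifold I ∞ M] : Type _ :=
  Cₛ^∞⟮I; E, (TangentSpace I : M → Type _)⟯

section FunctionModule

variable [VectorBundle ℝ F V]

variable {I F V}

/-- Pointwise multiplication of a smooth section by a smooth function. -/
instance instSMulFun : SMul (Fun I M) (Sec I F V) where
  smul f s := ⟨fun x => f x • s x, f.contMDiff.smul_section s.contMDiff⟩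

@[simp] theorem fun_smul_apply (f : Fun I M) (s : Sec I F V) (x : M) :
    (f • s) x = f x • s x := rfl

/-- Smooth sections form a module over the smooth functions. -/
instance instModuleFun : Module (Fun I M) (Sec I F V) where
  one_smul s := by ext x; simp
  mul_smul f g s := by ext x; simp [mul_smul]
  smul_zero f := by ext x; simp
  smul_add f s t := by ext x; simp
  add_smul f g s := by ext x; simp [add_smul]
  zero_smul s := by ext x; simp

end FunctionModule

variable [IsManifold I ∞ M] [VectorBundle ℝ F V]

/-- A Lie algebroid structure on the vector bundle `A` with fibers `V x`: an `ℝ`-bilinear Lie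
bracket on `Γ(A)` and a smooth vector bundle map `ρ : A → TM` over the identity, the anchor,
such that `[α, fβ] = f[α, β] + ρ(α)(f) β`. -/
structure LieAlgebroid where
  bracket : Sec I F V →ₗ[ℝ] Sec I F V →ₗ[ℝ] Sec I F V
  anchor : ∀ x : M, V x →ₗ[ℝ] TangentSpace I x
  bracket_self : ∀ α, bracket α α = 0
  jacobi : ∀ α β γ,
    bracket α (bracket β γ) + bracket β (bracket γ α) + bracket γ (bracket α β) = 0
  contMDiff_anchor : ContMDiff (I.prod 𝓘(ℝ, F)) (I.prod 𝓘(ℝ, E)) ∞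
    (fun p : TotalSpace F V => (⟨p.1, anchor p.1 p.2⟩ : TangentBundle I M))
  leibniz : ∀ (α β : Sec I F V) (f : Fun I M) (x : M),
    bracket α (f • β) x = f x • bracket α β x + mvfderiv I f x (anchor x (α x)) • β x

variable {I F V}

/-- A family of (time-independent) Lie algebroid structures varying smoothly with `t ∈ J`:
`(t, x) ↦ [α, β]_t(x)` is smooth on `J × M` for all sections `α, β`, and
`(t, v) ↦ ρ_t(v)` is smooth on `J × A`. Values of the family outside `J` are irrelevant. -/
structure IsSmoothFamily (J : Set ℝ) (A : ℝ → LieAlgebroid I F V) : Prop where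
  bracket : ∀ α β : Sec I F V,
    ContMDiffOn (𝓘(ℝ, ℝ).prod I) (I.prod 𝓘(ℝ, F)) ∞
      (fun p : ℝ × M => (⟨p.2, (A p.1).bracket α β p.2⟩ : TotalSpace F V)) (J ×ˢ univ)
  anchor : ContMDiffOn (𝓘(ℝ, ℝ).prod (I.prod 𝓘(ℝ, F))) (I.prod 𝓘(ℝ, E)) ∞
      (fun p : ℝ × TotalSpace F V =>
        (⟨p.2.1, (A p.1).anchor p.2.1 p.2.2⟩ : TangentBundle I M)) (J ×ˢ univ)

variable (I F V) in
/-- An automorphism of the vector bundle `A`, covering a diffeomorphism `base` of `M`. -/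
structure BundleAut where
  base : M ≃ₘ^∞⟮I, I⟯ M
  total : TotalSpace F V ≃ₘ^∞⟮I.prod 𝓘(ℝ, F), I.prod 𝓘(ℝ, F)⟯ TotalSpace F V
  fiber : ∀ x : M, V x →ₗ[ℝ] V (base x)
  total_mk : ∀ (x : M) (v : V x), total ⟨x, v⟩ = ⟨base x, fiber x v⟩

/-- `α'` is the push-forward `h ∘ α ∘ φ⁻¹` of the section `α` by the bundle automorphism `h`
covering `φ`. -/
def BundleAut.IsPushforward (h : BundleAut I F V) (α α' : Sec I F V) : Prop :=
  ∀ x : M, α' (h.base x) = h.fiber x (α x)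

/-- The bundle automorphism `h` is an isomorphism of Lie algebroids from `A` to `A'`:
`h_* [α, β] = [h_* α, h_* β]'` for all sections, and `ρ' ∘ h = dφ ∘ ρ`. -/
structure BundleAut.IsLieAlgebroidIso (h : BundleAut I F V) (A A' : LieAlgebroid I F V) :
    Prop where
  bracket : ∀ α β α' β' : Sec I F V, h.IsPushforward α α' → h.IsPushforward β β' →
    h.IsPushforward (A.bracket α β) (A'.bracket α' β')
  anchor : ∀ (x : M) (v : V x),
    A'.anchor (h.base x) (h.fiber x v) = mfderiv I I h.base x (A.anchor x v)

/-- Equivalence over `J` of two families of Lie algebroids on the same vector bundle: a family of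
Lie algebroid isomorphisms `h_t : A_t → A'_t` that depends smoothly on `t ∈ J`. -/
def EquivalentFamilies (J : Set ℝ) (A A' : ℝ → LieAlgebroid I F V) : Prop :=
  ∃ h : ℝ → BundleAut I F V,
    ContMDiffOn (𝓘(ℝ, ℝ).prod (I.prod 𝓘(ℝ, F))) (I.prod 𝓘(ℝ, F)) ∞
      (fun p : ℝ × TotalSpace F V => (h p.1).total p.2) (J ×ˢ univ) ∧
    ∀ t ∈ J, (h t).IsLieAlgebroidIso (A t) (A' t)

/-- A family of Lie algebroids is trivial over `J` if it is equivalent to a constant family. -/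
def IsTrivialFamily (J : Set ℝ) (A : ℝ → LieAlgebroid I F V) : Prop :=
  ∃ B : LieAlgebroid I F V, EquivalentFamilies J A (fun _ => B)

/-- The condition that the alternating `ℝ`-multilinear map `D : Γ(A)ⁿ → Γ(A)` is a
multiderivation, i.e. a cochain in `Cⁿ_def(A)`: there is a symbol `σ : Γ(A)ⁿ⁻¹ → 𝔛(M)`,
alternating and `C^∞(M)`-multilinear, such that
`D(s₁, …, sₙ₋₁, f u) = f D(s₁, …, sₙ₋₁, u) + σ(s₁, …, sₙ₋₁)(f) u`.
For `n = 0` the cochains are just the sections. -/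
def IsDefCochain : {n : ℕ} → (Sec I F V [⋀^Fin n]→ₗ[ℝ] Sec I F V) → Prop
  | 0, _ => True
  | n + 1, D => ∃ σ : Sec I F V [⋀^Fin n]→ₗ[Fun I M] VF I M,
      ∀ (s : Fin n → Sec I F V) (u : Sec I F V) (f : Fun I M) (x : M),
        D (Fin.snoc (α := fun _ => Sec I F V) s (f • u)) x
          = f x • D (Fin.snoc (α := fun _ => Sec I F V) s u) x + mvfderiv I f x (σ s x) • u x

/-- The coboundary of the deformation complex of `A`:
`δD(α₀, …, αₙ) = ∑ᵢ (-1)ⁱ [αᵢ, D(α₀, …, α̂ᵢ, …, αₙ)]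
  + ∑_{i<j} (-1)^{i+j} D([αᵢ, αⱼ], α₀, …, α̂ᵢ, …, α̂ⱼ, …, αₙ)`.
In the second sum `j` is removed first, so that `i < j` ranges over `Fin n`. -/
def LieAlgebroid.delta (A : LieAlgebroid I F V) :
    {n : ℕ} → (Sec I F V [⋀^Fin n]→ₗ[ℝ] Sec I F V) → (Fin (n + 1) → Sec I F V) → Sec I F V
  | 0, D, α => A.bracket (α 0) (D ![])
  | n + 1, D, α =>
      ∑ i : Fin (n + 2), (-1 : ℝ) ^ (i : ℕ) • A.bracket (α i) (D (i.removeNth α)) +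
      ∑ j : Fin (n + 2), ∑ i : Fin (n + 1),
        if i.castSucc < j then
          (-1 : ℝ) ^ ((i : ℕ) + (j : ℕ)) •
            D (Fin.cons (A.bracket (α i.castSucc) (α j)) (i.removeNth (j.removeNth α)))
        else 0

/-- `D` is a cocycle in `Cⁿ_def(A)`. -/
def LieAlgebroid.IsDefCocycle (A : LieAlgebroid I F V) {n : ℕ}
    (D : Sec I F V [⋀^Fin n]→ₗ[ℝ] Sec I F V) : Prop :=
  IsDefCochain D ∧ ∀ α, A.delta D α = 0

/-- A smooth family `(D_t)_{t ∈ J}` of `n`-cochains: each `D_t` is a multiderivation and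
`(t, x) ↦ D_t(s₁, …, sₙ)(x)` is smooth on `J × M` for all sections `sᵢ`. -/
structure IsSmoothCochainFamily (J : Set ℝ) {n : ℕ}
    (D : ℝ → (Sec I F V [⋀^Fin n]→ₗ[ℝ] Sec I F V)) : Prop where
  isDefCochain : ∀ t ∈ J, IsDefCochain (D t)
  smooth : ∀ s : Fin n → Sec I F V,
    ContMDiffOn (𝓘(ℝ, ℝ).prod I) (I.prod 𝓘(ℝ, F)) ∞
      (fun p : ℝ × M => (⟨p.2, D p.1 s p.2⟩ : TotalSpace F V)) (J ×ˢ univ)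

/-- `c_t(α, β) = d/dt [α, β]_t` for `t ∈ J`: the derivative exists in each fiber and equals `c_t`
(at an end point of `J` that belongs to `J`, the derivative is one-sided). -/
def IsBracketDerivative [∀ x, ContinuousSMul ℝ (V x)] (J : Set ℝ) (A : ℝ → LieAlgebroid I F V)
    (c : ℝ → (Sec I F V [⋀^Fin 2]→ₗ[ℝ] Sec I F V)) : Prop :=
  ∀ t ∈ J, ∀ (α β : Sec I F V) (x : M),
    HasDerivWithinAt (fun s => (A s).bracket α β x) (c t ![α, β] x) J t

end LieAlgd

end

section

open Bundle Set Filter Topology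
open scoped Manifold ContDiff Bundle NNReal

noncomputable section

set_option linter.unusedSectionVars false

namespace LieAlgd

section ODE

variable {E : Type*} [NormedAddCommGroup E] [NormedSpace ℝ E]

theorem norm_le_of_deriv_bound {J : Set ℝ} (hJ : J.OrdConnected) {d d' : ℝ → E} {t₀ t : ℝ}
    (ht₀ : t₀ ∈ J) (ht : t ∈ J) (hd : ∀ s ∈ J, HasDerivWithinAt d (d' s) J s) {c L : ℝ}
    (hc : ‖d t₀‖ ≤ c)
    (hb : ∀ s ∈ uIcc t₀ t, ‖d s‖ = c * Real.exp (L * |s - t₀|) →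
      ‖d' s‖ < L * (c * Real.exp (L * |s - t₀|))) :
    ‖d t‖ ≤ c * Real.exp (L * |t - t₀|) := by
  rcases eq_or_ne t t₀ with rfl | hne
  · simpa using hc
  have hpos : 0 < |t - t₀| := abs_pos.2 (sub_ne_zero.2 hne)
  have hmem : ∀ σ ∈ Icc (0 : ℝ) 1, t₀ + σ * (t - t₀) ∈ uIcc t₀ t := by
    intro σ hσ
    rcases le_total t₀ t with h | h
    · rw [uIcc_of_le h]
      constructor <;> nlinarith [hσ.1, hσ.2]
    · rw [uIcc_of_ge h]
      constructor <;> nlinarith [hσ.1, hσ.2]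
  have hsub : uIcc t₀ t ⊆ J := hJ.uIcc_subset ht₀ ht
  have hder : ∀ σ ∈ Icc (0 : ℝ) 1, HasDerivWithinAt (fun σ => d (t₀ + σ * (t - t₀)))
      ((t - t₀) • d' (t₀ + σ * (t - t₀))) (Icc 0 1) σ := by
    intro σ hσ
    have h1 : HasDerivWithinAt (fun σ : ℝ => t₀ + σ * (t - t₀)) (t - t₀) (Icc 0 1) σ := by
      simpa using (((hasDerivAt_id σ).mul_const (t - t₀)).const_add t₀).hasDerivWithinAt
    exact (hd _ (hsub (hmem σ hσ))).scomp σ h1 fun τ hτ => hsub (hmem τ hτ)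
  have key := image_norm_le_of_norm_deriv_right_lt_deriv_boundary
    (f := fun σ => d (t₀ + σ * (t - t₀))) (f' := fun σ => (t - t₀) • d' (t₀ + σ * (t - t₀)))
    (a := 0) (b := 1) (B := fun σ => c * Real.exp (L * |t - t₀| * σ))
    (B' := fun σ => c * (Real.exp (L * |t - t₀| * σ) * (L * |t - t₀|)))
    (fun σ hσ => (hder σ hσ).continuousWithinAt)
    (fun σ hσ => (hder σ ⟨hσ.1, hσ.2.le⟩).mono_of_mem_nhdsWithin
      (Icc_mem_nhdsGE_of_mem hσ)) (by simpa using hc)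
    (fun σ => by
      have := ((hasDerivAt_id σ).const_mul (L * |t - t₀|)).exp.const_mul c
      simpa using this) ?_ (right_mem_Icc.2 zero_le_one)
  · simpa using key
  · intro σ hσ heq
    have hσ' : |t₀ + σ * (t - t₀) - t₀| = |t - t₀| * σ := by
      rw [add_sub_cancel_left, abs_mul, abs_of_nonneg hσ.1, mul_comm]
    have := hb _ (hmem σ ⟨hσ.1, hσ.2.le⟩) (by rw [hσ', heq, mul_assoc])
    rw [hσ', ← mul_assoc L |t - t₀|] at this
    rw [norm_smul, Real.norm_eq_abs]
    calc |t - t₀| * ‖d' (t₀ + σ * (t - t₀))‖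
        < |t - t₀| * (L * (c * Real.exp (L * |t - t₀| * σ))) := by gcongr
      _ = _ := by ring

/-- Lipschitz continuity in space, uniformly for bounded arguments and compact time intervals. -/
def LocLip (J : Set ℝ) (f : ℝ → E → E) : Prop :=
  ∀ a ∈ J, ∀ b ∈ J, ∀ R : ℝ, ∃ L, ∀ t ∈ Icc a b, ∀ x y, ‖x‖ ≤ R → ‖y‖ ≤ R →
    ‖f t x - f t y‖ ≤ L * ‖x - y‖

/-- At most linear growth in space, uniformly on compact time intervals. -/
def LinearGrowth (J : Set ℝ) (f : ℝ → E → E) : Prop :=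
  ∀ a ∈ J, ∀ b ∈ J, ∃ C, ∀ t ∈ Icc a b, ∀ x, ‖f t x‖ ≤ C * (1 + ‖x‖)

theorem LocLip.mono {J J' : Set ℝ} {f : ℝ → E → E} (h : LocLip J f) (hJ : J' ⊆ J) :
    LocLip J' f :=
  fun a ha b hb => h a (hJ ha) b (hJ hb)

theorem exists_norm_le_of_continuousOn {γ : ℝ → E} {a b : ℝ}
    (h : ContinuousOn γ (Icc a b)) : ∃ R, ∀ t ∈ Icc a b, ‖γ t‖ ≤ R :=
  isCompact_Icc.exists_bound_of_continuousOn h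

theorem uIcc_eq_Icc_mem {J : Set ℝ} {s t : ℝ} (hs : s ∈ J) (ht : t ∈ J) :
    ∃ a ∈ J, ∃ b ∈ J, a ≤ b ∧ uIcc s t = Icc a b := by
  rcases le_total s t with h | h
  · exact ⟨s, hs, t, ht, h, uIcc_of_le h⟩
  · exact ⟨t, ht, s, hs, h, uIcc_of_ge h⟩

theorem LocLip.eq_of_isIntegralCurveOn {J : Set ℝ} (hJ : J.OrdConnected) {f : ℝ → E → E}
    (hf : LocLip J f) {γ δ : ℝ → E} (hγ : IsIntegralCurveOn γ f J)
    (hδ : IsIntegralCurveOn δ f J) {t₀ : ℝ} (ht₀ : t₀ ∈ J) (h : γ t₀ = δ t₀) {t : ℝ}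
    (ht : t ∈ J) : γ t = δ t := by
  obtain ⟨a, ha, b, hb, hab, hu⟩ := uIcc_eq_Icc_mem ht₀ ht
  have hsub : Icc a b ⊆ J := hJ.out ha hb
  obtain ⟨R₁, hR₁⟩ := exists_norm_le_of_continuousOn (hγ.continuousOn.mono hsub)
  obtain ⟨R₂, hR₂⟩ := exists_norm_le_of_continuousOn (hδ.continuousOn.mono hsub)
  obtain ⟨L, hL⟩ := hf a ha b hb (max R₁ R₂)
  have key : ∀ c > 0, ‖γ t - δ t‖ ≤ c * Real.exp ((L + 1) * |t - t₀|) := by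
    intro c hc
    refine norm_le_of_deriv_bound (d := fun s => γ s - δ s)
      (d' := fun s => f s (γ s) - f s (δ s)) hJ ht₀ ht
      (fun s hs => (hγ s hs).sub (hδ s hs)) (by simpa [h] using hc.le) ?_
    intro s hs heq
    rw [hu] at hs
    have h1 := hL s hs (γ s) (δ s) ((hR₁ s hs).trans (le_max_left _ _))
      ((hR₂ s hs).trans (le_max_right _ _))
    have h2 : 0 < c * Real.exp ((L + 1) * |s - t₀|) := by positivity
    rw [heq] at h1
    linarith
  have h0 : ‖γ t - δ t‖ ≤ 0 := by
    refine le_of_forall_pos_le_add fun ε hε => ?_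
    have := key (ε / Real.exp ((L + 1) * |t - t₀|)) (by positivity)
    rw [div_mul_cancel₀ _ (Real.exp_pos _).ne'] at this
    simpa using this
  exact sub_eq_zero.1 (norm_le_zero_iff.1 h0)

/-- A Lipschitz cutoff which is `1` on the ball of radius `R` and `0` outside that of radius
`2 * R`. -/
def radialCutoff (R : ℝ) (x : E) : ℝ := max 0 (min 1 (2 - ‖x‖ / R))

theorem radialCutoff_nonneg (R : ℝ) (x : E) : 0 ≤ radialCutoff R x := le_max_left _ _

theorem radialCutoff_le_one (R : ℝ) (x : E) : radialCutoff R x ≤ 1 :=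
  max_le zero_le_one (min_le_left _ _)

theorem radialCutoff_eq_one {R : ℝ} (hR : 0 < R) {x : E} (hx : ‖x‖ ≤ R) :
    radialCutoff R x = 1 := by
  have : ‖x‖ / R ≤ 1 := (div_le_one hR).2 hx
  rw [radialCutoff, min_eq_left (by linarith), max_eq_right zero_le_one]

theorem radialCutoff_eq_zero {R : ℝ} (hR : 0 < R) {x : E} (hx : 2 * R ≤ ‖x‖) :
    radialCutoff R x = 0 := by
  have : 2 ≤ ‖x‖ / R := (le_div_iff₀ hR).2 hx
  rw [radialCutoff, max_eq_left ((min_le_right _ _).trans (by linarith))]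

theorem abs_radialCutoff_sub_le {R : ℝ} (hR : 0 < R) (x y : E) :
    |radialCutoff R x - radialCutoff R y| ≤ R⁻¹ * ‖x - y‖ := by
  calc |radialCutoff R x - radialCutoff R y|
      ≤ |min 1 (2 - ‖x‖ / R) - min 1 (2 - ‖y‖ / R)| := by
        simpa [radialCutoff, max_comm] using
          abs_max_sub_max_le_abs (min 1 (2 - ‖x‖ / R)) (min 1 (2 - ‖y‖ / R)) 0
    _ ≤ |(2 - ‖x‖ / R) - (2 - ‖y‖ / R)| := by
        have := abs_min_sub_min_le_max 1 (2 - ‖x‖ / R) 1 (2 - ‖y‖ / R)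
        simpa using this
    _ = R⁻¹ * |‖x‖ - ‖y‖| := by
        rw [show (2 - ‖x‖ / R) - (2 - ‖y‖ / R) = -(R⁻¹ * (‖x‖ - ‖y‖)) by ring, abs_neg, abs_mul,
          abs_of_pos (inv_pos.2 hR)]
    _ ≤ R⁻¹ * ‖x - y‖ := by
        gcongr
        exact abs_norm_sub_norm_le x y

theorem exists_isIntegralCurveOn_Icc [CompleteSpace E] {a b t₀ : ℝ} {f : ℝ → E → E}
    (ht₀ : t₀ ∈ Icc a b) (hc : ∀ x, ContinuousOn (fun t => f t x) (Icc a b))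
    (hl : LocLip (Icc a b) f) (hg : LinearGrowth (Icc a b) f) (x₀ : E) :
    ∃ γ : ℝ → E, γ t₀ = x₀ ∧ IsIntegralCurveOn γ f (Icc a b) := by
  have hab : a ≤ b := ht₀.1.trans ht₀.2
  obtain ⟨C', hC'⟩ := hg a (left_mem_Icc.2 hab) b (right_mem_Icc.2 hab)
  obtain ⟨C, hC0, hC⟩ : ∃ C, 0 ≤ C ∧ ∀ t ∈ Icc a b, ∀ x, ‖f t x‖ ≤ C * (1 + ‖x‖) :=
    ⟨max C' 0, le_max_right _ _, fun t ht x => (hC' t ht x).trans (by gcongr; exact le_max_left _ _)⟩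
  set R : ℝ := (‖x₀‖ + 1) * Real.exp ((2 * C + 1) * (b - a)) with hR
  have hRpos : 0 < R := by positivity
  set B : ℝ := C * (1 + 2 * R) with hB
  have hB0 : 0 ≤ B := by positivity
  have hba : 0 ≤ b - a := sub_nonneg.2 hab
  set ρ : ℝ := B * (b - a) with hρ
  have hρ0 : 0 ≤ ρ := mul_nonneg hB0 hba
  set R₂ : ℝ := ‖x₀‖ + ρ with hR₂
  obtain ⟨L', hL'⟩ := hl a (left_mem_Icc.2 hab) b (right_mem_Icc.2 hab) R₂
  obtain ⟨L, hL0, hL⟩ : ∃ L, 0 ≤ L ∧ ∀ t ∈ Icc a b, ∀ x y, ‖x‖ ≤ R₂ → ‖y‖ ≤ R₂ →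
      ‖f t x - f t y‖ ≤ L * ‖x - y‖ :=
    ⟨max L' 0, le_max_right _ _, fun t ht x y hx hy =>
      (hL' t ht x y hx hy).trans (by gcongr; exact le_max_left _ _)⟩
  set g : ℝ → E → E := fun t x => radialCutoff R x • f t x with hgdef
  have hgB : ∀ t ∈ Icc a b, ∀ x, ‖g t x‖ ≤ B := by
    intro t ht x
    rcases le_total ‖x‖ (2 * R) with h | h
    · calc ‖g t x‖ = radialCutoff R x * ‖f t x‖ := by
            rw [hgdef, norm_smul, Real.norm_of_nonneg (radialCutoff_nonneg R x)]
        _ ≤ 1 * (C * (1 + 2 * R)) := by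
            gcongr
            · exact radialCutoff_le_one R x
            · exact (hC t ht x).trans (by gcongr)
        _ = B := one_mul _
    · simpa [hgdef, radialCutoff_eq_zero hRpos h] using hB0
  set K : ℝ := L + R⁻¹ * (C * (1 + R₂)) with hK
  have hK0 : 0 ≤ K := by positivity
  have hpl : IsPicardLindelof g (tmin := a) (tmax := b) ⟨t₀, ht₀⟩ x₀ ⟨ρ, hρ0⟩ 0 ⟨B, hB0⟩
      ⟨K, hK0⟩ := by
    refine ⟨fun t ht => ?_, fun x _ => (hc x).const_smul _, fun t ht x _ => hgB t ht x, ?_⟩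
    · refine LipschitzOnWith.of_dist_le_mul fun x hx y hy => ?_
      have hb : ∀ z ∈ Metric.closedBall x₀ ρ, ‖z‖ ≤ R₂ := by
        intro z hz
        have h1 : ‖z - x₀‖ ≤ ρ := mem_closedBall_iff_norm.1 hz
        calc ‖z‖ = ‖x₀ + (z - x₀)‖ := by rw [add_sub_cancel]
          _ ≤ ‖x₀‖ + ‖z - x₀‖ := norm_add_le _ _
          _ ≤ R₂ := by rw [hR₂]; gcongr
      have hx' := hb x hx
      have hy' := hb y hy
      rw [dist_eq_norm, dist_eq_norm]
      have : g t x - g t y = radialCutoff R x • (f t x - f t y) +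
          (radialCutoff R x - radialCutoff R y) • f t y := by
        simp only [hgdef]
        module
      rw [this]
      calc _ ≤ ‖radialCutoff R x • (f t x - f t y)‖ +
            ‖(radialCutoff R x - radialCutoff R y) • f t y‖ := norm_add_le _ _
        _ ≤ 1 * (L * ‖x - y‖) + (R⁻¹ * ‖x - y‖) * (C * (1 + R₂)) := by
            rw [norm_smul, norm_smul, Real.norm_of_nonneg (radialCutoff_nonneg R x),
              Real.norm_eq_abs]
            gcongr
            · exact radialCutoff_le_one R x
            · exact hL t ht x y hx' hy'
            · exact abs_radialCutoff_sub_le hRpos x y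
            · exact (hC t ht y).trans (by gcongr)
        _ = K * ‖x - y‖ := by rw [hK]; ring
    · show B * max (b - t₀) (t₀ - a) ≤ ρ - ((0 : ℝ≥0) : ℝ)
      rw [hρ, NNReal.coe_zero, sub_zero]
      gcongr
      exact max_le (by linarith [ht₀.1]) (by linarith [ht₀.2])
  obtain ⟨γ, hγ0, hγ⟩ := hpl.exists_eq_forall_mem_Icc_hasDerivWithinAt₀
  refine ⟨γ, hγ0, fun t ht => ?_⟩
  have hle : ‖γ t‖ ≤ R := by
    have hfence := norm_le_of_deriv_bound (J := Icc a b) (d := γ) (d' := fun s => g s (γ s))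
      ordConnected_Icc ht₀ ht hγ (c := ‖x₀‖ + 1) (L := 2 * C + 1)
      (by simp only at hγ0; rw [hγ0]; linarith) ?_
    · refine hfence.trans ?_
      rw [hR]
      gcongr
      rw [abs_le]
      constructor <;> linarith [ht.1, ht.2, ht₀.1, ht₀.2]
    · intro s hs heq
      have hs' : s ∈ Icc a b := ordConnected_Icc.uIcc_subset ht₀ ht hs
      have h1 : 1 ≤ (‖x₀‖ + 1) * Real.exp ((2 * C + 1) * |s - t₀|) := by
        have h2 : 1 ≤ Real.exp ((2 * C + 1) * |s - t₀|) := Real.one_le_exp (by positivity)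
        nlinarith [norm_nonneg x₀]
      calc ‖g s (γ s)‖ = radialCutoff R (γ s) * ‖f s (γ s)‖ := by
            rw [hgdef, norm_smul, Real.norm_of_nonneg (radialCutoff_nonneg R _)]
        _ ≤ 1 * (C * (1 + ‖γ s‖)) := by
            gcongr
            · exact radialCutoff_le_one R _
            · exact hC s hs' _
        _ < _ := by rw [heq]; nlinarith
  have := hγ t ht
  simp only [hgdef, radialCutoff_eq_one hRpos hle, one_smul] at this
  exact this

theorem exists_Icc_mem_nhdsWithin {J : Set ℝ} {t₀ t : ℝ} (ht₀ : t₀ ∈ J) (ht : t ∈ J) :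
    ∃ a ∈ J, ∃ b ∈ J, t₀ ∈ Icc a b ∧ t ∈ Icc a b ∧ Icc a b ∈ 𝓝[J] t := by
  have hlow : ∃ a ∈ J, a ≤ t₀ ∧ a ≤ t ∧ Ici a ∈ 𝓝[J] t := by
    by_cases h : ∃ s ∈ J, s < min t₀ t
    · obtain ⟨s, hs, hlt⟩ := h
      exact ⟨s, hs, (hlt.trans_le (min_le_left _ _)).le, (hlt.trans_le (min_le_right _ _)).le,
        mem_nhdsWithin_of_mem_nhds (Ici_mem_nhds (hlt.trans_le (min_le_right _ _)))⟩
    · push Not at h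
      refine ⟨min t₀ t, ?_, min_le_left _ _, min_le_right _ _,
        mem_of_superset self_mem_nhdsWithin fun s hs => h s hs⟩
      rcases min_choice t₀ t with h | h <;> rw [h] <;> assumption
  have hupp : ∃ b ∈ J, t₀ ≤ b ∧ t ≤ b ∧ Iic b ∈ 𝓝[J] t := by
    by_cases h : ∃ s ∈ J, max t₀ t < s
    · obtain ⟨s, hs, hlt⟩ := h
      exact ⟨s, hs, ((le_max_left _ _).trans_lt hlt).le, ((le_max_right _ _).trans_lt hlt).le,
        mem_nhdsWithin_of_mem_nhds (Iic_mem_nhds ((le_max_right _ _).trans_lt hlt))⟩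
    · push Not at h
      refine ⟨max t₀ t, ?_, le_max_left _ _, le_max_right _ _,
        mem_of_superset self_mem_nhdsWithin fun s hs => h s hs⟩
      rcases max_choice t₀ t with h | h <;> rw [h] <;> assumption
  obtain ⟨a, ha, h1, h2, h3⟩ := hlow
  obtain ⟨b, hb, h4, h5, h6⟩ := hupp
  exact ⟨a, ha, b, hb, ⟨h1, h4⟩, ⟨h2, h5⟩, inter_mem h3 h6⟩

theorem exists_isIntegralCurveOn [CompleteSpace E] {J : Set ℝ} (hJ : J.OrdConnected) {t₀ : ℝ}
    (ht₀ : t₀ ∈ J) {f : ℝ → E → E} (hc : ∀ x, ContinuousOn (fun t => f t x) J)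
    (hl : LocLip J f) (hg : LinearGrowth J f) (x₀ : E) :
    ∃ γ : ℝ → E, γ t₀ = x₀ ∧ IsIntegralCurveOn γ f J := by
  have hex : ∀ a b : ℝ, ∃ γ : ℝ → E, a ∈ J → b ∈ J → t₀ ∈ Icc a b →
      γ t₀ = x₀ ∧ IsIntegralCurveOn γ f (Icc a b) := by
    intro a b
    by_cases h : a ∈ J ∧ b ∈ J ∧ t₀ ∈ Icc a b
    · have hsub : Icc a b ⊆ J := hJ.out h.1 h.2.1
      obtain ⟨γ, hγ⟩ := exists_isIntegralCurveOn_Icc h.2.2 (fun x => (hc x).mono hsub)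
        (hl.mono hsub) (fun c hc d hd => hg c (hsub hc) d (hsub hd)) x₀
      exact ⟨γ, fun _ _ _ => hγ⟩
    · exact ⟨0, fun h1 h2 h3 => absurd ⟨h1, h2, h3⟩ h⟩
  choose Γ hΓ using hex
  have hminmax : ∀ t ∈ J, min t₀ t ∈ J ∧ max t₀ t ∈ J ∧ t₀ ∈ Icc (min t₀ t) (max t₀ t) ∧
      t ∈ Icc (min t₀ t) (max t₀ t) := by
    intro t ht
    refine ⟨?_, ?_, ⟨min_le_left _ _, le_max_left _ _⟩, ⟨min_le_right _ _, le_max_right _ _⟩⟩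
    · rcases min_choice t₀ t with h | h <;> rw [h] <;> assumption
    · rcases max_choice t₀ t with h | h <;> rw [h] <;> assumption
  have heq : ∀ a ∈ J, ∀ b ∈ J, t₀ ∈ Icc a b → ∀ t ∈ Icc a b,
      Γ (min t₀ t) (max t₀ t) t = Γ a b t := by
    intro a ha b hb h0 t ht
    have htJ : t ∈ J := hJ.out ha hb ht
    obtain ⟨h1, h2, h3, h4⟩ := hminmax t htJ
    have hsub : Icc (min t₀ t) (max t₀ t) ⊆ Icc a b :=
      Icc_subset_Icc (le_min h0.1 ht.1) (max_le h0.2 ht.2)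
    refine LocLip.eq_of_isIntegralCurveOn ordConnected_Icc (hl.mono (hJ.out h1 h2))
      (hΓ _ _ h1 h2 h3).2 ((hΓ a b ha hb h0).2.mono hsub) h3 ?_ h4
    rw [(hΓ _ _ h1 h2 h3).1, (hΓ a b ha hb h0).1]
  refine ⟨fun t => Γ (min t₀ t) (max t₀ t) t, ?_, fun t ht => ?_⟩
  · obtain ⟨h1, h2, h3, -⟩ := hminmax t₀ ht₀
    exact (hΓ _ _ h1 h2 h3).1
  · obtain ⟨a, ha, b, hb, h0, h1, h2⟩ := exists_Icc_mem_nhdsWithin ht₀ ht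
    simp only [heq a ha b hb h0 t h1]
    refine (((hΓ a b ha hb h0).2 t h1).mono_of_mem_nhdsWithin h2).congr_of_eventuallyEq
      (mem_of_superset h2 fun s hs => heq a ha b hb h0 s hs) (heq a ha b hb h0 t h1)

end ODE

section PartialDerivatives

variable {E : Type*} [NormedAddCommGroup E] [NormedSpace ℝ E]
  {G : Type*} [NormedAddCommGroup G] [NormedSpace ℝ G] {J : Set ℝ} {U : Set E}

theorem interior_nonempty_of_ordConnected (hJ : J.OrdConnected) (hJ' : J.Nontrivial) :
    (interior J).Nonempty := by
  obtain ⟨a, ha, b, hb, hab⟩ := hJ'.exists_lt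
  refine (nonempty_Ioo.2 hab).mono (interior_maximal ?_ isOpen_Ioo)
  exact Ioo_subset_Icc_self.trans (hJ.out ha hb)

theorem uniqueDiffOn_of_ordConnected (hJ : J.OrdConnected) (hJ' : J.Nontrivial) :
    UniqueDiffOn ℝ J :=
  uniqueDiffOn_convex hJ.convex (interior_nonempty_of_ordConnected hJ hJ')

theorem uniqueDiffOn_prod_of_ordConnected (hJ : J.OrdConnected) (hJ' : J.Nontrivial)
    (hU : IsOpen U) : UniqueDiffOn ℝ (J ×ˢ U) :=
  (uniqueDiffOn_of_ordConnected hJ hJ').prod hU.uniqueDiffOn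

/-- The partial derivative with respect to time of a function on `J × U`. -/
def timeDeriv (J : Set ℝ) (U : Set E) (g : ℝ × E → G) (p : ℝ × E) : G :=
  fderivWithin ℝ g (J ×ˢ U) p (1, 0)

/-- The partial derivative with respect to space of a function on `J × U`. -/
def spaceDeriv (J : Set ℝ) (U : Set E) (g : ℝ × E → G) (p : ℝ × E) : E →L[ℝ] G :=
  (fderivWithin ℝ g (J ×ˢ U) p).comp (ContinuousLinearMap.inr ℝ ℝ E)

theorem hasDerivWithinAt_timeDeriv {g : ℝ × E → G} {p : ℝ × E}
    (hg : DifferentiableWithinAt ℝ g (J ×ˢ U) p) (hp : p ∈ J ×ˢ U) :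
    HasDerivWithinAt (fun s => g (s, p.2)) (timeDeriv J U g p) J p.1 := by
  have h1 : HasDerivWithinAt (fun s : ℝ => (s, p.2)) ((1 : ℝ), (0 : E)) J p.1 :=
    (hasDerivWithinAt_id _ _).prodMk (hasDerivWithinAt_const _ _ _)
  exact HasFDerivWithinAt.comp_hasDerivWithinAt (x := p.1) (t := J ×ˢ U)
    (hg.hasFDerivWithinAt) h1 fun s hs => ⟨hs, hp.2⟩

theorem hasFDerivAt_spaceDeriv {g : ℝ × E → G} {p : ℝ × E} (hU : IsOpen U)
    (hg : DifferentiableWithinAt ℝ g (J ×ˢ U) p) (hp : p ∈ J ×ˢ U) :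
    HasFDerivAt (fun z => g (p.1, z)) (spaceDeriv J U g p) p.2 := by
  have h1 : HasFDerivWithinAt (fun z : E => (p.1, z)) (ContinuousLinearMap.inr ℝ ℝ E) U p.2 :=
    (hasFDerivAt_prodMk_right p.1 p.2).hasFDerivWithinAt
  exact (HasFDerivWithinAt.comp (x := p.2) (t := J ×ˢ U) hg.hasFDerivWithinAt h1
    fun z hz => ⟨hp.1, hz⟩).hasFDerivAt (hU.mem_nhds hp.2)

theorem contDiffOn_timeDeriv (hJ : J.OrdConnected) (hJ' : J.Nontrivial) (hU : IsOpen U)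
    {g : ℝ × E → G} {n m : ℕ∞ω} (hg : ContDiffOn ℝ n g (J ×ˢ U)) (hm : m + 1 ≤ n) :
    ContDiffOn ℝ m (timeDeriv J U g) (J ×ˢ U) :=
  (hg.fderivWithin (uniqueDiffOn_prod_of_ordConnected hJ hJ' hU) hm).clm_apply contDiffOn_const

theorem contDiffOn_spaceDeriv (hJ : J.OrdConnected) (hJ' : J.Nontrivial) (hU : IsOpen U)
    {g : ℝ × E → G} {n m : ℕ∞ω} (hg : ContDiffOn ℝ n g (J ×ˢ U)) (hm : m + 1 ≤ n) :
    ContDiffOn ℝ m (spaceDeriv J U g) (J ×ˢ U) :=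
  (hg.fderivWithin (uniqueDiffOn_prod_of_ordConnected hJ hJ' hU) hm).clm_comp contDiffOn_const

theorem hasFDerivWithinAt_of_partials {g g₁ : ℝ × E → G} {g₂ : ℝ × E → E →L[ℝ] G}
    (hU : IsOpen U) {p : ℝ × E} (hp : p ∈ J ×ˢ U)
    (h₁ : HasDerivWithinAt (fun s => g (s, p.2)) (g₁ p) J p.1)
    (h₂ : ∀ q ∈ J ×ˢ U, HasFDerivAt (fun z => g (q.1, z)) (g₂ q) q.2)
    (hc : ContinuousWithinAt g₂ (J ×ˢ U) p) :
    HasFDerivWithinAt g ((ContinuousLinearMap.toSpanSingleton ℝ (g₁ p)).coprod (g₂ p))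
      (J ×ˢ U) p := by
  rw [hasFDerivWithinAt_iff_isLittleO]
  have hfst : Tendsto (fun q : ℝ × E => q.1) (𝓝[J ×ˢ U] p) (𝓝[J] p.1) :=
    tendsto_nhdsWithin_of_tendsto_nhds_of_eventually_within _
      (continuous_fst.continuousAt.mono_left nhdsWithin_le_nhds)
      (eventually_nhdsWithin_of_forall fun q hq => hq.1)
  have hsnd : Tendsto (fun q : ℝ × E => q.2) (𝓝[J ×ˢ U] p) (𝓝 p.2) :=
    continuous_snd.continuousAt.mono_left nhdsWithin_le_nhds
  have A : (fun q : ℝ × E => g (q.1, q.2) - g (q.1, p.2) - g₂ p (q.2 - p.2))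
      =o[𝓝[J ×ˢ U] p] fun q => q.2 - p.2 := by
    rw [Asymptotics.isLittleO_iff]
    intro ε hε
    have hev : ∀ᶠ r in 𝓝[J ×ˢ U] p, ‖g₂ r - g₂ p‖ ≤ ε := by
      filter_upwards [hc.eventually (Metric.closedBall_mem_nhds _ hε)] with r hr
      simpa [dist_eq_norm] using hr
    obtain ⟨δ, hδ, hball⟩ := Metric.mem_nhdsWithin_iff.1 hev
    obtain ⟨δ', hδ', hU'⟩ := Metric.mem_nhds_iff.1 (hU.mem_nhds hp.2)
    have hr : 0 < min δ δ' := lt_min hδ hδ'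
    filter_upwards [mem_nhdsWithin_of_mem_nhds (Metric.ball_mem_nhds p hr),
      self_mem_nhdsWithin] with q hq hqS
    rw [Metric.mem_ball, Prod.dist_eq, max_lt_iff] at hq
    have hz : ∀ z ∈ Metric.ball p.2 (min δ δ'), (q.1, z) ∈ J ×ˢ U := fun z hz =>
      ⟨hqS.1, hU' (Metric.ball_subset_ball (min_le_right _ _) hz)⟩
    refine Convex.norm_image_sub_le_of_norm_hasFDerivWithin_le' (f := fun z => g (q.1, z))
      (f' := fun z => g₂ (q.1, z)) (s := Metric.ball p.2 (min δ δ'))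
      (fun z hz' => (h₂ (q.1, z) (hz z hz')).hasFDerivWithinAt) ?_ (convex_ball _ _)
      (Metric.mem_ball_self hr) hq.2
    intro z hz'
    refine hball ⟨?_, hz z hz'⟩
    rw [Metric.mem_ball, Prod.dist_eq, max_lt_iff]
    exact ⟨hq.1.trans_le (min_le_left _ _), (Metric.mem_ball.1 hz').trans_le (min_le_left _ _)⟩
  have B := (hasDerivWithinAt_iff_isLittleO.1 h₁).comp_tendsto hfst
  have A' : (fun q : ℝ × E => g (q.1, q.2) - g (q.1, p.2) - g₂ p (q.2 - p.2))
      =o[𝓝[J ×ˢ U] p] fun q => q - p :=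
    A.trans_isBigO (Asymptotics.isBigO_of_le _ fun q => norm_snd_le (q - p))
  have B' : (fun q : ℝ × E => g (q.1, p.2) - g (p.1, p.2) - (q.1 - p.1) • g₁ p)
      =o[𝓝[J ×ˢ U] p] fun q => q - p :=
    B.trans_isBigO (Asymptotics.isBigO_of_le _ fun q => norm_fst_le (q - p))
  refine (A'.add B').congr_left fun q => ?_
  simp only [ContinuousLinearMap.coprod_apply, ContinuousLinearMap.toSpanSingleton_apply,
    Prod.fst_sub, Prod.snd_sub]
  abel

theorem contDiffOn_succ_of_partials (hJ : J.OrdConnected) (hJ' : J.Nontrivial) (hU : IsOpen U)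
    {g g₁ : ℝ × E → G} {g₂ : ℝ × E → E →L[ℝ] G} {n : ℕ}
    (h₁ : ∀ p ∈ J ×ˢ U, HasDerivWithinAt (fun s => g (s, p.2)) (g₁ p) J p.1)
    (h₂ : ∀ p ∈ J ×ˢ U, HasFDerivAt (fun z => g (p.1, z)) (g₂ p) p.2)
    (hg₁ : ContDiffOn ℝ n g₁ (J ×ˢ U)) (hg₂ : ContDiffOn ℝ n g₂ (J ×ˢ U)) :
    ContDiffOn ℝ (n + 1) g (J ×ˢ U) := by
  rw [contDiffOn_succ_iff_hasFDerivWithinAt_of_uniqueDiffOn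
    (uniqueDiffOn_prod_of_ordConnected hJ hJ' hU)]
  refine ⟨fun h => absurd h (by simp), _, ?_, fun p hp => hasFDerivWithinAt_of_partials hU hp
    (h₁ p hp) h₂ (hg₂.continuousOn p hp)⟩
  have e1 : ContDiffOn ℝ n (fun p => (ContinuousLinearMap.toSpanSingleton ℝ (g₁ p)).comp
      (ContinuousLinearMap.fst ℝ ℝ E) + (g₂ p).comp (ContinuousLinearMap.snd ℝ ℝ E))
      (J ×ˢ U) := by
    refine ContDiffOn.add (ContDiffOn.clm_comp ?_ contDiffOn_const)
      (hg₂.clm_comp contDiffOn_const)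
    exact (ContinuousLinearMap.toSpanSingletonCLE (𝕜 := ℝ) (E := G)
      |>.toContinuousLinearMap.contDiff).comp_contDiffOn hg₁
  exact e1.congr fun p _ => by ext <;> simp

end PartialDerivatives

section SmoothDependence

variable {E : Type*} [NormedAddCommGroup E] [NormedSpace ℝ E] [FiniteDimensional ℝ E]
  {J : Set ℝ}

theorem exists_spaceDeriv_bound (hJ : J.OrdConnected) (hJ' : J.Nontrivial) {f : ℝ → E → E}
    (hf : ContDiffOn ℝ 1 (fun p : ℝ × E => f p.1 p.2) (J ×ˢ univ)) {a b : ℝ} (ha : a ∈ J)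
    (hb : b ∈ J) (R : ℝ) : ∃ L, 0 ≤ L ∧ ∀ t ∈ Icc a b, ∀ x, ‖x‖ ≤ R →
      ‖spaceDeriv J univ (fun p : ℝ × E => f p.1 p.2) (t, x)‖ ≤ L := by
  have hc := (contDiffOn_spaceDeriv (m := 0) hJ hJ' isOpen_univ hf (by simp)).continuousOn
  have hK : IsCompact (Icc a b ×ˢ Metric.closedBall (0 : E) R) :=
    isCompact_Icc.prod (isCompact_closedBall 0 R)
  obtain ⟨L, hL⟩ := hK.exists_bound_of_continuousOn
    (hc.mono (prod_mono (hJ.out ha hb) (subset_univ _)))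
  exact ⟨max L 0, le_max_right _ _, fun t ht x hx =>
    (hL (t, x) ⟨ht, by simpa using hx⟩).trans (le_max_left _ _)⟩

theorem locLip_of_contDiffOn (hJ : J.OrdConnected) (hJ' : J.Nontrivial) {f : ℝ → E → E}
    (hf : ContDiffOn ℝ 1 (fun p : ℝ × E => f p.1 p.2) (J ×ˢ univ)) : LocLip J f := by
  intro a ha b hb R
  obtain ⟨L, -, hL⟩ := exists_spaceDeriv_bound hJ hJ' hf ha hb R
  refine ⟨L, fun t ht x y hx hy => ?_⟩
  have hB : ∀ z ∈ Metric.closedBall (0 : E) R, HasFDerivWithinAt (f t)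
      (spaceDeriv J univ (fun p : ℝ × E => f p.1 p.2) (t, z)) (Metric.closedBall (0 : E) R) z :=
    fun z _ => (hasFDerivAt_spaceDeriv (p := (t, z)) isOpen_univ
      (hf.differentiableOn one_ne_zero (t, z) ⟨hJ.out ha hb ht, trivial⟩)
      ⟨hJ.out ha hb ht, trivial⟩).hasFDerivWithinAt
  exact (convex_closedBall (0 : E) R).norm_image_sub_le_of_norm_hasFDerivWithin_le hB
    (fun z hz => hL t ht z (by simpa using hz)) (by simpa using hy) (by simpa using hx)

/-- `Φ t x` is the value at time `t` of the solution starting in `x` at time `t₀`. -/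
structure IsFlow (J : Set ℝ) (t₀ : ℝ) (f Φ : ℝ → E → E) : Prop where
  init : ∀ x, Φ t₀ x = x
  curve : ∀ x, IsIntegralCurveOn (fun t => Φ t x) f J

variable {t₀ : ℝ} {f Φ : ℝ → E → E}

theorem IsFlow.exists_dist_le (h : IsFlow J t₀ f Φ) (hJ : J.OrdConnected) (hJ' : J.Nontrivial)
    (hf : ContDiffOn ℝ 1 (fun p : ℝ × E => f p.1 p.2) (J ×ˢ univ)) {a b : ℝ} (ha : a ∈ J)
    (hb : b ∈ J) (ht₀ : t₀ ∈ Icc a b) (x₀ : E) :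
    ∃ C, 0 < C ∧ ∃ δ > 0, ∀ x, ‖x - x₀‖ < δ → ∀ t ∈ Icc a b,
      ‖Φ t x - Φ t x₀‖ ≤ C * ‖x - x₀‖ := by
  have hsub : Icc a b ⊆ J := hJ.out ha hb
  obtain ⟨R, hR⟩ := exists_norm_le_of_continuousOn ((h.curve x₀).continuousOn.mono hsub)
  obtain ⟨L', hL'⟩ := locLip_of_contDiffOn hJ hJ' hf a ha b hb (R + 1)
  obtain ⟨L, hL0, hL⟩ : ∃ L, 0 ≤ L ∧ ∀ t ∈ Icc a b, ∀ x y, ‖x‖ ≤ R + 1 → ‖y‖ ≤ R + 1 →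
      ‖f t x - f t y‖ ≤ L * ‖x - y‖ :=
    ⟨max L' 0, le_max_right _ _, fun t ht x y hx hy =>
      (hL' t ht x y hx hy).trans (by gcongr; exact le_max_left _ _)⟩
  set C := Real.exp ((L + 1) * (b - a)) with hC
  have hCpos : 0 < C := Real.exp_pos _
  refine ⟨C, hCpos, 1 / C, by positivity, fun x hx t ht => ?_⟩
  rcases eq_or_ne x x₀ with rfl | hne
  · simp
  have hxpos : 0 < ‖x - x₀‖ := norm_pos_iff.2 (sub_ne_zero.2 hne)
  have hle : ∀ s ∈ Icc a b, Real.exp ((L + 1) * |s - t₀|) ≤ C := by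
    intro s hs
    rw [hC]
    gcongr
    rw [abs_le]
    constructor <;> linarith [hs.1, hs.2, ht₀.1, ht₀.2]
  have key := norm_le_of_deriv_bound (J := Icc a b) (d := fun s => Φ s x - Φ s x₀)
    (d' := fun s => f s (Φ s x) - f s (Φ s x₀)) (c := ‖x - x₀‖) (L := L + 1) ordConnected_Icc ht₀ ht
    (fun s hs => ((h.curve x s (hsub hs)).sub (h.curve x₀ s (hsub hs))).mono hsub)
    (by simp [h.init]) ?_
  · exact key.trans (by rw [mul_comm]; gcongr; exact hle t ht)
  · intro s hs heq
    have hs' : s ∈ Icc a b := ordConnected_Icc.uIcc_subset ht₀ ht hs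
    have h1 : ‖Φ s x - Φ s x₀‖ ≤ 1 := by
      rw [heq]
      calc _ ≤ 1 / C * C := by gcongr; exact hle s hs'
        _ = 1 := by field_simp
    have h2 : ‖Φ s x‖ ≤ R + 1 := by
      calc ‖Φ s x‖ = ‖Φ s x₀ + (Φ s x - Φ s x₀)‖ := by rw [add_sub_cancel]
        _ ≤ ‖Φ s x₀‖ + ‖Φ s x - Φ s x₀‖ := norm_add_le _ _
        _ ≤ R + 1 := add_le_add (hR s hs') h1
    have h3 := hL s hs' _ _ h2 ((hR s hs').trans (by linarith))
    rw [heq] at h3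
    have : 0 < ‖x - x₀‖ * Real.exp ((L + 1) * |s - t₀|) := by positivity
    linarith

theorem IsFlow.continuousOn (h : IsFlow J t₀ f Φ) (hJ : J.OrdConnected) (hJ' : J.Nontrivial)
    (ht₀ : t₀ ∈ J) (hf : ContDiffOn ℝ 1 (fun p : ℝ × E => f p.1 p.2) (J ×ˢ univ)) :
    ContinuousOn (fun p : ℝ × E => Φ p.1 p.2) (J ×ˢ univ) := by
  rintro ⟨t, x₀⟩ ⟨ht, -⟩
  obtain ⟨a, ha, b, hb, h0, h1, h2⟩ := exists_Icc_mem_nhdsWithin ht₀ ht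
  obtain ⟨C, hC, δ, hδ, hle⟩ := h.exists_dist_le hJ hJ' hf ha hb h0 x₀
  have hfst : Tendsto (fun q : ℝ × E => q.1) (𝓝[J ×ˢ univ] (t, x₀)) (𝓝[J] t) :=
    tendsto_nhdsWithin_of_tendsto_nhds_of_eventually_within _
      (continuous_fst.continuousAt.mono_left nhdsWithin_le_nhds)
      (eventually_nhdsWithin_of_forall fun q hq => hq.1)
  have hsnd : Tendsto (fun q : ℝ × E => q.2) (𝓝[J ×ˢ univ] (t, x₀)) (𝓝 x₀) :=
    continuous_snd.continuousAt.mono_left nhdsWithin_le_nhds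
  have A : Tendsto (fun q : ℝ × E => Φ q.1 x₀) (𝓝[J ×ˢ univ] (t, x₀)) (𝓝 (Φ t x₀)) :=
    ((h.curve x₀).continuousOn t ht).tendsto.comp hfst
  have B : Tendsto (fun q : ℝ × E => Φ q.1 q.2 - Φ q.1 x₀) (𝓝[J ×ˢ univ] (t, x₀)) (𝓝 0) := by
    have hn : Tendsto (fun q : ℝ × E => ‖q.2 - x₀‖) (𝓝[J ×ˢ univ] (t, x₀)) (𝓝 0) := by
      simpa using (hsnd.sub_const x₀).norm
    refine squeeze_zero_norm' (a := fun q : ℝ × E => C * ‖q.2 - x₀‖) ?_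
      (by simpa using hn.const_mul C)
    filter_upwards [hfst.eventually h2, hn.eventually (gt_mem_nhds hδ)] with q hq1 hq2
    exact hle q.2 hq2 q.1 hq1
  have := A.add B
  simpa [ContinuousWithinAt] using this

theorem exists_resolvent (hJ : J.OrdConnected) (ht₀ : t₀ ∈ J) {A : ℝ → E →L[ℝ] E}
    (hA : ContinuousOn A J) :
    ∃ W : ℝ → E →L[ℝ] E, W t₀ = ContinuousLinearMap.id ℝ E ∧
      IsIntegralCurveOn W (fun t w => (A t).comp w) J := by
  have hbd : ∀ a ∈ J, ∀ b ∈ J, ∃ C, 0 ≤ C ∧ ∀ t ∈ Icc a b, ‖A t‖ ≤ C := by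
    intro a ha b hb
    obtain ⟨C, hC⟩ := isCompact_Icc.exists_bound_of_continuousOn (hA.mono (hJ.out ha hb))
    exact ⟨max C 0, le_max_right _ _, fun t ht => (hC t ht).trans (le_max_left _ _)⟩
  refine exists_isIntegralCurveOn hJ ht₀ (fun w => hA.clm_comp continuousOn_const) ?_ ?_ _
  · intro a ha b hb R
    obtain ⟨C, -, hC⟩ := hbd a ha b hb
    refine ⟨C, fun t ht x y _ _ => ?_⟩
    rw [← ContinuousLinearMap.comp_sub]
    exact (ContinuousLinearMap.opNorm_comp_le _ _).trans (by gcongr; exact hC t ht)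
  · intro a ha b hb
    obtain ⟨C, hC0, hC⟩ := hbd a ha b hb
    refine ⟨C, fun t ht w => (ContinuousLinearMap.opNorm_comp_le _ _).trans ?_⟩
    gcongr
    · exact hC t ht
    · linarith

theorem IsFlow.hasFDerivAt (h : IsFlow J t₀ f Φ) (hJ : J.OrdConnected) (hJ' : J.Nontrivial)
    (ht₀ : t₀ ∈ J) (hf : ContDiffOn ℝ 1 (fun p : ℝ × E => f p.1 p.2) (J ×ˢ univ)) {x₀ : E}
    {W : ℝ → E →L[ℝ] E} (hW₀ : W t₀ = ContinuousLinearMap.id ℝ E)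
    (hW : IsIntegralCurveOn W
      (fun t w => (spaceDeriv J univ (fun p : ℝ × E => f p.1 p.2) (t, Φ t x₀)).comp w) J)
    {t : ℝ} (ht : t ∈ J) : HasFDerivAt (Φ t) (W t) x₀ := by
  obtain ⟨a, ha, b, hb, h0, h1, -⟩ := exists_Icc_mem_nhdsWithin ht₀ ht
  have hsub : Icc a b ⊆ J := hJ.out ha hb
  obtain ⟨C, hC, δ₁, hδ₁, hle⟩ := h.exists_dist_le hJ hJ' hf ha hb h0 x₀
  set D := spaceDeriv J univ (fun p : ℝ × E => f p.1 p.2) with hD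
  obtain ⟨R, hR⟩ := exists_norm_le_of_continuousOn ((h.curve x₀).continuousOn.mono hsub)
  obtain ⟨L, hL0, hL⟩ := exists_spaceDeriv_bound hJ hJ' hf ha hb R
  set M := Real.exp ((L + 2) * (b - a)) with hM
  have hMpos : 0 < M := Real.exp_pos _
  have hDc : ContinuousOn D (J ×ˢ univ) :=
    (contDiffOn_spaceDeriv (m := 0) hJ hJ' isOpen_univ hf (by simp)).continuousOn
  have hK : IsCompact (Icc a b ×ˢ Metric.closedBall (0 : E) (R + 1)) :=
    isCompact_Icc.prod (isCompact_closedBall 0 _)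
  have hunif := Metric.uniformContinuousOn_iff_le.1
    (hK.uniformContinuousOn_of_continuous (hDc.mono (prod_mono hsub (subset_univ _))))
  rw [hasFDerivAt_iff_isLittleO, Asymptotics.isLittleO_iff]
  intro ε hε
  set η := ε / (M * C) * 1 with hη
  have hηpos : 0 < η := by positivity
  obtain ⟨δ₂, hδ₂, hunif⟩ := hunif η hηpos
  set r := min 1 δ₂ with hr
  have hrpos : 0 < r := by positivity
  have hmean : ∀ s ∈ Icc a b, ∀ y, ‖y - Φ s x₀‖ ≤ r →
      ‖f s y - f s (Φ s x₀) - D (s, Φ s x₀) (y - Φ s x₀)‖ ≤ η * ‖y - Φ s x₀‖ := by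
    intro s hs y hy
    have hball : ∀ z ∈ Metric.closedBall (Φ s x₀) r, ‖z‖ ≤ R + 1 := by
      intro z hz
      calc ‖z‖ = ‖Φ s x₀ + (z - Φ s x₀)‖ := by rw [add_sub_cancel]
        _ ≤ ‖Φ s x₀‖ + ‖z - Φ s x₀‖ := norm_add_le _ _
        _ ≤ R + 1 := add_le_add (hR s hs)
          ((mem_closedBall_iff_norm.1 hz).trans (min_le_left _ _))
    refine Convex.norm_image_sub_le_of_norm_hasFDerivWithin_le' (f := f s)
      (f' := fun z => D (s, z)) (s := Metric.closedBall (Φ s x₀) r) ?_ ?_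
      (convex_closedBall _ _) (Metric.mem_closedBall_self hrpos.le) (by simpa [dist_eq_norm] using hy)
    · intro z _
      exact (hasFDerivAt_spaceDeriv (p := (s, z)) isOpen_univ
        (hf.differentiableOn one_ne_zero (s, z) ⟨hsub hs, trivial⟩)
        ⟨hsub hs, trivial⟩).hasFDerivWithinAt
    · intro z hz
      rw [← dist_eq_norm]
      refine hunif (s, z) ⟨hs, by simpa using hball z hz⟩ (s, Φ s x₀)
        ⟨hs, by simpa using (hR s hs).trans (by linarith)⟩ ?_
      rw [Prod.dist_eq]
      simpa using (Metric.mem_closedBall.1 hz).trans (min_le_right _ _)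
  have hnear : ∀ᶠ x in 𝓝 x₀, ‖x - x₀‖ < min δ₁ (r / C) := by
    have : Metric.ball x₀ (min δ₁ (r / C)) ∈ 𝓝 x₀ := Metric.ball_mem_nhds _ (by positivity)
    filter_upwards [this] with x hx
    simpa [dist_eq_norm] using hx
  filter_upwards [hnear] with x hx
  rcases eq_or_ne x x₀ with rfl | hne
  · simp
  have hxpos : 0 < ‖x - x₀‖ := norm_pos_iff.2 (sub_ne_zero.2 hne)
  have hc : 0 < η * C * ‖x - x₀‖ := by positivity
  have key := norm_le_of_deriv_bound (J := Icc a b)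
    (d := fun s => Φ s x - Φ s x₀ - W s (x - x₀))
    (d' := fun s => f s (Φ s x) - f s (Φ s x₀) - (D (s, Φ s x₀)).comp (W s) (x - x₀))
    (c := η * C * ‖x - x₀‖) (L := L + 2) ordConnected_Icc h0 h1
    (fun s hs => by
      refine HasDerivWithinAt.sub
        (((h.curve x s (hsub hs)).sub (h.curve x₀ s (hsub hs))).mono hsub) ?_
      simpa using ((hW s (hsub hs)).mono hsub).clm_apply (hasDerivWithinAt_const s _ (x - x₀)))
    (by simpa [h.init, hW₀] using hc.le) ?_
  · refine key.trans ?_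
    calc η * C * ‖x - x₀‖ * Real.exp ((L + 2) * |t - t₀|) ≤ η * C * ‖x - x₀‖ * M := by
          rw [hM]
          gcongr
          rw [abs_le]
          constructor <;> linarith [h1.1, h1.2, h0.1, h0.2]
      _ = ε * ‖x - x₀‖ := by
          rw [hη]
          field_simp
  · intro s hs heq
    have hs' : s ∈ Icc a b := ordConnected_Icc.uIcc_subset h0 h1 hs
    have h3 := hle x (hx.trans_le (min_le_left _ _)) s hs'
    have h4 : ‖Φ s x - Φ s x₀‖ ≤ r := h3.trans (by
      have := (hx.trans_le (min_le_right δ₁ (r / C))).le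
      calc C * ‖x - x₀‖ ≤ C * (r / C) := by gcongr
        _ = r := by field_simp)
    have h5 := hmean s hs' _ h4
    have h6 : f s (Φ s x) - f s (Φ s x₀) - (D (s, Φ s x₀)).comp (W s) (x - x₀) =
        (f s (Φ s x) - f s (Φ s x₀) - D (s, Φ s x₀) (Φ s x - Φ s x₀)) +
          D (s, Φ s x₀) (Φ s x - Φ s x₀ - W s (x - x₀)) := by
      simp only [ContinuousLinearMap.comp_apply, map_sub]
      abel
    set B := η * C * ‖x - x₀‖ * Real.exp ((L + 2) * |s - t₀|) with hB
    have hBc : η * C * ‖x - x₀‖ ≤ B := by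
      rw [hB]
      exact le_mul_of_one_le_right hc.le (Real.one_le_exp (by positivity))
    calc ‖f s (Φ s x) - f s (Φ s x₀) - (D (s, Φ s x₀)).comp (W s) (x - x₀)‖
        ≤ η * ‖Φ s x - Φ s x₀‖ + ‖D (s, Φ s x₀)‖ * ‖Φ s x - Φ s x₀ - W s (x - x₀)‖ := by
          rw [h6]
          exact (norm_add_le _ _).trans (add_le_add h5 (ContinuousLinearMap.le_opNorm _ _))
      _ ≤ η * (C * ‖x - x₀‖) + L * B := by
          rw [heq]
          gcongr
          exact hL s hs' _ (hR s hs')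
      _ ≤ B + L * B := by rw [← mul_assoc]; gcongr
      _ < (L + 2) * B := by nlinarith [hc.trans_le hBc]

end SmoothDependence

theorem IsFlow.contDiffOn_nat {J : Set ℝ} (hJ : J.OrdConnected) (hJ' : J.Nontrivial)
    {t₀ : ℝ} (ht₀ : t₀ ∈ J) (n : ℕ) : ∀ {E : Type*} [NormedAddCommGroup E] [NormedSpace ℝ E]
    [FiniteDimensional ℝ E] {f Φ : ℝ → E → E}, IsFlow J t₀ f Φ →
    ContDiffOn ℝ ∞ (fun p : ℝ × E => f p.1 p.2) (J ×ˢ univ) →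
    ContDiffOn ℝ n (fun p : ℝ × E => Φ p.1 p.2) (J ×ˢ univ) := by
  induction n with
  | zero =>
    intro E _ _ _ f Φ h hf
    exact contDiffOn_zero.2 (h.continuousOn hJ hJ' ht₀ (hf.of_le (by simp)))
  | succ n ih =>
    intro E _ _ _ f Φ h hf
    have hf1 : ContDiffOn ℝ 1 (fun p : ℝ × E => f p.1 p.2) (J ×ˢ univ) := hf.of_le (by simp)
    set D := spaceDeriv J univ (fun p : ℝ × E => f p.1 p.2) with hD
    have hDsm : ContDiffOn ℝ ∞ D (J ×ˢ univ) :=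
      contDiffOn_spaceDeriv hJ hJ' isOpen_univ hf (by simp)
    have hcurve : ∀ x, ContinuousOn (fun t => D (t, Φ t x)) J := fun x =>
      hDsm.continuousOn.comp (continuousOn_id.prodMk (h.curve x).continuousOn)
        fun t ht => ⟨ht, trivial⟩
    choose W hW₀ hW using fun x => exists_resolvent hJ ht₀ (hcurve x)
    have hΦ := ih h hf
    have haug : IsFlow J t₀ (fun t (z : E × (E →L[ℝ] E)) => (f t z.1, (D (t, z.1)).comp z.2))
        (fun t z => (Φ t z.1, (W z.1 t).comp z.2)) := by
      refine ⟨fun z => by simp [h.init, hW₀], fun z t ht => ?_⟩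
      refine (h.curve z.1 t ht).prodMk ?_
      simpa [ContinuousLinearMap.comp_assoc] using
        (hW z.1 t ht).clm_comp (hasDerivWithinAt_const t J z.2)
    have hpair := ih haug (by
      have hfst : ContDiffOn ℝ ∞ (fun p : ℝ × (E × (E →L[ℝ] E)) => (p.1, p.2.1)) (J ×ˢ univ) :=
        (contDiff_fst.prodMk (contDiff_fst.comp contDiff_snd)).contDiffOn
      refine ContDiffOn.prodMk
        (hf.comp hfst fun p hp => ⟨hp.1, trivial⟩) (ContDiffOn.clm_comp
        (hDsm.comp hfst fun p hp => ⟨hp.1, trivial⟩) ?_)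
      exact (contDiff_snd.comp contDiff_snd).contDiffOn)
    have hWsm : ContDiffOn ℝ n (fun p : ℝ × E => W p.2 p.1) (J ×ˢ univ) := by
      have h1 : ContDiffOn ℝ n
          (fun p : ℝ × E => (p.1, (p.2, ContinuousLinearMap.id ℝ E))) (J ×ˢ univ) :=
        (contDiff_fst.prodMk (contDiff_snd.prodMk contDiff_const)).contDiffOn
      have h2 := contDiff_snd.comp_contDiffOn (hpair.comp h1 fun p hp => ⟨hp.1, trivial⟩)
      exact h2.congr fun p _ => by simp
    push_cast
    refine contDiffOn_succ_of_partials hJ hJ' isOpen_univ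
      (g₁ := fun p => f p.1 (Φ p.1 p.2)) (g₂ := fun p => W p.2 p.1)
      (fun p hp => h.curve p.2 p.1 hp.1)
      (fun p hp => h.hasFDerivAt hJ hJ' ht₀ hf1 (hW₀ p.2) (hW p.2) hp.1) ?_ hWsm
    exact ContDiffOn.comp (g := fun p : ℝ × E => f p.1 p.2) (hf.of_le (by exact_mod_cast le_top))
      (contDiffOn_fst.prodMk hΦ) fun p hp => ⟨hp.1, trivial⟩

theorem IsFlow.contDiffOn {J : Set ℝ} (hJ : J.OrdConnected) (hJ' : J.Nontrivial)
    {t₀ : ℝ} (ht₀ : t₀ ∈ J) {E : Type*} [NormedAddCommGroup E] [NormedSpace ℝ E]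
    [FiniteDimensional ℝ E] {f Φ : ℝ → E → E} (h : IsFlow J t₀ f Φ)
    (hf : ContDiffOn ℝ ∞ (fun p : ℝ × E => f p.1 p.2) (J ×ˢ univ)) :
    ContDiffOn ℝ ∞ (fun p : ℝ × E => Φ p.1 p.2) (J ×ˢ univ) :=
  contDiffOn_infty.2 fun n => IsFlow.contDiffOn_nat hJ hJ' ht₀ n h hf

theorem exists_isFlow {J : Set ℝ} (hJ : J.OrdConnected) (hJ' : J.Nontrivial)
    {t₀ : ℝ} (ht₀ : t₀ ∈ J) {E : Type*} [NormedAddCommGroup E] [NormedSpace ℝ E]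
    [FiniteDimensional ℝ E] {f : ℝ → E → E}
    (hf : ContDiffOn ℝ ∞ (fun p : ℝ × E => f p.1 p.2) (J ×ˢ univ)) (hg : LinearGrowth J f) :
    ∃ Φ, IsFlow J t₀ f Φ := by
  have hcE : CompleteSpace E := FiniteDimensional.complete ℝ E
  have hc : ∀ x, ContinuousOn (fun t => f t x) J := fun x =>
    hf.continuousOn.comp (continuousOn_id.prodMk continuousOn_const) fun t ht => ⟨ht, trivial⟩
  choose γ h0 h1 using exists_isIntegralCurveOn hJ ht₀ hc
    (locLip_of_contDiffOn hJ hJ' (hf.of_le (by simp))) hg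
  exact ⟨fun t x => γ x t, h0, h1⟩

section TimeDependentFunctions

variable {E : Type*} [NormedAddCommGroup E] [NormedSpace ℝ E] [FiniteDimensional ℝ E]
  {H : Type*} [TopologicalSpace H] {I : ModelWithCorners ℝ E H} [I.Boundaryless]
  {M : Type*} [TopologicalSpace M] [ChartedSpace H M] [IsManifold I ∞ M]
  {J : Set ℝ}

variable {G : Type*} [NormedAddCommGroup G] [NormedSpace ℝ G]

/-- Smoothness on `J × M` of a time-dependent function. -/
def SmoothFun (I : ModelWithCorners ℝ E H) (J : Set ℝ) (g : ℝ × M → G) : Prop :=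
  ContMDiffOn (𝓘(ℝ, ℝ).prod I) 𝓘(ℝ, G) ∞ g (J ×ˢ univ)

/-- The time-dependent function `g` in the chart at `x₀`. -/
def chartRead (I : ModelWithCorners ℝ E H) (x₀ : M) (g : ℝ × M → G) (q : ℝ × E) : G :=
  g (q.1, (extChartAt I x₀).symm q.2)

theorem isOpen_extChartAt_target' (x₀ : M) : IsOpen (extChartAt I x₀).target :=
  isOpen_extChartAt_target x₀

theorem SmoothFun.contDiffOn_chartRead {g : ℝ × M → G} (hg : SmoothFun I J g) (x₀ : M) :
    ContDiffOn ℝ ∞ (chartRead I x₀ g) (J ×ˢ (extChartAt I x₀).target) := by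
  rw [← contMDiffOn_iff_contDiffOn]
  refine ContMDiffOn.comp (t := J ×ˢ univ) hg ?_ fun q hq => ⟨hq.1, trivial⟩
  exact contDiff_fst.contMDiff.contMDiffOn.prodMk ((contMDiffOn_extChartAt_symm x₀).comp
    contDiff_snd.contMDiff.contMDiffOn fun q hq => hq.2)

theorem prod_source_mem_nhdsWithin (t : ℝ) (x₀ : M) :
    J ×ˢ (extChartAt I x₀).source ∈ 𝓝[J ×ˢ univ] (t, x₀) := by
  have h : (univ : Set ℝ) ×ˢ (extChartAt I x₀).source ∈ 𝓝 (t, x₀) :=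
    prod_mem_nhds univ_mem (extChartAt_source_mem_nhds x₀)
  filter_upwards [self_mem_nhdsWithin, mem_nhdsWithin_of_mem_nhds h] with p h1 h2
  exact ⟨h1.1, h2.2⟩

theorem contMDiffWithinAt_of_chart {K : ℝ × E → G} {t : ℝ} {x₀ : M}
    (hK : ContDiffWithinAt ℝ ∞ K (J ×ˢ (extChartAt I x₀).target) (t, extChartAt I x₀ x₀)) :
    ContMDiffWithinAt (𝓘(ℝ, ℝ).prod I) 𝓘(ℝ, G) ∞
      (fun p : ℝ × M => K (p.1, extChartAt I x₀ p.2)) (J ×ˢ univ) (t, x₀) := by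
  refine ContMDiffWithinAt.mono_of_mem_nhdsWithin (s := J ×ˢ (extChartAt I x₀).source) ?_
    (prod_source_mem_nhdsWithin t x₀)
  have h1 : ContMDiffWithinAt (𝓘(ℝ, ℝ).prod I) 𝓘(ℝ, ℝ × E) ∞
      (fun p : ℝ × M => (p.1, extChartAt I x₀ p.2)) (J ×ˢ (extChartAt I x₀).source) (t, x₀) := by
    refine ContMDiffWithinAt.prodMk_space contMDiffWithinAt_fst ?_
    exact ((contMDiffAt_extChartAt (I := I) (x := x₀) (n := ∞)).comp (t, x₀)
      contMDiffAt_snd).contMDiffWithinAt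
  have hmap : MapsTo (fun p : ℝ × M => (p.1, extChartAt I x₀ p.2))
      (J ×ˢ (extChartAt I x₀).source) (J ×ˢ (extChartAt I x₀).target) :=
    fun p hp => ⟨hp.1, (extChartAt I x₀).map_source hp.2⟩
  exact hK.contMDiffWithinAt.comp (t, x₀) h1 hmap

/-- The time derivative of a time-dependent function on a manifold. -/
def tderiv (J : Set ℝ) (g : ℝ × M → G) (p : ℝ × M) : G :=
  derivWithin (fun s => g (s, p.2)) J p.1

variable (hJ : J.OrdConnected) (hJ' : J.Nontrivial)
include hJ hJ'

theorem timeDeriv_chartRead {g : ℝ × M → G} (hg : SmoothFun I J g) (x₀ : M) {q : ℝ × E}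
    (hq : q ∈ J ×ˢ (extChartAt I x₀).target) :
    timeDeriv J (extChartAt I x₀).target (chartRead I x₀ g) q =
      tderiv J g (q.1, (extChartAt I x₀).symm q.2) :=
  ((hasDerivWithinAt_timeDeriv (((hg.contDiffOn_chartRead x₀).differentiableOn (by simp)) q hq)
    hq).derivWithin (uniqueDiffOn_of_ordConnected hJ hJ' q.1 hq.1)).symm

theorem SmoothFun.hasDerivWithinAt {g : ℝ × M → G} (hg : SmoothFun I J g) {t : ℝ} (ht : t ∈ J)
    (x : M) : HasDerivWithinAt (fun s => g (s, x)) (tderiv J g (t, x)) J t := by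
  have hq : (t, extChartAt I x x) ∈ J ×ˢ (extChartAt I x).target :=
    ⟨ht, mem_extChartAt_target x⟩
  have h1 := hasDerivWithinAt_timeDeriv
    (((hg.contDiffOn_chartRead x).differentiableOn (by simp)) _ hq) hq
  rw [timeDeriv_chartRead hJ hJ' hg x hq] at h1
  simpa [chartRead] using h1

theorem SmoothFun.tderiv {g : ℝ × M → G} (hg : SmoothFun I J g) : SmoothFun I J (tderiv J g) := by
  rintro ⟨t, x₀⟩ ⟨ht, -⟩
  have h1 := contDiffOn_timeDeriv (m := ∞) hJ hJ' (isOpen_extChartAt_target' x₀)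
    (hg.contDiffOn_chartRead x₀) (by simp)
  have h2 := contMDiffWithinAt_of_chart (J := J)
    (h1 (t, extChartAt I x₀ x₀) ⟨ht, mem_extChartAt_target x₀⟩)
  have h3 : ∀ p ∈ J ×ˢ (extChartAt I x₀).source, LieAlgd.tderiv J g p =
      timeDeriv J (extChartAt I x₀).target (chartRead I x₀ g) (p.1, extChartAt I x₀ p.2) := by
    intro p hp
    rw [timeDeriv_chartRead hJ hJ' hg x₀ ⟨hp.1, (extChartAt I x₀).map_source hp.2⟩]
    rw [(extChartAt I x₀).left_inv hp.2]
  exact h2.congr_of_eventuallyEq (mem_of_superset (prod_source_mem_nhdsWithin t x₀) h3)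
    (h3 _ ⟨ht, mem_extChartAt_source x₀⟩)

omit hJ hJ' in
theorem SmoothFun.contMDiff {g : ℝ × M → G} (hg : SmoothFun I J g) {t : ℝ} (ht : t ∈ J) :
    ContMDiff I 𝓘(ℝ, G) ∞ (fun x => g (t, x)) := by
  rw [← contMDiffOn_univ]
  exact ContMDiffOn.comp (t := J ×ˢ univ) hg (contMDiffOn_const.prodMk contMDiffOn_id)
    fun x _ => ⟨ht, trivial⟩

omit hJ hJ' in
theorem mvfderiv_eq_spaceDeriv {g : ℝ × M → G} (hg : SmoothFun I J g) {t : ℝ} (ht : t ∈ J)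
    (x : M) : (mvfderiv I (fun y => g (t, y)) x : E →L[ℝ] G) =
      spaceDeriv J (extChartAt I x).target (chartRead I x g) (t, extChartAt I x x) := by
  have hq : (t, extChartAt I x x) ∈ J ×ˢ (extChartAt I x).target :=
    ⟨ht, mem_extChartAt_target x⟩
  have h1 := hasFDerivAt_spaceDeriv (isOpen_extChartAt_target' x)
    (((hg.contDiffOn_chartRead x).differentiableOn (by simp)) _ hq) hq
  have h2 := ((hg.contMDiff ht).mdifferentiable (by simp) x).mvfderiv
  refine h2.trans ?_
  rw [I.range_eq_univ, fderivWithin_univ]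
  exact h1.fderiv

omit [FiniteDimensional ℝ E] in
theorem hasDerivWithinAt_spaceDeriv {U : Set E} (hU : IsOpen U) {K : ℝ × E → G}
    (hK : ContDiffOn ℝ ∞ K (J ×ˢ U)) {q : ℝ × E} (hq : q ∈ J ×ˢ U) :
    HasDerivWithinAt (fun s => spaceDeriv J U K (s, q.2))
      (spaceDeriv J U (timeDeriv J U K) q) J q.1 := by
  have hS := uniqueDiffOn_prod_of_ordConnected hJ hJ' hU
  have hK2 : ContDiffOn ℝ ∞ (fderivWithin ℝ K (J ×ˢ U)) (J ×ˢ U) :=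
    hK.fderivWithin hS (by simp)
  have h1 := hasDerivWithinAt_timeDeriv
    ((contDiffOn_spaceDeriv (m := ∞) hJ hJ' hU hK (by simp)).differentiableOn (by simp) q hq) hq
  suffices hkey : spaceDeriv J U (timeDeriv J U K) q = timeDeriv J U (spaceDeriv J U K) q by
    rw [hkey]
    exact h1
  have hcl : q ∈ closure (interior (J ×ˢ U)) := by
    rw [interior_prod_eq, hU.interior_eq, closure_prod_eq]
    refine ⟨?_, subset_closure hq.2⟩
    have hconv : Convex ℝ J := hJ.convex
    rw [hconv.closure_interior_eq_closure_of_nonempty_interior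
      (interior_nonempty_of_ordConnected hJ hJ')]
    exact subset_closure hq.1
  have hsymm := ((hK q hq).of_le (WithTop.coe_le_coe.2 le_top)).isSymmSndFDerivWithinAt
    (n := 2) (by simp) hS hcl hq
  have hd := (hK2.differentiableOn (by simp) q hq).hasFDerivWithinAt
  ext v
  have e1 : fderivWithin ℝ (timeDeriv J U K) (J ×ˢ U) q (0, v) =
      fderivWithin ℝ (fderivWithin ℝ K (J ×ˢ U)) (J ×ˢ U) q (0, v) (1, 0) := by
    have := (hd.clm_apply (hasFDerivWithinAt_const ((1 : ℝ), (0 : E)) q _)).fderivWithin (hS q hq)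
    have h2 : timeDeriv J U K = fun y => fderivWithin ℝ K (J ×ˢ U) y (1, 0) := rfl
    rw [h2, this]
    simp
  have e2 : fderivWithin ℝ (spaceDeriv J U K) (J ×ˢ U) q (1, 0) v =
      fderivWithin ℝ (fderivWithin ℝ K (J ×ˢ U)) (J ×ˢ U) q (1, 0) (0, v) := by
    have := (hd.clm_comp (hasFDerivWithinAt_const (ContinuousLinearMap.inr ℝ ℝ E) q
      (J ×ˢ U))).fderivWithin (hS q hq)
    have h2 : spaceDeriv J U K =
      fun y => (fderivWithin ℝ K (J ×ˢ U) y).comp (ContinuousLinearMap.inr ℝ ℝ E) := rfl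
    rw [h2, this]
    simp
  have e3 : spaceDeriv J U (timeDeriv J U K) q v =
      fderivWithin ℝ (timeDeriv J U K) (J ×ˢ U) q (0, v) := rfl
  have e4 : timeDeriv J U (spaceDeriv J U K) q v =
      fderivWithin ℝ (spaceDeriv J U K) (J ×ˢ U) q (1, 0) v := rfl
  rw [e3, e4, e1, e2]
  exact hsymm _ _

theorem SmoothFun.hasDerivWithinAt_mvfderiv {g : ℝ × M → G} (hg : SmoothFun I J g) {t : ℝ}
    (ht : t ∈ J) (x : M) :
    HasDerivWithinAt (fun s => (mvfderiv I (fun y => g (s, y)) x : E →L[ℝ] G))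
      (mvfderiv I (fun y => LieAlgd.tderiv J g (t, y)) x : E →L[ℝ] G) J t := by
  have hq : (t, extChartAt I x x) ∈ J ×ˢ (extChartAt I x).target :=
    ⟨ht, mem_extChartAt_target x⟩
  have h1 := hasDerivWithinAt_spaceDeriv hJ hJ' (isOpen_extChartAt_target' x)
    (hg.contDiffOn_chartRead x) hq
  have h2 : (mvfderiv I (fun y => LieAlgd.tderiv J g (t, y)) x : E →L[ℝ] G) =
      spaceDeriv J (extChartAt I x).target
        (timeDeriv J (extChartAt I x).target (chartRead I x g)) (t, extChartAt I x x) := by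
    refine (mvfderiv_eq_spaceDeriv (hg.tderiv hJ hJ') ht x).trans ?_
    unfold spaceDeriv
    congr 1
    refine fderivWithin_congr (fun q hq' => ?_) ?_
    · rw [timeDeriv_chartRead hJ hJ' hg x hq', chartRead]
    · rw [timeDeriv_chartRead hJ hJ' hg x hq, chartRead]
  rw [h2]
  exact h1.congr (fun s hs => mvfderiv_eq_spaceDeriv hg hs x) (mvfderiv_eq_spaceDeriv hg ht x)

omit hJ hJ' in
theorem mvfderiv_eq_chart {f : M → G} (hf : ContMDiff I 𝓘(ℝ, G) ∞ f) {x₀ x : M}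
    (hx : x ∈ (extChartAt I x₀).source) (v : TangentSpace I x) :
    mvfderiv I f x v = fderiv ℝ (f ∘ (extChartAt I x₀).symm) (extChartAt I x₀ x)
      ((trivializationAt E (TangentSpace I) x₀ ⟨x, v⟩).2) := by
  have hx' : x ∈ (chartAt H x₀).source := by rwa [extChartAt_source] at hx
  have h1 : mvfderiv I f x = (mvfderiv 𝓘(ℝ, E) (f ∘ (extChartAt I x₀).symm)
      (extChartAt I x₀ x)).comp (mfderiv I 𝓘(ℝ, E) (extChartAt I x₀) x) := by
    have hev : f =ᶠ[𝓝 x] (f ∘ (extChartAt I x₀).symm) ∘ extChartAt I x₀ := by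
      filter_upwards [extChartAt_source_mem_nhds' hx] with y hy
      rw [Function.comp_apply, Function.comp_apply, (extChartAt I x₀).left_inv hy]
    have hd : MDifferentiableAt 𝓘(ℝ, E) 𝓘(ℝ, G) (f ∘ (extChartAt I x₀).symm)
        (extChartAt I x₀ x) := by
      have := ((hf.contMDiffOn (s := univ)).comp (contMDiffOn_extChartAt_symm (n := ∞) x₀)
        fun _ _ => trivial) _ ((extChartAt I x₀).map_source hx)
      exact (this.contMDiffAt ((isOpen_extChartAt_target' x₀).mem_nhds
        ((extChartAt I x₀).map_source hx))).mdifferentiableAt (by simp)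
    unfold mvfderiv
    rw [hev.mfderiv_eq, mfderiv_comp x hd (mdifferentiableAt_extChartAt hx')]
    rfl
  rw [h1, ContinuousLinearMap.comp_apply]
  have h2 : mfderiv I 𝓘(ℝ, E) (extChartAt I x₀) x v =
      (trivializationAt E (TangentSpace I) x₀ ⟨x, v⟩).2 := by
    have h3 : (trivializationAt E (TangentSpace I) x₀).continuousLinearMapAt ℝ x v =
        (trivializationAt E (TangentSpace I) x₀ ⟨x, v⟩).2 := by
      rw [Trivialization.continuousLinearMapAt_apply, Trivialization.coe_linearMapAt_of_mem _ hx']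
    rw [← h3]
    exact congrArg (fun L : TangentSpace I x →L[ℝ] E => L v)
      (TangentBundle.continuousLinearMapAt_trivializationAt hx').symm
  rw [h2]
  unfold mvfderiv
  rw [mfderiv_eq_fderiv]
  rfl

theorem SmoothFun.mvfderiv_apply {g : ℝ × M → G} (hg : SmoothFun I J g)
    {v : ℝ → ∀ x : M, TangentSpace I x}
    (hv : ContMDiffOn (𝓘(ℝ, ℝ).prod I) (I.prod 𝓘(ℝ, E)) ∞
      (fun p : ℝ × M => (⟨p.2, v p.1 p.2⟩ : TangentBundle I M)) (J ×ˢ univ)) :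
    SmoothFun I J (fun p : ℝ × M => mvfderiv I (fun y => g (p.1, y)) p.2 (v p.1 p.2)) := by
  rintro ⟨t, x₀⟩ ⟨ht, -⟩
  have h1 := contDiffOn_spaceDeriv (m := ∞) hJ hJ' (isOpen_extChartAt_target' x₀)
    (hg.contDiffOn_chartRead x₀) (by simp)
  have h2 := contMDiffWithinAt_of_chart (J := J)
    (h1 (t, extChartAt I x₀ x₀) ⟨ht, mem_extChartAt_target x₀⟩)
  have h3 := (contMDiffWithinAt_totalSpace.1 (hv (t, x₀) ⟨ht, trivial⟩)).2
  have h4 : ∀ p ∈ J ×ˢ (extChartAt I x₀).source,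
      mvfderiv I (fun y => g (p.1, y)) p.2 (v p.1 p.2) =
      spaceDeriv J (extChartAt I x₀).target (chartRead I x₀ g) (p.1, extChartAt I x₀ p.2)
        ((trivializationAt E (TangentSpace I) x₀ ⟨p.2, v p.1 p.2⟩).2) := by
    intro p hp
    have hq : (p.1, extChartAt I x₀ p.2) ∈ J ×ˢ (extChartAt I x₀).target :=
      ⟨hp.1, (extChartAt I x₀).map_source hp.2⟩
    rw [mvfderiv_eq_chart (hg.contMDiff hp.1) hp.2]
    have h5 := hasFDerivAt_spaceDeriv (isOpen_extChartAt_target' x₀)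
      (((hg.contDiffOn_chartRead x₀).differentiableOn (by simp)) _ hq) hq
    exact congrArg (fun L : E →L[ℝ] G =>
      L ((trivializationAt E (TangentSpace I) x₀ ⟨p.2, v p.1 p.2⟩).2)) h5.fderiv
  exact (h2.clm_apply h3).congr_of_eventuallyEq
    (mem_of_superset (prod_source_mem_nhdsWithin t x₀) h4) (h4 _ ⟨ht, mem_extChartAt_source x₀⟩)

end TimeDependentFunctions

section WeakDerivative

variable {W : Type*} [AddCommGroup W] [Module ℝ W] {J : Set ℝ} {t : ℝ}

/-- The curve `f` in a real vector space is differentiable at `t` within `J`, tested by linear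
functionals. -/
def WDeriv (J : Set ℝ) (t : ℝ) (f : ℝ → W) (w : W) : Prop :=
  ∀ φ : W →ₗ[ℝ] ℝ, HasDerivWithinAt (fun s => φ (f s)) (φ w) J t

theorem WDeriv.const (w : W) : WDeriv J t (fun _ => w) 0 := fun φ => by
  simpa using hasDerivWithinAt_const t J (φ w)

theorem WDeriv.add {f g : ℝ → W} {v w : W} (hf : WDeriv J t f v) (hg : WDeriv J t g w) :
    WDeriv J t (fun s => f s + g s) (v + w) := fun φ => by
  simpa using (hf φ).fun_add (hg φ)

theorem WDeriv.neg {f : ℝ → W} {v : W} (hf : WDeriv J t f v) :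
    WDeriv J t (fun s => -f s) (-v) := fun φ => by
  simpa using (hf φ).fun_neg

theorem WDeriv.smul {c : ℝ → ℝ} {c' : ℝ} {f : ℝ → W} {v : W} (hc : HasDerivWithinAt c c' J t)
    (hf : WDeriv J t f v) : WDeriv J t (fun s => c s • f s) (c' • f t + c t • v) := fun φ => by
  simpa using hc.fun_mul (hf φ)

theorem WDeriv.const_smul (c : ℝ) {f : ℝ → W} {v : W}
    (hf : WDeriv J t f v) : WDeriv J t (fun s => c • f s) (c • v) := fun φ => by
  simpa using (hf φ).const_mul c

theorem WDeriv.sum {κ : Type*} [Fintype κ] {f : κ → ℝ → W} {v : κ → W}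
    (hf : ∀ k, WDeriv J t (f k) (v k)) : WDeriv J t (fun s => ∑ k, f k s) (∑ k, v k) := fun φ => by
  simpa using HasDerivWithinAt.fun_sum fun k (_ : k ∈ Finset.univ) => hf k φ

theorem WDeriv.map {W' : Type*} [AddCommGroup W'] [Module ℝ W'] {f : ℝ → W} {v : W}
    (hf : WDeriv J t f v) (φ : W →ₗ[ℝ] W') : WDeriv J t (fun s => φ (f s)) (φ v) :=
  fun ψ => hf (ψ ∘ₗ φ)

theorem WDeriv.congr {f g : ℝ → W} {v : W} (hf : WDeriv J t f v) (ht : t ∈ J)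
    (h : ∀ s ∈ J, g s = f s) : WDeriv J t g v := fun φ =>
  (hf φ).congr (fun s hs => by rw [h s hs]) (by rw [h t ht])

theorem eq_of_forall_dual {v w : W} (h : ∀ φ : W →ₗ[ℝ] ℝ, φ v = φ w) : v = w := by
  rw [← sub_eq_zero]
  refine (Module.forall_dual_apply_eq_zero_iff ℝ (v - w)).1 fun φ => ?_
  rw [map_sub, h φ, sub_self]

theorem WDeriv.unique {f : ℝ → W} {v w : W} (hJ : UniqueDiffOn ℝ J) (ht : t ∈ J)
    (hv : WDeriv J t f v) (hw : WDeriv J t f w) : v = w :=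
  eq_of_forall_dual fun φ => (hJ t ht).eq_deriv _ (hv φ) (hw φ)

theorem WDeriv.hasDerivWithinAt {G : Type*} [NormedAddCommGroup G] [NormedSpace ℝ G]
    [FiniteDimensional ℝ G] {f : ℝ → G} {v : G} (hf : WDeriv J t f v) :
    HasDerivWithinAt f v J t := by
  have b := Module.finBasis ℝ G
  have h : HasDerivWithinAt (fun s => ∑ k, b.coord k (f s) • b k) (∑ k, b.coord k v • b k) J t :=
    HasDerivWithinAt.fun_sum fun k _ => (hf (b.coord k)).smul_const (b k)
  simpa [Module.Basis.sum_repr] using h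

theorem WDeriv.clm_apply {G G' : Type*} [NormedAddCommGroup G] [NormedSpace ℝ G]
    [FiniteDimensional ℝ G] [NormedAddCommGroup G'] [NormedSpace ℝ G']
    {L : ℝ → G →L[ℝ] G'} {L' : G →L[ℝ] G'} (hL : HasDerivWithinAt L L' J t) {f : ℝ → G} {v : G}
    (hf : WDeriv J t f v) : HasDerivWithinAt (fun s => L s (f s)) (L' (f t) + L t v) J t :=
  hL.clm_apply hf.hasDerivWithinAt

end WeakDerivative

section Frames

variable {E : Type*} [NormedAddCommGroup E] [NormedSpace ℝ E] [FiniteDimensional ℝ E]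
  {H : Type*} [TopologicalSpace H] {I : ModelWithCorners ℝ E H} [I.Boundaryless]
  {M : Type*} [TopologicalSpace M] [ChartedSpace H M] [IsManifold I ∞ M]
  {J : Set ℝ}

variable {F : Type*} [NormedAddCommGroup F] [NormedSpace ℝ F] [FiniteDimensional ℝ F]
  {V : M → Type*} [TopologicalSpace (TotalSpace F V)]
  [∀ x, AddCommGroup (V x)] [∀ x, Module ℝ (V x)] [∀ x, TopologicalSpace (V x)]
  [FiberBundle F V] [VectorBundle ℝ F V] [ContMDiffVectorBundle ∞ F V I]

theorem exists_bump [T2Space M] [SecondCountableTopology M] {C U : Set M} (hC : IsClosed C)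
    (hU : IsOpen U) (hCU : C ⊆ U) : ∃ χ : Fun I M, (∀ᶠ x in 𝓝ˢ C, χ x = 1) ∧ tsupport χ ⊆ U := by
  have : LocallyCompactSpace M := Manifold.locallyCompact_of_finiteDimensional I
  obtain ⟨u, hu, hCu, huU⟩ := normal_exists_closure_subset hC hU hCU
  obtain ⟨f, h1, h0, -⟩ := exists_contMDiffMap_one_nhds_of_subset_interior (n := (⊤ : ℕ∞)) I
    (s := C) (t := closure u) hC (hCu.trans (interior_maximal subset_closure hu))
  refine ⟨f, h1, (closure_minimal ?_ isClosed_closure).trans huU⟩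
  intro x hx
  by_contra hx'
  exact hx (h0 x hx')

/-- Global sections `s k` and smooth fibrewise linear functionals `ξ k` such that
`v = ∑ ξ k v • s k` over `U`. -/
structure FrameOn (U : Set M) {κ : Type*} [Fintype κ] (s : κ → Sec I F V)
    (ξ : κ → ∀ x : M, V x →ₗ[ℝ] ℝ) : Prop where
  smooth : ∀ k, ContMDiff (I.prod 𝓘(ℝ, F)) 𝓘(ℝ, ℝ) ∞ (fun p : TotalSpace F V => ξ k p.1 p.2)
  sum : ∀ x ∈ U, ∀ v : V x, ∑ k, ξ k x v • s k x = v

theorem exists_frameOn [T2Space M] [SecondCountableTopology M] (x₀ : M) :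
    ∃ U : Set M, IsOpen U ∧ x₀ ∈ U ∧ ∃ (n : ℕ) (s : Fin n → Sec I F V)
      (ξ : Fin n → ∀ x : M, V x →ₗ[ℝ] ℝ), FrameOn U s ξ := by
  set e := trivializationAt F V x₀ with he
  have b := Module.finBasis ℝ F
  have hx₀ : x₀ ∈ e.baseSet := mem_baseSet_trivializationAt F V x₀
  obtain ⟨χ, h1, hsupp⟩ := exists_bump (I := I) (isClosed_singleton (x := x₀)) e.open_baseSet
    (singleton_subset_iff.2 hx₀)
  rw [nhdsSet_singleton] at h1
  obtain ⟨U, hU1, hU, hxU⟩ := mem_nhds_iff.1 (inter_mem h1 (e.open_baseSet.mem_nhds hx₀))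
  refine ⟨U, hU, hxU, Module.finrank ℝ F, fun k => ⟨(χ : M → ℝ) • e.localFrame b k, ?_⟩,
    fun k x => χ x • (b.coord k ∘ₗ e.linearMapAt ℝ x), fun k => ?_, fun x hx v => ?_⟩
  · exact ContMDiffOn.smul_section_of_tsupport χ.contMDiff.contMDiffOn e.open_baseSet hsupp
      (e.contMDiffOn_localFrame_baseSet (I := I) ∞ b k)
  · refine contMDiff_of_tsupport fun p hp => ?_
    have hp1 : p.1 ∈ e.baseSet := by
      refine hsupp ?_
      have hcl : IsClosed {q : TotalSpace F V | q.1 ∈ tsupport χ} :=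
        (isClosed_tsupport χ).preimage (FiberBundle.continuous_proj F V)
      refine closure_minimal ?_ hcl hp
      intro q hq
      refine subset_tsupport _ fun h0 => hq ?_
      simp only [LinearMap.smul_apply]
      rw [h0, zero_smul]
    have hsrc : p ∈ e.source := e.mem_source.2 hp1
    have hes := (e.contMDiffOn (IB := I) (n := ∞)).contMDiffAt (e.open_source.mem_nhds hsrc)
    have hev : (fun q : TotalSpace F V => (χ q.1 • (b.coord k ∘ₗ e.linearMapAt ℝ q.1)) q.2) =ᶠ[𝓝 p]
        fun q => χ q.1 * LinearMap.toContinuousLinearMap (b.coord k) (e q).2 := by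
      filter_upwards [e.open_source.mem_nhds hsrc] with q hq
      have hq' := e.mem_source.1 hq
      simp [Trivialization.coe_linearMapAt_of_mem _ hq']
    refine ContMDiffAt.congr_of_eventuallyEq ?_ hev
    refine ContMDiffAt.mul ?_ ?_
    · exact (χ.contMDiff.contMDiffAt).comp p (contMDiffAt_proj V)
    · exact (LinearMap.toContinuousLinearMap (b.coord k)).contDiff.contMDiff.contMDiffAt.comp p
        (contMDiffAt_snd.comp p hes)
  · obtain ⟨hx1, hxb⟩ := hU1 hx
    have hx1' : χ x = 1 := hx1
    have h2 := (e.basisAt b hxb).sum_repr v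
    calc _ = ∑ k, (e.basisAt b hxb).repr v k • e.basisAt b hxb k := by
          refine Finset.sum_congr rfl fun k _ => ?_
          change (χ x • (b.coord k ∘ₗ e.linearMapAt ℝ x)) v • (χ x • e.localFrame b k x) = _
          rw [hx1', one_smul, one_smul, e.localFrame_apply_of_mem_baseSet b hxb]
          congr 1
          simp [Bundle.Trivialization.basisAt, Trivialization.coe_linearMapAt_of_mem _ hxb]
      _ = v := h2

section SmoothMaps

variable {E' : Type*} [NormedAddCommGroup E'] [NormedSpace ℝ E'] {H' : Type*} [TopologicalSpace H']
  {I' : ModelWithCorners ℝ E' H'} {N : Type*} [TopologicalSpace N] [ChartedSpace H' N]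

theorem contMDiffWithinAt_sum_smul {κ : Type*} [Fintype κ] (s : κ → Sec I F V) {b : N → M}
    {c : κ → N → ℝ} {S : Set N} {q₀ : N} (hb : ContMDiffWithinAt I' I ∞ b S q₀)
    (hc : ∀ k, ContMDiffWithinAt I' 𝓘(ℝ, ℝ) ∞ (c k) S q₀) :
    ContMDiffWithinAt I' (I.prod 𝓘(ℝ, F)) ∞
      (fun q => (⟨b q, ∑ k, c k q • s k (b q)⟩ : TotalSpace F V)) S q₀ := by
  rw [contMDiffWithinAt_totalSpace]
  refine ⟨hb, ?_⟩
  set e := trivializationAt F V (b q₀)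
  have h1 : ∀ k, ContMDiffWithinAt I' 𝓘(ℝ, F) ∞
      (fun q => (e (⟨b q, s k (b q)⟩ : TotalSpace F V)).2) S q₀ := fun k =>
    (contMDiffWithinAt_totalSpace.1 (((s k).contMDiff (b q₀)).comp_contMDiffWithinAt q₀ hb)).2
  have h2 : ContMDiffWithinAt I' 𝓘(ℝ, F) ∞
      (fun q => ∑ k, c k q • (e (⟨b q, s k (b q)⟩ : TotalSpace F V)).2) S q₀ :=
    ContMDiffWithinAt.sum fun k _ => (hc k).smul (h1 k)
  have h3 : ∀ q, b q ∈ e.baseSet → (e (⟨b q, ∑ k, c k q • s k (b q)⟩ : TotalSpace F V)).2 =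
      ∑ k, c k q • (e (⟨b q, s k (b q)⟩ : TotalSpace F V)).2 := by
    intro q hq
    have hl : ∀ v : V (b q), (e (⟨b q, v⟩ : TotalSpace F V)).2 = e.linearMapAt ℝ (b q) v :=
      fun v => by rw [Trivialization.coe_linearMapAt_of_mem _ hq]
    simp only [hl, map_sum, map_smul]
  have hmem : b q₀ ∈ e.baseSet := mem_baseSet_trivializationAt F V (b q₀)
  exact h2.congr_of_eventuallyEq ((hb.continuousWithinAt.eventually
    (e.open_baseSet.mem_nhds hmem)).mono fun q hq => h3 q hq) (h3 q₀ hmem)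

theorem FrameOn.contMDiffWithinAt {U : Set M} {κ : Type*} [Fintype κ] {s : κ → Sec I F V}
    {ξ : κ → ∀ x : M, V x →ₗ[ℝ] ℝ} (h : FrameOn U s ξ) {f : N → TotalSpace F V} {S : Set N}
    {q₀ : N} (hU : U ∈ 𝓝 (f q₀).1) (hb : ContMDiffWithinAt I' I ∞ (fun q => (f q).1) S q₀)
    (hc : ∀ k, ContMDiffWithinAt I' 𝓘(ℝ, ℝ) ∞ (fun q => ξ k (f q).1 (f q).2) S q₀) :
    ContMDiffWithinAt I' (I.prod 𝓘(ℝ, F)) ∞ f S q₀ := by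
  have h1 : ∀ q, (f q).1 ∈ U →
      f q = (⟨(f q).1, ∑ k, ξ k (f q).1 (f q).2 • s k (f q).1⟩ : TotalSpace F V) :=
    fun q hq => by rw [h.sum _ hq]
  exact (contMDiffWithinAt_sum_smul s hb hc).congr_of_eventuallyEq
    ((hb.continuousWithinAt.eventually hU).mono fun q hq => h1 q hq) (h1 q₀ (mem_of_mem_nhds hU))

end SmoothMaps

/-- Smoothness on `J × M` of a time-dependent section. -/
def SmoothFam (I : ModelWithCorners ℝ E H) (F : Type*) [NormedAddCommGroup F] [NormedSpace ℝ F]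
    {V : M → Type*} [TopologicalSpace (TotalSpace F V)]
    [∀ x, AddCommGroup (V x)] [∀ x, Module ℝ (V x)] [∀ x, TopologicalSpace (V x)]
    [FiberBundle F V] (J : Set ℝ) (s : ℝ → ∀ x : M, V x) : Prop :=
  ContMDiffOn (𝓘(ℝ, ℝ).prod I) (I.prod 𝓘(ℝ, F)) ∞
    (fun p : ℝ × M => (⟨p.2, s p.1 p.2⟩ : TotalSpace F V)) (J ×ˢ univ)

theorem SmoothFam.coeff {s : ℝ → ∀ x : M, V x} (hs : SmoothFam I F J s)
    {ξ : ∀ x : M, V x →ₗ[ℝ] ℝ}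
    (hξ : ContMDiff (I.prod 𝓘(ℝ, F)) 𝓘(ℝ, ℝ) ∞ (fun p : TotalSpace F V => ξ p.1 p.2)) :
    SmoothFun I J (fun p : ℝ × M => ξ p.2 (s p.1 p.2)) :=
  hξ.comp_contMDiffOn hs

theorem smoothFam_sum_smul {κ : Type*} [Fintype κ] (s : κ → Sec I F V) {g : κ → ℝ × M → ℝ}
    (hg : ∀ k, SmoothFun I J (g k)) :
    SmoothFam I F J (fun t x => ∑ k, g k (t, x) • s k x) := fun p hp =>
  contMDiffWithinAt_sum_smul s contMDiffWithinAt_snd fun k => hg k p hp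

theorem SmoothFam.const (s : Sec I F V) : SmoothFam I F J (fun _ x => s x) :=
  s.contMDiff.comp_contMDiffOn contMDiffOn_snd

theorem SmoothFam.contMDiff {s : ℝ → ∀ x : M, V x} (hs : SmoothFam I F J s) {t : ℝ} (ht : t ∈ J) :
    ContMDiff I (I.prod 𝓘(ℝ, F)) ∞ (fun x => (⟨x, s t x⟩ : TotalSpace F V)) := by
  rw [← contMDiffOn_univ]
  exact ContMDiffOn.comp (t := J ×ˢ univ) hs (contMDiffOn_const.prodMk contMDiffOn_id)
    fun x _ => ⟨ht, trivial⟩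

theorem SmoothFam.exists_deriv [T2Space M] [SecondCountableTopology M] (hJ : J.OrdConnected)
    (hJ' : J.Nontrivial) {s : ℝ → ∀ x : M, V x} (hs : SmoothFam I F J s) :
    ∃ s' : ℝ → Sec I F V, SmoothFam I F J (fun t x => s' t x) ∧
      ∀ t ∈ J, ∀ x, WDeriv J t (fun r => s r x) (s' t x) := by
  have hfr := fun x₀ : M => exists_frameOn (I := I) (F := F) (V := V) x₀
  choose U hU hxU n e ξ hfr using hfr
  have hW : ∀ x₀ : M, ∀ x ∈ U x₀, ∀ t ∈ J, WDeriv J t (fun r => s r x)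
      (∑ k, tderiv J (fun p : ℝ × M => ξ x₀ k p.2 (s p.1 p.2)) (t, x) • e x₀ k x) := by
    intro x₀ x hx t ht
    have h1 := WDeriv.sum (J := J) (t := t) fun k => WDeriv.smul
      ((hs.coeff ((hfr x₀).smooth k)).hasDerivWithinAt hJ hJ' ht x) (WDeriv.const (e x₀ k x))
    simp only [(hfr x₀).sum x hx, smul_zero, add_zero] at h1
    exact h1
  set s'' : ℝ → ∀ x : M, V x := fun t x =>
    ∑ k, tderiv J (fun p : ℝ × M => ξ x k p.2 (s p.1 p.2)) (t, x) • e x k x with hs''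
  have hs''W : ∀ t ∈ J, ∀ x, WDeriv J t (fun r => s r x) (s'' t x) :=
    fun t ht x => hW x x (hxU x) t ht
  have hsm : SmoothFam I F J s'' := by
    rintro ⟨t, x₀⟩ ⟨ht, -⟩
    have h1 := smoothFam_sum_smul (J := J) (e x₀) fun k =>
      (hs.coeff ((hfr x₀).smooth k)).tderiv hJ hJ'
    have hev : ∀ᶠ p in 𝓝[J ×ˢ univ] (t, x₀), p.1 ∈ J ∧ p.2 ∈ U x₀ := by
      have h2 : (univ : Set ℝ) ×ˢ U x₀ ∈ 𝓝 (t, x₀) :=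
        prod_mem_nhds univ_mem ((hU x₀).mem_nhds (hxU x₀))
      filter_upwards [self_mem_nhdsWithin, mem_nhdsWithin_of_mem_nhds h2] with p h1 h2
      exact ⟨h1.1, h2.2⟩
    have huniq := uniqueDiffOn_of_ordConnected hJ hJ'
    exact (h1 (t, x₀) ⟨ht, trivial⟩).congr_of_eventuallyEq
      (hev.mono fun p hp => congrArg (fun v => (⟨p.2, v⟩ : TotalSpace F V))
        ((hs''W p.1 hp.1 p.2).unique huniq hp.1 (hW x₀ p.2 hp.2 p.1 hp.1)))
      rfl
  classical
  refine ⟨fun t => if ht : t ∈ J then ⟨s'' t, hsm.contMDiff ht⟩ else 0, ?_, fun t ht x => ?_⟩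
  · refine hsm.congr fun p hp => ?_
    simp only [dif_pos hp.1]
    rfl
  · simp only [dif_pos ht]
    exact hs''W t ht x

theorem WDeriv.hasDerivWithinAt_fiber (F : Type*) [NormedAddCommGroup F] [NormedSpace ℝ F]
    [FiniteDimensional ℝ F] {V : M → Type*} [TopologicalSpace (TotalSpace F V)]
    [∀ x, AddCommGroup (V x)] [∀ x, Module ℝ (V x)] [∀ x, TopologicalSpace (V x)]
    [FiberBundle F V] [VectorBundle ℝ F V] [∀ x, IsTopologicalAddGroup (V x)]
    [∀ x, ContinuousSMul ℝ (V x)] {t : ℝ} {x : M} {f : ℝ → V x} {v : V x}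
    (hf : WDeriv J t f v) : HasDerivWithinAt f v J t := by
  set L := (trivializationAt F V x).continuousLinearEquivAt ℝ x
    (mem_baseSet_trivializationAt F V x)
  have h1 : HasDerivWithinAt (fun s => L (f s)) (L v) J t :=
    (hf.map (L : V x →L[ℝ] F).toLinearMap).hasDerivWithinAt
  rw [hasDerivWithinAt_iff_hasFDerivWithinAt, hasFDerivWithinAt_iff_isLittleOTVS]
  refine ((L.symm : F →L[ℝ] V x).isBigOTVS_comp.trans_isLittleOTVS
    h1.hasFDerivWithinAt.isLittleOTVS).congr_left fun s => ?_
  simp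

end Frames

section Algebroid

variable {E : Type*} [NormedAddCommGroup E] [NormedSpace ℝ E] [FiniteDimensional ℝ E]
  {H : Type*} [TopologicalSpace H] {I : ModelWithCorners ℝ E H} [I.Boundaryless]
  {M : Type*} [TopologicalSpace M] [ChartedSpace H M] [IsManifold I ∞ M]
  {J : Set ℝ}

variable {F : Type*} [NormedAddCommGroup F] [NormedSpace ℝ F] [FiniteDimensional ℝ F]
  {V : M → Type*} [TopologicalSpace (TotalSpace F V)]
  [∀ x, AddCommGroup (V x)] [∀ x, Module ℝ (V x)] [∀ x, TopologicalSpace (V x)]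
  [FiberBundle F V] [VectorBundle ℝ F V] [ContMDiffVectorBundle ∞ F V I]

/-- `T : Γ(A) → A_x` is a first order operator with scalar symbol `X ∈ T_x M`. -/
def IsDerAt (x : M) (T : Sec I F V →ₗ[ℝ] V x) (X : TangentSpace I x) : Prop :=
  ∀ (f : Fun I M) (β : Sec I F V), T (f • β) = f x • T β + mvfderiv I f x X • β x

/-- Evaluation of sections at a point. -/
def evalAt (x : M) : Sec I F V →ₗ[ℝ] V x where
  toFun s := s x
  map_add' _ _ := rfl
  map_smul' _ _ := rfl

@[simp] theorem evalAt_apply (x : M) (s : Sec I F V) : evalAt x s = s x := rfl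

theorem sec_sum_apply {κ : Type*} (S : Finset κ) (f : κ → Sec I F V) (x : M) :
    (∑ k ∈ S, f k) x = ∑ k ∈ S, f k x :=
  map_sum (evalAt x) f S

/-- A component of a section as a smooth function. -/
def coeffFun {ξ : ∀ x : M, V x →ₗ[ℝ] ℝ}
    (hξ : ContMDiff (I.prod 𝓘(ℝ, F)) 𝓘(ℝ, ℝ) ∞ (fun p : TotalSpace F V => ξ p.1 p.2))
    (β : Sec I F V) : Fun I M :=
  ⟨fun x => ξ x (β x), hξ.comp β.contMDiff⟩

@[simp] theorem coeffFun_apply {ξ : ∀ x : M, V x →ₗ[ℝ] ℝ}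
    (hξ : ContMDiff (I.prod 𝓘(ℝ, F)) 𝓘(ℝ, ℝ) ∞ (fun p : TotalSpace F V => ξ p.1 p.2))
    (β : Sec I F V) (x : M) : coeffFun hξ β x = ξ x (β x) := rfl

section Locality

variable [T2Space M] [SecondCountableTopology M]

theorem IsDerAt.congr {x : M} {T : Sec I F V →ₗ[ℝ] V x} {X : TangentSpace I x}
    (hT : IsDerAt x T X) {β γ : Sec I F V} (h : ∀ᶠ y in 𝓝 x, β y = γ y) : T β = T γ := by
  obtain ⟨U, hUs, hU, hxU⟩ := mem_nhds_iff.1 h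
  obtain ⟨χ, h1, h2⟩ := exists_bump (I := I) (isClosed_singleton (x := x)) hU
    (singleton_subset_iff.2 hxU)
  have hx1 : χ x = 1 := h1.self_of_nhdsSet x rfl
  have h3 : χ • (β - γ) = 0 := by
    ext y
    by_cases hy : y ∈ U
    · have : β y = γ y := hUs hy
      simp [this]
    · have : χ y = 0 := image_eq_zero_of_notMem_tsupport fun hy' => hy (h2 hy')
      simp [this]
  have h4 := hT χ (β - γ)
  have h5 : (β - γ) x = 0 := by
    have : β x = γ x := hUs hxU
    simp [this]
  rw [h3, map_zero, hx1, one_smul, h5, smul_zero, add_zero, map_sub] at h4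
  exact (sub_eq_zero.1 h4.symm)

theorem IsDerAt.eq_sum {x : M} {T : Sec I F V →ₗ[ℝ] V x} {X : TangentSpace I x}
    (hT : IsDerAt x T X) {U : Set M} (hU : U ∈ 𝓝 x) {κ : Type*} [Fintype κ] {s : κ → Sec I F V}
    {ξ : κ → ∀ x : M, V x →ₗ[ℝ] ℝ} (h : FrameOn U s ξ) (β : Sec I F V) :
    T β = ∑ k, (ξ k x (β x) • T (s k) +
      mvfderiv I (fun y => ξ k y (β y)) x X • s k x) := by
  have h1 : T β = T (∑ k, coeffFun (h.smooth k) β • s k) := by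
    refine hT.congr (mem_of_superset hU fun y hy => ?_)
    simp only [mem_ofPred_eq, sec_sum_apply, fun_smul_apply, coeffFun_apply]
    exact (h.sum y hy (β y)).symm
  rw [h1, map_sum]
  exact Finset.sum_congr rfl fun k _ => hT (coeffFun (h.smooth k) β) (s k)

theorem IsDerAt.wderiv {x : M} {t : ℝ} (ht : t ∈ J) (hJ : J.OrdConnected) (hJ' : J.Nontrivial)
    {T : ℝ → Sec I F V →ₗ[ℝ] V x}
    {X : ℝ → TangentSpace I x} {T' : Sec I F V →ₗ[ℝ] V x} {X' : TangentSpace I x}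
    (hT : ∀ s ∈ J, IsDerAt x (T s) (X s)) (hT' : IsDerAt x T' X')
    (hd : ∀ β, WDeriv J t (fun s => T s β) (T' β)) (hX : WDeriv J t X X')
    {β β' : ℝ → Sec I F V} (hβ : SmoothFam I F J fun t x => β t x)
    (hβ' : ∀ t ∈ J, ∀ x, WDeriv J t (fun s => β s x) (β' t x)) :
    WDeriv J t (fun s => T s (β s)) (T' (β t) + T t (β' t)) := by
  obtain ⟨U, hU, hxU, n, s, ξ, hfr⟩ := exists_frameOn (I := I) (F := F) (V := V) x
  have hUx := hU.mem_nhds hxU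
  have hg : ∀ k, SmoothFun I J (fun p : ℝ × M => ξ k p.2 (β p.1 p.2)) :=
    fun k => hβ.coeff (hfr.smooth k)
  have hgd : ∀ k y, tderiv J (fun p : ℝ × M => ξ k p.2 (β p.1 p.2)) (t, y) = ξ k y (β' t y) := by
    intro k y
    have h1 := (hg k).hasDerivWithinAt hJ hJ' ht y
    exact (uniqueDiffOn_of_ordConnected hJ hJ' t ht).eq_deriv _ h1 (hβ' t ht y (ξ k y))
  have key : ∀ k, WDeriv J t (fun s' => ξ k x (β s' x) • T s' (s k) +
      mvfderiv I (fun y => ξ k y (β s' y)) x (X s') • s k x)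
      ((ξ k x (β' t x) • T t (s k) + ξ k x (β t x) • T' (s k)) +
        ((mvfderiv I (fun y => ξ k y (β' t y)) x (X t) +
          mvfderiv I (fun y => ξ k y (β t y)) x X') • s k x)) := by
    intro k
    refine (WDeriv.smul (hβ' t ht x (ξ k x)) (hd (s k))).add ?_
    have h1 := (hg k).hasDerivWithinAt_mvfderiv hJ hJ' ht x
    simp only [hgd] at h1
    have hX1 : WDeriv (W := E) J t X X' := hX
    have h2 := WDeriv.clm_apply (G := E) h1 hX1
    have h3 := WDeriv.smul h2 (WDeriv.const (s k x))
    rw [smul_zero, add_zero] at h3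
    exact h3
  have h4 := (WDeriv.sum key).congr ht fun r hr => (hT r hr).eq_sum hUx hfr (β r)
  convert h4 using 1
  rw [hT'.eq_sum hUx hfr (β t), (hT t ht).eq_sum hUx hfr (β' t), ← Finset.sum_add_distrib]
  refine Finset.sum_congr rfl fun k _ => ?_
  module

theorem SmoothFam.add {a b : ℝ → ∀ x : M, V x} (ha : SmoothFam I F J a) (hb : SmoothFam I F J b) :
    SmoothFam I F J (fun t x => a t x + b t x) := by
  rintro ⟨t, x₀⟩ hp
  obtain ⟨U, hU, hxU, n, s, ξ, hfr⟩ := exists_frameOn (I := I) (F := F) (V := V) x₀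
  refine hfr.contMDiffWithinAt (hU.mem_nhds hxU) contMDiffWithinAt_snd fun k => ?_
  simp only [map_add]
  exact (ha.coeff (hfr.smooth k) _ hp).add (hb.coeff (hfr.smooth k) _ hp)

theorem SmoothFam.smul {g : ℝ × M → ℝ} {a : ℝ → ∀ x : M, V x} (hg : SmoothFun I J g)
    (ha : SmoothFam I F J a) : SmoothFam I F J (fun t x => g (t, x) • a t x) := by
  rintro ⟨t, x₀⟩ hp
  obtain ⟨U, hU, hxU, n, s, ξ, hfr⟩ := exists_frameOn (I := I) (F := F) (V := V) x₀
  refine hfr.contMDiffWithinAt (hU.mem_nhds hxU) contMDiffWithinAt_snd fun k => ?_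
  simp only [map_smul]
  exact (hg _ hp).smul (ha.coeff (hfr.smooth k) _ hp)

theorem SmoothFam.sum {κ : Type*} [Fintype κ] {a : κ → ℝ → ∀ x : M, V x}
    (ha : ∀ k, SmoothFam I F J (a k)) : SmoothFam I F J (fun t x => ∑ k, a k t x) := by
  rintro ⟨t, x₀⟩ hp
  obtain ⟨U, hU, hxU, n, s, ξ, hfr⟩ := exists_frameOn (I := I) (F := F) (V := V) x₀
  refine hfr.contMDiffWithinAt (hU.mem_nhds hxU) contMDiffWithinAt_snd fun k => ?_
  simp only [map_sum]
  exact ContMDiffWithinAt.sum fun j _ => (ha j).coeff (hfr.smooth k) _ hp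

theorem IsDerAt.smoothFam {T : ℝ → ∀ x : M, Sec I F V →ₗ[ℝ] V x}
    {X : ℝ → ∀ x : M, TangentSpace I x} (hJ : J.OrdConnected) (hJ' : J.Nontrivial)
    (hT : ∀ t ∈ J, ∀ x, IsDerAt x (T t x) (X t x)) (hTs : ∀ β, SmoothFam I F J fun t x => T t x β)
    (hX : SmoothFam I E J X) {β : ℝ → Sec I F V} (hβ : SmoothFam I F J fun t x => β t x) :
    SmoothFam I F J (fun t x => T t x (β t)) := by
  rintro ⟨t, x₀⟩ ⟨ht, -⟩
  obtain ⟨U, hU, hxU, n, s, ξ, hfr⟩ := exists_frameOn (I := I) (F := F) (V := V) x₀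
  have hg : ∀ k, SmoothFun I J (fun p : ℝ × M => ξ k p.2 (β p.1 p.2)) :=
    fun k => hβ.coeff (hfr.smooth k)
  have h1 : SmoothFam I F J (fun t x => ∑ k, (ξ k x (β t x) • T t x (s k) +
      mvfderiv I (fun y => ξ k y (β t y)) x (X t x) • s k x)) :=
    SmoothFam.sum fun k => (SmoothFam.smul (hg k) (hTs (s k))).add
      (SmoothFam.smul ((hg k).mvfderiv_apply hJ hJ' hX) (SmoothFam.const (s k)))
  have hev : ∀ᶠ p in 𝓝[J ×ˢ univ] (t, x₀), p.1 ∈ J ∧ p.2 ∈ U := by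
    have h2 : (univ : Set ℝ) ×ˢ U ∈ 𝓝 (t, x₀) := prod_mem_nhds univ_mem (hU.mem_nhds hxU)
    filter_upwards [self_mem_nhdsWithin, mem_nhdsWithin_of_mem_nhds h2] with p h1 h2
    exact ⟨h1.1, h2.2⟩
  exact (h1 (t, x₀) ⟨ht, trivial⟩).congr_of_eventuallyEq
    (hev.mono fun p hp => congrArg (fun v => (⟨p.2, v⟩ : TotalSpace F V))
      ((hT p.1 hp.1 p.2).eq_sum (hU.mem_nhds hp.2) hfr (β p.1)))
    (congrArg (fun v => (⟨x₀, v⟩ : TotalSpace F V))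
      ((hT t ht x₀).eq_sum (hU.mem_nhds hxU) hfr (β t)))

theorem exists_sec_apply_eq {x : M} (v : V x) : ∃ α : Sec I F V, α x = v := by
  obtain ⟨U, hU, hxU, n, s, ξ, hfr⟩ := exists_frameOn (I := I) (F := F) (V := V) x
  refine ⟨∑ k, ξ k x v • s k, ?_⟩
  rw [sec_sum_apply]
  exact hfr.sum x hxU v

end Locality

namespace LieAlgebroid

variable (A : LieAlgebroid I F V)

theorem bracket_swap (α β : Sec I F V) : A.bracket α β = -A.bracket β α := by
  have h := A.bracket_self (α + β)
  simp only [map_add, LinearMap.add_apply, A.bracket_self, zero_add, add_zero] at h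
  exact eq_neg_of_add_eq_zero_right h

theorem isDerAt_bracket (α : Sec I F V) (x : M) :
    IsDerAt x (evalAt x ∘ₗ A.bracket α) (A.anchor x (α x)) :=
  fun f β => A.leibniz α β f x

end LieAlgebroid

/-- The alternating map associated with an alternating bilinear map. -/
def altTwo {Γ Γ' : Type*} [AddCommGroup Γ] [Module ℝ Γ] [AddCommGroup Γ'] [Module ℝ Γ']
    (b : Γ →ₗ[ℝ] Γ →ₗ[ℝ] Γ') (hb : ∀ α, b α α = 0) : Γ [⋀^Fin 2]→ₗ[ℝ] Γ' where
  toFun v := b (v 0) (v 1)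
  map_update_add' v i x y := by
    fin_cases i <;> simp [Function.update]
  map_update_smul' v i c x := by
    fin_cases i <;> simp [Function.update]
  map_eq_zero_of_eq' v i j h hij := by
    have : v 0 = v 1 := by
      fin_cases i <;> fin_cases j <;> simp_all
    simp [this, hb]

@[simp] theorem altTwo_apply {Γ Γ' : Type*} [AddCommGroup Γ] [Module ℝ Γ] [AddCommGroup Γ']
    [Module ℝ Γ'] (b : Γ →ₗ[ℝ] Γ →ₗ[ℝ] Γ') (hb : ∀ α, b α α = 0) (v : Fin 2 → Γ) :
    altTwo b hb v = b (v 0) (v 1) := rfl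

/-- The alternating map of one variable associated with a linear map. -/
def altOne {R Γ Γ' : Type*} [CommRing R] [AddCommGroup Γ] [Module R Γ] [AddCommGroup Γ']
    [Module R Γ'] (b : Γ →ₗ[R] Γ') : Γ [⋀^Fin 1]→ₗ[R] Γ' where
  toFun v := b (v 0)
  map_update_add' v i x y := by
    fin_cases i; simp [Function.update]
  map_update_smul' v i c x := by
    fin_cases i; simp [Function.update]
  map_eq_zero_of_eq' v i j h hij := absurd (Subsingleton.elim i j) hij

@[simp] theorem altOne_apply {R Γ Γ' : Type*} [CommRing R] [AddCommGroup Γ] [Module R Γ]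
    [AddCommGroup Γ'] [Module R Γ'] (b : Γ →ₗ[R] Γ') (v : Fin 1 → Γ) : altOne b v = b (v 0) := rfl

theorem removeNth_eq_of_fin_two {Γ : Type*} (α : Fin 2 → Γ) :
    Fin.removeNth (n := 1) (α := fun _ => Γ) 0 α = ![α 1] ∧
    Fin.removeNth (n := 1) (α := fun _ => Γ) 1 α = ![α 0] := by
  constructor <;> (ext i : 1; fin_cases i; rfl)

theorem removeNth_eq_of_fin_three {Γ : Type*} (α : Fin 3 → Γ) :
    Fin.removeNth (n := 2) (α := fun _ => Γ) 0 α = ![α 1, α 2] ∧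
    Fin.removeNth (n := 2) (α := fun _ => Γ) 1 α = ![α 0, α 2] ∧
    Fin.removeNth (n := 2) (α := fun _ => Γ) 2 α = ![α 0, α 1] := by
  refine ⟨?_, ?_, ?_⟩ <;> (ext i : 1; fin_cases i <;> rfl)

theorem LieAlgebroid.delta_succ (A : LieAlgebroid I F V) {n : ℕ}
    (D : Sec I F V [⋀^Fin (n + 1)]→ₗ[ℝ] Sec I F V) (α : Fin (n + 2) → Sec I F V) : A.delta D α =
      ∑ i : Fin (n + 2), (-1 : ℝ) ^ (i : ℕ) • A.bracket (α i) (D (i.removeNth α)) +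
      ∑ j : Fin (n + 2), ∑ i : Fin (n + 1),
        if i.castSucc < j then
          (-1 : ℝ) ^ ((i : ℕ) + (j : ℕ)) •
            D (Fin.cons (A.bracket (α i.castSucc) (α j)) (i.removeNth (j.removeNth α)))
        else 0 := rfl

theorem LieAlgebroid.delta_one (A : LieAlgebroid I F V) (D : Sec I F V [⋀^Fin 1]→ₗ[ℝ] Sec I F V)
    (α : Fin 2 → Sec I F V) : A.delta D α = A.bracket (α 0) (D ![α 1]) -
      A.bracket (α 1) (D ![α 0]) - D ![A.bracket (α 0) (α 1)] := by
  obtain ⟨e1, e2⟩ := removeNth_eq_of_fin_two α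
  have e3 : ∀ (w : Sec I F V) (v : Fin 0 → Sec I F V),
      Fin.cons (n := 0) (α := fun _ => Sec I F V) w v = ![w] := by
    intro w v; ext i : 1; fin_cases i; rfl
  rw [LieAlgebroid.delta_succ, Fin.sum_univ_two, Fin.sum_univ_two, Fin.sum_univ_one, Fin.sum_univ_one, e3, e3, e1, e2,
    if_neg (by decide), if_pos (by decide)]
  simp [sub_eq_add_neg]

theorem LieAlgebroid.delta_two (A : LieAlgebroid I F V) (D : Sec I F V [⋀^Fin 2]→ₗ[ℝ] Sec I F V)
    (α : Fin 3 → Sec I F V) : A.delta D α = A.bracket (α 0) (D ![α 1, α 2]) -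
      A.bracket (α 1) (D ![α 0, α 2]) + A.bracket (α 2) (D ![α 0, α 1]) -
      D ![A.bracket (α 0) (α 1), α 2] + D ![A.bracket (α 0) (α 2), α 1] -
      D ![A.bracket (α 1) (α 2), α 0] := by
  obtain ⟨r0, r1, r2⟩ := removeNth_eq_of_fin_three α
  have e3 : ∀ u v : Sec I F V, Fin.cons (n := 1) (α := fun _ => Sec I F V) u ![v] = ![u, v] :=
    fun _ _ => rfl
  rw [LieAlgebroid.delta_succ, Fin.sum_univ_three, Fin.sum_univ_three, Fin.sum_univ_two, Fin.sum_univ_two, Fin.sum_univ_two,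
    r0, r1, r2, (removeNth_eq_of_fin_two _).1, (removeNth_eq_of_fin_two _).1,
    (removeNth_eq_of_fin_two _).1, (removeNth_eq_of_fin_two _).2, (removeNth_eq_of_fin_two _).2,
    (removeNth_eq_of_fin_two _).2, e3, e3, e3, e3, e3, e3, if_neg (by decide), if_neg (by decide),
    if_pos (by decide), if_neg (by decide), if_pos (by decide), if_pos (by decide)]
  simp [sub_eq_add_neg, pow_succ]
  abel

end Algebroid

section DerivativeCochain

variable {E : Type*} [NormedAddCommGroup E] [NormedSpace ℝ E] [FiniteDimensional ℝ E]
  {H : Type*} [TopologicalSpace H] {I : ModelWithCorners ℝ E H} [I.Boundaryless]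
  {M : Type*} [TopologicalSpace M] [ChartedSpace H M] [IsManifold I ∞ M]
  {J : Set ℝ}

variable {F : Type*} [NormedAddCommGroup F] [NormedSpace ℝ F] [FiniteDimensional ℝ F]
  {V : M → Type*} [TopologicalSpace (TotalSpace F V)]
  [∀ x, AddCommGroup (V x)] [∀ x, Module ℝ (V x)] [∀ x, TopologicalSpace (V x)]
  [FiberBundle F V] [VectorBundle ℝ F V] [ContMDiffVectorBundle ∞ F V I]

variable [T2Space M] [SecondCountableTopology M] {A : ℝ → LieAlgebroid I F V}

theorem IsSmoothFamily.smoothFam_anchor (hA : IsSmoothFamily J A) {α : ℝ → ∀ x : M, V x}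
    (hα : SmoothFam I F J α) :
    SmoothFam I E (V := (TangentSpace I : M → Type _)) J (fun t x => (A t).anchor x (α t x)) :=
  ContMDiffOn.comp (t := J ×ˢ univ) hA.anchor (contMDiffOn_fst.prodMk hα)
    fun _ hp => ⟨hp.1, trivial⟩

theorem IsSmoothFamily.smoothFam_bracket (hA : IsSmoothFamily J A) (hJ : J.OrdConnected)
    (hJ' : J.Nontrivial) {α β : ℝ → Sec I F V} (hα : SmoothFam I F J fun t x => α t x)
    (hβ : SmoothFam I F J fun t x => β t x) :
    SmoothFam I F J (fun t x => (A t).bracket (α t) (β t) x) := by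
  have h1 : ∀ (γ : Sec I F V) {β : ℝ → Sec I F V}, SmoothFam I F J (fun t x => β t x) →
      SmoothFam I F J (fun t x => (A t).bracket γ (β t) x) := fun γ β hβ =>
    IsDerAt.smoothFam (T := fun t x => evalAt x ∘ₗ (A t).bracket γ)
      (X := fun t x => (A t).anchor x (γ x)) hJ hJ' (fun t _ x => (A t).isDerAt_bracket γ x)
      (hA.bracket γ) (hA.smoothFam_anchor (SmoothFam.const γ)) hβ
  refine IsDerAt.smoothFam (T := fun t x => evalAt x ∘ₗ (A t).bracket (α t))
      (X := fun t x => (A t).anchor x (α t x)) hJ hJ' (fun t _ x => (A t).isDerAt_bracket (α t) x)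
      (fun γ => ?_) (hA.smoothFam_anchor hα) hβ
  have h2 : SmoothFam I F J (fun t x => (fun _ => (-1 : ℝ)) (t, x) • (A t).bracket γ (α t) x) :=
    SmoothFam.smul (g := fun _ => (-1 : ℝ)) contMDiffOn_const (h1 γ hα)
  refine h2.congr fun p _ => ?_
  simp [(A p.1).bracket_swap (α p.1) γ]

/-- `c t` is the derivative of the brackets and `σ t` the derivative of the anchors of the
family `A`. -/
structure BracketDeriv (J : Set ℝ) (A : ℝ → LieAlgebroid I F V)
    (c : ℝ → Sec I F V →ₗ[ℝ] Sec I F V →ₗ[ℝ] Sec I F V)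
    (σ : ℝ → Sec I F V →ₗ[Fun I M] VF I M) : Prop where
  self : ∀ t α, c t α α = 0
  wderiv_bracket : ∀ t ∈ J, ∀ α β x, WDeriv J t (fun s => (A s).bracket α β x) (c t α β x)
  wderiv_anchor : ∀ t ∈ J, ∀ (α : Sec I F V) (x : M),
    WDeriv J t (fun s => (A s).anchor x (α x)) (σ t α x)

theorem IsSmoothFamily.exists_bracketDeriv (hA : IsSmoothFamily J A) (hJ : J.OrdConnected)
    (hJ' : J.Nontrivial) : ∃ c σ, BracketDeriv J A c σ := by
  classical
  have hu := uniqueDiffOn_of_ordConnected hJ hJ'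
  choose c₀ _ hc₀ using fun α β : Sec I F V => SmoothFam.exists_deriv (s := fun t x => (A t).bracket α β x) hJ hJ'
    (hA.bracket α β)
  choose X₀ _ hX₀ using fun α : Sec I F V =>
    SmoothFam.exists_deriv hJ hJ' (hA.smoothFam_anchor (SmoothFam.const α))
  refine ⟨fun t => if ht : t ∈ J then LinearMap.mk₂ ℝ (fun α β => c₀ α β t) ?_ ?_ ?_ ?_ else 0,
    fun t => if ht : t ∈ J then ⟨⟨fun α => X₀ α t, ?_⟩, ?_⟩ else 0, ?_, ?_, ?_⟩
  · intro α α' β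
    ext x
    refine (hc₀ _ _ t ht x).unique hu ht ?_
    simpa using (hc₀ α β t ht x).add (hc₀ α' β t ht x)
  · intro r α β
    ext x
    refine (hc₀ _ _ t ht x).unique hu ht ?_
    simpa using (hc₀ α β t ht x).const_smul r
  · intro α β β'
    ext x
    refine (hc₀ _ _ t ht x).unique hu ht ?_
    simpa using (hc₀ α β t ht x).add (hc₀ α β' t ht x)
  · intro r α β
    ext x
    refine (hc₀ _ _ t ht x).unique hu ht ?_
    simpa using (hc₀ α β t ht x).const_smul r
  · intro α β
    ext x
    refine (hX₀ _ t ht x).unique hu ht ?_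
    simpa using (hX₀ α t ht x).add (hX₀ β t ht x)
  · intro f α
    ext x
    refine (hX₀ _ t ht x).unique hu ht ?_
    simpa using (hX₀ α t ht x).const_smul (f x)
  · intro t α
    by_cases ht : t ∈ J
    · ext x
      simp only [dif_pos ht, LinearMap.mk₂_apply]
      refine (hc₀ _ _ t ht x).unique hu ht ?_
      simpa [(A _).bracket_self] using WDeriv.const (J := J) (t := t) (0 : V x)
    · simp [dif_neg ht]
  · intro t ht α β x
    simpa only [dif_pos ht, LinearMap.mk₂_apply] using hc₀ α β t ht x
  · intro t ht α x
    simp only [dif_pos ht]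
    exact hX₀ α t ht x

namespace BracketDeriv

variable {c : ℝ → Sec I F V →ₗ[ℝ] Sec I F V →ₗ[ℝ] Sec I F V}
  {σ : ℝ → Sec I F V →ₗ[Fun I M] VF I M}

theorem swap (h : BracketDeriv J A c σ) (t : ℝ) (α β : Sec I F V) : c t α β = -c t β α := by
  have h := h.self t (α + β)
  simp only [map_add, LinearMap.add_apply, BracketDeriv.self ‹_›, zero_add, add_zero] at h
  exact eq_neg_of_add_eq_zero_right h

theorem isDerAt (h : BracketDeriv J A c σ) (hJ : J.OrdConnected) (hJ' : J.Nontrivial) {t : ℝ}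
    (ht : t ∈ J) (α : Sec I F V) (x : M) : IsDerAt x (evalAt x ∘ₗ c t α) (σ t α x) := by
  intro f β
  refine (h.wderiv_bracket t ht α (f • β) x).unique (uniqueDiffOn_of_ordConnected hJ hJ') ht ?_
  have h1 := (h.wderiv_anchor t ht α x).map (mvfderiv I f x).toLinearMap
  have h2 := ((h.wderiv_bracket t ht α β x).const_smul (f x)).add
    (WDeriv.smul (h1 LinearMap.id) (WDeriv.const (β x)))
  simp only [smul_zero, add_zero] at h2
  exact h2.congr ht fun s _ => (A s).leibniz α β f x

theorem wderiv_anchor_apply (h : BracketDeriv J A c σ) (hJ : J.OrdConnected) (hJ' : J.Nontrivial)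
    {t : ℝ} (ht : t ∈ J) {α : ℝ → Sec I F V} {α' : Sec I F V} {x : M}
    (hα : WDeriv J t (fun s => α s x) (α' x)) :
    WDeriv J t (fun s => (A s).anchor x (α s x)) (σ t (α t) x + (A t).anchor x (α' x)) := by
  obtain ⟨U, hU, hxU, n, e, ξ, hfr⟩ := exists_frameOn (I := I) (F := F) (V := V) x
  have h0 : ∀ s (v : V x), (A s).anchor x v = ∑ k, ξ k x v • (A s).anchor x (e k x) := by
    intro s v
    conv_lhs => rw [← hfr.sum x hxU v]
    simp only [map_sum, map_smul]
  have h1 := WDeriv.sum fun k => WDeriv.smul (hα (ξ k x)) (h.wderiv_anchor t ht (e k) x)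
  have h2 : σ t (α t) x = ∑ k, ξ k x (α t x) • σ t (e k) x := by
    refine (h.wderiv_anchor t ht (α t) x).unique (uniqueDiffOn_of_ordConnected hJ hJ') ht ?_
    exact (WDeriv.sum fun k => (h.wderiv_anchor t ht (e k) x).const_smul (ξ k x (α t x))).congr ht
      fun s _ => h0 s _
  rw [Finset.sum_add_distrib, ← h0, ← h2, add_comm] at h1
  exact h1.congr ht fun s _ => h0 s _

theorem wderiv_bracket_apply (h : BracketDeriv J A c σ) (hJ : J.OrdConnected)
    (hJ' : J.Nontrivial) {t : ℝ} (ht : t ∈ J) {α β α' β' : ℝ → Sec I F V}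
    (hα : SmoothFam I F J fun t x => α t x) (hα' : ∀ t ∈ J, ∀ x, WDeriv J t (fun s => α s x) (α' t x))
    (hβ : SmoothFam I F J fun t x => β t x) (hβ' : ∀ t ∈ J, ∀ x, WDeriv J t (fun s => β s x) (β' t x))
    (x : M) : WDeriv J t (fun s => (A s).bracket (α s) (β s) x)
      (c t (α t) (β t) x + (A t).bracket (α' t) (β t) x + (A t).bracket (α t) (β' t) x) := by
  have h1 : ∀ γ, WDeriv J t (fun s => (A s).bracket γ (α s) x)
      (c t γ (α t) x + (A t).bracket γ (α' t) x) := fun γ =>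
    IsDerAt.wderiv ht hJ hJ' (T := fun s => evalAt x ∘ₗ (A s).bracket γ)
      (X := fun s => (A s).anchor x (γ x)) (fun s _ => (A s).isDerAt_bracket γ x)
      (h.isDerAt hJ hJ' ht γ x) (fun β => h.wderiv_bracket t ht γ β x) (h.wderiv_anchor t ht γ x)
      hα hα'
  refine IsDerAt.wderiv ht hJ hJ' (T := fun s => evalAt x ∘ₗ (A s).bracket (α s))
      (X := fun s => (A s).anchor x (α s x))
      (T' := evalAt x ∘ₗ (c t (α t) + (A t).bracket (α' t)))
      (X' := σ t (α t) x + (A t).anchor x (α' t x)) (fun s _ => (A s).isDerAt_bracket (α s) x)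
      ?_ (fun γ => ?_) (h.wderiv_anchor_apply hJ hJ' ht (hα' t ht x)) hβ hβ'
  · intro f γ
    have e1 := h.isDerAt hJ hJ' ht (α t) x f γ
    have e2 := (A t).isDerAt_bracket (α' t) x f γ
    simp only [LinearMap.comp_apply, evalAt_apply, LinearMap.add_apply, map_add] at e1 e2 ⊢
    rw [e1, e2]
    module
  · have h2 := (h1 γ).neg
    simp only [LinearMap.comp_apply, evalAt_apply, LinearMap.add_apply, map_add]
    rw [h.swap t (α t) γ, (A t).bracket_swap (α' t) γ]
    convert h2 using 1
    · ext s
      rw [(A s).bracket_swap]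
      rfl
    · simp only [ContMDiffSection.coe_neg, Pi.neg_apply]
      abel

theorem isDefCochain (h : BracketDeriv J A c σ) (hJ : J.OrdConnected) (hJ' : J.Nontrivial) {t : ℝ}
    (ht : t ∈ J) : IsDefCochain (altTwo (c t) (h.self t)) := by
  refine ⟨altOne (σ t), fun s u f x => ?_⟩
  exact h.isDerAt hJ hJ' ht (s 0) x f u

theorem isDefCocycle (h : BracketDeriv J A c σ) (hA : IsSmoothFamily J A) (hJ : J.OrdConnected)
    (hJ' : J.Nontrivial) {t : ℝ} (ht : t ∈ J) : (A t).IsDefCocycle (altTwo (c t) (h.self t)) := by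
  refine ⟨h.isDefCochain hJ hJ' ht, fun α => ?_⟩
  have h1 : ∀ (α β γ : Sec I F V) (x : M), WDeriv J t (fun s => (A s).bracket α ((A s).bracket β γ) x)
      (c t α ((A t).bracket β γ) x + (A t).bracket α (c t β γ) x) := by
    intro α β γ x
    have h2 := h.wderiv_bracket_apply hJ hJ' ht (α := fun _ => α) (α' := fun _ => 0)
      (β := fun s => (A s).bracket β γ) (β' := fun t => c t β γ) (SmoothFam.const α)
      (fun t _ x => WDeriv.const (α x)) (hA.bracket β γ) (fun t ht x => h.wderiv_bracket t ht β γ x) x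
    simpa using h2
  rw [LieAlgebroid.delta_two]
  ext x
  have h2 := ((h1 (α 0) (α 1) (α 2) x).add (h1 (α 1) (α 2) (α 0) x)).add
    (h1 (α 2) (α 0) (α 1) x)
  have h3 := (h2.congr (g := fun _ => 0) ht fun s _ => by
    have := congrArg (fun s => s x) ((A s).jacobi (α 0) (α 1) (α 2))
    simpa using this.symm).unique (uniqueDiffOn_of_ordConnected hJ hJ') ht (WDeriv.const 0)
  have e1 := h.swap t ((A t).bracket (α 0) (α 1)) (α 2)
  have e2 := h.swap t ((A t).bracket (α 0) (α 2)) (α 1)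
  have e3 := h.swap t ((A t).bracket (α 1) (α 2)) (α 0)
  have e4 := (A t).bracket_swap (α 0) (α 2)
  have e5 := h.swap t (α 0) (α 2)
  rw [e4, map_neg] at e2
  simp only [altTwo_apply, Matrix.cons_val_zero, Matrix.cons_val_one, e1, e4, e2, e3, e5, map_neg,
    ContMDiffSection.coe_neg, ContMDiffSection.coe_add, ContMDiffSection.coe_sub,
    Pi.neg_apply, Pi.add_apply, Pi.sub_apply, ContMDiffSection.coe_zero, Pi.zero_apply]
  rw [← h3]
  abel

theorem isBracketDerivative [∀ x, IsTopologicalAddGroup (V x)] [∀ x, ContinuousSMul ℝ (V x)]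
    (h : BracketDeriv J A c σ) : IsBracketDerivative J A fun t => altTwo (c t) (h.self t) :=
  fun t ht α β x => (h.wderiv_bracket t ht α β x).hasDerivWithinAt_fiber F

end BracketDeriv

end DerivativeCochain

section LocalInverse

variable {E : Type*} [NormedAddCommGroup E] [NormedSpace ℝ E] [FiniteDimensional ℝ E]
  {J : Set ℝ} {U : Set E} {K : ℝ × E → E}

/-- An injective endomorphism of a finite-dimensional space as an equivalence. -/
theorem exists_equiv_of_injective {A : E →L[ℝ] E} (hA : Function.Injective A) :
    ∃ B : E ≃L[ℝ] E, (B : E →L[ℝ] E) = A :=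
  ⟨(LinearEquiv.ofInjectiveEndo A.toLinearMap hA).toContinuousLinearEquiv, by ext; rfl⟩

theorem eventually_exists_eq (hJ : J.OrdConnected) (hJ' : J.Nontrivial) (hU : IsOpen U)
    (hK : ContDiffOn ℝ ∞ K (J ×ˢ U)) {t₀ : ℝ} {ζ₀ : E} (h₀ : (t₀, ζ₀) ∈ J ×ˢ U)
    (hinj : Function.Injective (spaceDeriv J U K (t₀, ζ₀))) {r : ℝ} (hr : 0 < r) :
    ∀ᶠ p in 𝓝[J ×ˢ univ] (t₀, K (t₀, ζ₀)), ∃ z ∈ U, ‖z - ζ₀‖ ≤ r ∧ K (p.1, z) = p.2 := by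
  have hcE : CompleteSpace E := FiniteDimensional.complete ℝ E
  obtain ⟨B, hB⟩ := exists_equiv_of_injective hinj
  let S : (B : E →L[ℝ] E).NonlinearRightInverse :=
    { toFun := B.symm
      nnnorm := ‖(B.symm : E →L[ℝ] E)‖₊ + 1
      bound' := fun y => ((B.symm : E →L[ℝ] E).le_opNorm y).trans (by
        push_cast
        gcongr
        simp)
      right_inv' := fun y => B.apply_symm_apply y }
  set N : ℝ := ‖(B.symm : E →L[ℝ] E)‖ + 1 with hN
  have hN0 : 0 < N := by positivity
  have hSN : (S.nnnorm : ℝ) = N := by simp [S, hN]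
  have hc := (contDiffOn_spaceDeriv (m := 0) hJ hJ' hU hK (by simp)).continuousOn (t₀, ζ₀) h₀
  have hc' : ∀ᶠ q in 𝓝[J ×ˢ U] (t₀, ζ₀), ‖spaceDeriv J U K q - B‖ ≤ (2 * N)⁻¹ := by
    have := hc.eventually (Metric.closedBall_mem_nhds _ (show 0 < (2 * N)⁻¹ by positivity))
    filter_upwards [this] with q hq
    rwa [hB, ← dist_eq_norm]
  obtain ⟨δ, hδ, hδK⟩ := Metric.mem_nhdsWithin_iff.1 hc'
  obtain ⟨δ', hδ', hδU⟩ := Metric.isOpen_iff.1 hU ζ₀ h₀.2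
  set r' := min r (min (δ / 2) (δ' / 2)) with hr'
  have hr'0 : 0 < r' := by positivity
  have hr'1 : r' < δ := by
    have : r' ≤ δ / 2 := (min_le_right _ _).trans (min_le_left _ _)
    linarith
  have hr'2 : r' < δ' := by
    have : r' ≤ δ' / 2 := (min_le_right _ _).trans (min_le_right _ _)
    linarith
  have hball : Metric.closedBall ζ₀ r' ⊆ U :=
    (Metric.closedBall_subset_ball hr'2).trans hδU
  have hsurj : ∀ t ∈ J, dist t t₀ < δ → SurjOn (fun z => K (t, z)) (Metric.closedBall ζ₀ r')
      (Metric.closedBall (K (t, ζ₀)) ((2 * N)⁻¹ * r')) := by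
    intro t ht htδ
    have happ : ApproximatesLinearOn (fun z => K (t, z)) (B : E →L[ℝ] E)
        (Metric.closedBall ζ₀ r') ⟨(2 * N)⁻¹, by positivity⟩ := by
      intro x hx y hy
      refine Convex.norm_image_sub_le_of_norm_hasFDerivWithin_le' (f := fun z => K (t, z))
        (f' := fun z => spaceDeriv J U K (t, z)) (fun z hz => ?_) (fun z hz => ?_)
        (convex_closedBall ζ₀ r') hy hx
      · exact (hasFDerivAt_spaceDeriv hU (hK.differentiableOn (by simp) (t, z) ⟨ht, hball hz⟩)
          ⟨ht, hball hz⟩).hasFDerivWithinAt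
      · refine hδK ⟨?_, ht, hball hz⟩
        rw [Metric.mem_ball, Prod.dist_eq]
        exact max_lt htδ ((Metric.mem_closedBall.1 hz).trans_lt hr'1)
    have h1 : SurjOn (fun z => K (t, z)) (Metric.closedBall ζ₀ r')
        (Metric.closedBall (K (t, ζ₀)) (((S.nnnorm : ℝ)⁻¹ - ((2 * N)⁻¹)) * r')) :=
      happ.surjOn_closedBall_of_nonlinearRightInverse S hr'0.le Subset.rfl
    have h2 : ((S.nnnorm : ℝ)⁻¹ - ((2 * N)⁻¹)) * r' = (2 * N)⁻¹ * r' := by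
      rw [hSN]; field_simp; ring
    rwa [h2] at h1
  have hcont : ContinuousWithinAt (fun p : ℝ × E => p.2 - K (p.1, ζ₀)) (J ×ˢ univ)
      (t₀, K (t₀, ζ₀)) := by
    refine continuousWithinAt_snd.sub ?_
    refine ContinuousWithinAt.comp (t := J ×ˢ U) (g := K) (f := fun p : ℝ × E => (p.1, ζ₀))
      (hK.continuousOn (t₀, ζ₀) h₀) ?_ fun p hp => ⟨hp.1, h₀.2⟩
    exact continuousWithinAt_fst.prodMk continuousWithinAt_const
  have e1 := hcont.eventually (Metric.closedBall_mem_nhds _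
    (show 0 < (2 * N)⁻¹ * r' by positivity))
  have e2 : ∀ᶠ p in 𝓝[J ×ˢ univ] (t₀, K (t₀, ζ₀)), dist p.1 t₀ < δ :=
    (continuous_fst.continuousAt.continuousWithinAt).eventually (Metric.ball_mem_nhds _ hδ)
  filter_upwards [e1, e2, self_mem_nhdsWithin] with p h1 h2 h3
  obtain ⟨z, hz, hKz⟩ := hsurj p.1 h3.1 h2 (show p.2 ∈ _ by
    simpa [dist_eq_norm] using h1)
  refine ⟨z, hball hz, ?_, hKz⟩
  rw [← dist_eq_norm]
  exact (Metric.mem_closedBall.1 hz).trans (min_le_left _ _)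

theorem contDiffOn_of_leftInverse (hJ : J.OrdConnected) (hJ' : J.Nontrivial) (hU : IsOpen U)
    (hK : ContDiffOn ℝ ∞ K (J ×ˢ U)) (hinj : ∀ p ∈ J ×ˢ U, Function.Injective (spaceDeriv J U K p))
    {g : ℝ × E → E} (hg : ∀ p ∈ J ×ˢ U, g (p.1, K p) = p.2) {p₀ : ℝ × E} (hp₀ : p₀ ∈ J ×ˢ U) :
    ContDiffWithinAt ℝ ∞ g (J ×ˢ univ) (p₀.1, K p₀) := by
  have hcE : CompleteSpace E := FiniteDimensional.complete ℝ E
  set Ψ : ℝ × E → ℝ × E := fun p => (p.1, K p) with hΨ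
  set Ω : Set (ℝ × E) := Ψ '' (J ×ˢ U) with hΩ
  set G : ℝ × E → ℝ × E := fun p => (p.1, g p) with hG
  have hGΨ : ∀ p ∈ J ×ˢ U, G (Ψ p) = p := fun p hp => Prod.ext rfl (hg p hp)
  have hΩJ : Ω ⊆ J ×ˢ univ := by
    rintro _ ⟨p, hp, rfl⟩
    exact ⟨hp.1, trivial⟩
  have hev : ∀ p ∈ J ×ˢ U, ∀ r > 0, ∀ᶠ q in 𝓝[J ×ˢ univ] (Ψ p),
      q ∈ Ω ∧ G q ∈ J ×ˢ U ∧ Ψ (G q) = q ∧ ‖(G q).2 - p.2‖ ≤ r := by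
    intro p hp r hr
    filter_upwards [eventually_exists_eq hJ hJ' hU hK hp (hinj p hp) hr, self_mem_nhdsWithin] with
      q ⟨z, hzU, hz, hKz⟩ hq
    have hm : (q.1, z) ∈ J ×ˢ U := ⟨hq.1, hzU⟩
    have hq' : Ψ (q.1, z) = q := Prod.ext rfl hKz
    have hGq : G q = (q.1, z) := by rw [← hq']; exact hGΨ _ hm
    exact ⟨⟨_, hm, hq'⟩, hGq ▸ hm, by rw [hGq, hq'], by rw [hGq]; exact hz⟩
  have hΩn : ∀ q ∈ Ω, Ω ∈ 𝓝[J ×ˢ univ] q := by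
    rintro _ ⟨p, hp, rfl⟩
    exact (hev p hp 1 one_pos).mono fun q hq => hq.1
  have huniq : UniqueDiffOn ℝ Ω := fun q hq =>
    ((uniqueDiffOn_prod_of_ordConnected hJ hJ' isOpen_univ) q (hΩJ hq)).mono_nhds
      (le_antisymm (nhdsWithin_le_of_mem (hΩn q hq)) (nhdsWithin_mono _ hΩJ)).le
  have hcont : ∀ q ∈ Ω, ContinuousWithinAt G Ω q := by
    rintro _ ⟨p, hp, rfl⟩
    refine continuousWithinAt_fst.prodMk ?_
    rw [ContinuousWithinAt, Metric.tendsto_nhds]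
    intro ε hε
    have h2 := (hev p hp (ε / 2) (half_pos hε)).filter_mono (nhdsWithin_mono _ hΩJ)
    filter_upwards [h2] with q hq
    have h3 : g (Ψ p) = p.2 := hg p hp
    rw [h3, dist_eq_norm]
    exact hq.2.2.2.trans_lt (half_lt_self hε)
  have hΨs : ContDiffOn ℝ ∞ Ψ (J ×ˢ U) := contDiffOn_fst.prodMk hK
  have hS := uniqueDiffOn_prod_of_ordConnected hJ hJ' hU
  have hequiv : ∀ p ∈ J ×ˢ U, ∃ B : (ℝ × E) ≃L[ℝ] (ℝ × E),
      (B : ℝ × E →L[ℝ] ℝ × E) = fderivWithin ℝ Ψ (J ×ˢ U) p := by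
    intro p hp
    have hd := (hK.differentiableOn (by simp) p hp).hasFDerivWithinAt
    have h1 : fderivWithin ℝ Ψ (J ×ˢ U) p =
        (ContinuousLinearMap.fst ℝ ℝ E).prod (fderivWithin ℝ K (J ×ˢ U) p) :=
      (hasFDerivWithinAt_fst.prodMk hd).fderivWithin (hS p hp)
    refine exists_equiv_of_injective ((injective_iff_map_eq_zero _).2 fun v hv => ?_)
    rw [h1] at hv
    have hv1 : v.1 = 0 := congrArg Prod.fst hv
    have hv2 : fderivWithin ℝ K (J ×ˢ U) p v = 0 := congrArg Prod.snd hv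
    have hv3 : v = (0, v.2) := Prod.ext hv1 rfl
    have hv4 : spaceDeriv J U K p v.2 = 0 := by
      rw [hv3] at hv2
      exact hv2
    have hv5 : v.2 = 0 := (injective_iff_map_eq_zero _).1 (hinj p hp) _ hv4
    exact Prod.ext hv1 hv5
  have hmaps : MapsTo G Ω (J ×ˢ U) := by
    rintro _ ⟨p, hp, rfl⟩
    rwa [hGΨ p hp]
  have hderiv : ∀ q ∈ Ω, HasFDerivWithinAt G
      (ContinuousLinearMap.inverse (fderivWithin ℝ Ψ (J ×ˢ U) (G q))) Ω q := by
    intro q hq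
    obtain ⟨B, hB⟩ := hequiv (G q) (hmaps hq)
    rw [← hB, ContinuousLinearMap.inverse_equiv]
    refine HasFDerivWithinAt.of_local_left_inverse (f := Ψ) (t := J ×ˢ U) ?_ ?_ hq ?_
    · exact (hcont q hq).tendsto_nhdsWithin hmaps
    · rw [hB]
      exact (hΨs.differentiableOn (by simp) _ (hmaps hq)).hasFDerivWithinAt
    · filter_upwards [self_mem_nhdsWithin] with q' hq'
      obtain ⟨p, hp, rfl⟩ := hq'
      rw [hGΨ p hp]
  have hsm : ∀ n : ℕ, ContDiffOn ℝ n G Ω := by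
    intro n
    induction n with
    | zero => exact contDiffOn_zero.2 hcont
    | succ n ih =>
      push_cast
      rw [contDiffOn_succ_iff_hasFDerivWithinAt_of_uniqueDiffOn huniq]
      refine ⟨fun h => absurd h (by simp), _, ?_, hderiv⟩
      have h1 : ContDiffOn ℝ n (fderivWithin ℝ Ψ (J ×ˢ U)) (J ×ˢ U) :=
        (hΨs.fderivWithin (m := ∞) hS (by simp)).of_le (by exact_mod_cast le_top)
      have h2 := h1.comp ih hmaps
      intro q hq
      obtain ⟨B, hB⟩ := hequiv (G q) (hmaps hq)
      have h3 := contDiffAt_map_inverse (n := n) B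
      rw [hB] at h3
      exact h3.comp_contDiffWithinAt q (h2 q hq)
  have hq₀ : Ψ p₀ ∈ Ω := ⟨p₀, hp₀, rfl⟩
  have h1 : ContDiffOn ℝ ∞ G Ω := contDiffOn_infty.2 hsm
  exact ((contDiff_snd.comp_contDiffOn h1) (Ψ p₀) hq₀).mono_of_mem_nhdsWithin (hΩn _ hq₀)

end LocalInverse

section Inverse

variable {E : Type*} [NormedAddCommGroup E] [NormedSpace ℝ E] [FiniteDimensional ℝ E]
  {H : Type*} [TopologicalSpace H] {I : ModelWithCorners ℝ E H} [I.Boundaryless]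
  {M : Type*} [TopologicalSpace M] [ChartedSpace H M] [IsManifold I ∞ M]
  {J : Set ℝ}

theorem inter_ball_of_ordConnected (hJ : J.OrdConnected) (hJ' : J.Nontrivial) {t₀ δ : ℝ}
    (ht₀ : t₀ ∈ J) (hδ : 0 < δ) :
    (J ∩ Metric.ball t₀ δ).OrdConnected ∧ (J ∩ Metric.ball t₀ δ).Nontrivial := by
  refine ⟨?_, ?_⟩
  · rw [Real.ball_eq_Ioo]
    exact hJ.inter ordConnected_Ioo
  · obtain ⟨s, hs, hst⟩ := hJ'.exists_ne t₀
    have hst' : 0 < |s - t₀| := abs_pos.2 (sub_ne_zero.2 hst)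
    set r : ℝ := min 1 (δ / (2 * |s - t₀|)) with hr
    have hr0 : 0 < r := by positivity
    have hr1 : r ≤ 1 := min_le_left _ _
    have hr2 : r * |s - t₀| ≤ δ / 2 := by
      calc r * |s - t₀| ≤ δ / (2 * |s - t₀|) * |s - t₀| := by
            gcongr
            exact min_le_right _ _
        _ = δ / 2 := by field_simp
    refine ⟨t₀, ⟨ht₀, Metric.mem_ball_self hδ⟩, t₀ + r * (s - t₀), ⟨?_, ?_⟩, ?_⟩
    · have := hJ.convex.add_smul_sub_mem ht₀ hs ⟨hr0.le, hr1⟩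
      simpa using this
    · rw [Metric.mem_ball, Real.dist_eq, add_sub_cancel_left, abs_mul, abs_of_pos hr0]
      linarith
    · intro h
      have : r * (s - t₀) = 0 := by linarith
      exact (mul_ne_zero hr0.ne' (sub_ne_zero.2 hst)) this

/-- The inverses of a smooth family of diffeomorphisms form a smooth family. -/
theorem contMDiffOn_symm (hJ : J.OrdConnected) (hJ' : J.Nontrivial) {h : ℝ → M ≃ₘ^∞⟮I, I⟯ M}
    (hs : ContMDiffOn (𝓘(ℝ, ℝ).prod I) I ∞ (fun p : ℝ × M => h p.1 p.2) (J ×ˢ univ)) :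
    ContMDiffOn (𝓘(ℝ, ℝ).prod I) I ∞ (fun p : ℝ × M => (h p.1).symm p.2) (J ×ˢ univ) := by
  rintro ⟨t₀, w₀⟩ ⟨(ht₀ : t₀ ∈ J), -⟩
  set z₀ : M := (h t₀).symm w₀ with hz₀
  have hw₀ : h t₀ z₀ = w₀ := (h t₀).apply_symm_apply w₀
  set φ := extChartAt I z₀ with hφ
  set ψ := extChartAt I w₀ with hψ
  set ζ₀ : E := φ z₀ with hζ₀
  have hφz : φ.symm ζ₀ = z₀ := extChartAt_to_inv z₀
  have hζm : ζ₀ ∈ φ.target := mem_extChartAt_target z₀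
  have hQ : ContMDiffOn 𝓘(ℝ, ℝ × E) I ∞ (fun q : ℝ × E => h q.1 (φ.symm q.2))
      (J ×ˢ φ.target) := by
    refine ContMDiffOn.comp (t := J ×ˢ univ) (f := fun q : ℝ × E => (q.1, φ.symm q.2)) hs ?_
      fun q hq => ⟨hq.1, trivial⟩
    exact contDiff_fst.contMDiff.contMDiffOn.prodMk ((contMDiffOn_extChartAt_symm z₀).comp
      contDiff_snd.contMDiff.contMDiffOn fun q hq => hq.2)
  have hψn : ψ.source ∈ 𝓝 (h t₀ (φ.symm ζ₀)) := by
    rw [hφz, hw₀]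
    exact extChartAt_source_mem_nhds w₀
  have hev := (hQ.continuousOn (t₀, ζ₀) ⟨ht₀, hζm⟩).eventually hψn
  obtain ⟨δ, hδ, hδQ⟩ := Metric.mem_nhdsWithin_iff.1 hev
  set J₁ : Set ℝ := J ∩ Metric.ball t₀ δ with hJ₁
  obtain ⟨hJo, hJn⟩ := inter_ball_of_ordConnected hJ hJ' ht₀ hδ
  set U : Set E := φ.target ∩ Metric.ball ζ₀ δ with hU
  have hUo : IsOpen U := (isOpen_extChartAt_target z₀).inter Metric.isOpen_ball
  have hsrc : ∀ q ∈ J₁ ×ˢ U, h q.1 (φ.symm q.2) ∈ ψ.source := fun q hq =>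
    hδQ ⟨by
      rw [Metric.mem_ball, Prod.dist_eq]
      exact max_lt hq.1.2 hq.2.2, hq.1.1, hq.2.1⟩
  set K : ℝ × E → E := fun q => ψ (h q.1 (φ.symm q.2)) with hK
  have hKs : ContDiffOn ℝ ∞ K (J₁ ×ˢ U) := by
    rw [← contMDiffOn_iff_contDiffOn]
    refine (contMDiffOn_extChartAt (x := w₀)).comp (hQ.mono fun q hq => ⟨hq.1.1, hq.2.1⟩) ?_
    intro q hq
    rw [← extChartAt_source I]
    exact hsrc q hq
  set g : ℝ × E → E := fun q => φ ((h q.1).symm (ψ.symm q.2)) with hg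
  have hgi : ∀ q ∈ J₁ ×ˢ U, (h q.1).symm (ψ.symm (K q)) = φ.symm q.2 := by
    intro q hq
    rw [hK]
    simp only
    rw [ψ.left_inv (hsrc q hq), (h q.1).symm_apply_apply]
  have hgK : ∀ q ∈ J₁ ×ˢ U, g (q.1, K q) = q.2 := fun q hq => by
    simp only [hg]
    rw [hgi q hq, φ.right_inv hq.2.1]
  have hinj : ∀ q ∈ J₁ ×ˢ U, Function.Injective (spaceDeriv J₁ U K q) := by
    intro q hq
    have h1 := hasFDerivAt_spaceDeriv hUo (hKs.differentiableOn (by simp) q hq) hq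
    have h2 : DifferentiableAt ℝ (fun y => g (q.1, y)) (K q) := by
      have h3 : ContMDiffAt 𝓘(ℝ, E) 𝓘(ℝ, E) ∞ (fun y => g (q.1, y)) (K q) := by
        have e1 : ContMDiffAt 𝓘(ℝ, E) I ∞ ψ.symm (K q) :=
          (contMDiffOn_extChartAt_symm w₀).contMDiffAt
            ((isOpen_extChartAt_target w₀).mem_nhds (ψ.map_source (hsrc q hq)))
        have e2 : ContMDiffAt 𝓘(ℝ, E) I ∞ (fun y => (h q.1).symm (ψ.symm y)) (K q) :=
          (h q.1).symm.contMDiff.contMDiffAt.comp (K q) e1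
        refine ContMDiffAt.comp (K q) (contMDiffAt_extChartAt' (x := z₀) ?_) e2
        rw [hgi q hq, ← extChartAt_source I]
        exact φ.map_target hq.2.1
      exact h3.contDiffAt.differentiableAt (by simp)
    have h4 : HasFDerivAt (fun z => g (q.1, K (q.1, z)))
        ((fderiv ℝ (fun y => g (q.1, y)) (K q)).comp (spaceDeriv J₁ U K q)) q.2 :=
      HasFDerivAt.comp (g := fun y => g (q.1, y)) q.2 h2.hasFDerivAt h1
    have h5 : HasFDerivAt (fun z => g (q.1, K (q.1, z))) (ContinuousLinearMap.id ℝ E) q.2 := by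
      refine (hasFDerivAt_id q.2).congr_of_eventuallyEq ?_
      filter_upwards [hUo.mem_nhds hq.2] with z hz
      exact hgK (q.1, z) ⟨hq.1, hz⟩
    exact Function.LeftInverse.injective (g := fderiv ℝ (fun y => g (q.1, y)) (K q)) fun v =>
      congrArg (fun L : E →L[ℝ] E => L v) (h4.unique h5)
  have hp₀ : (t₀, ζ₀) ∈ J₁ ×ˢ U :=
    ⟨⟨ht₀, Metric.mem_ball_self hδ⟩, hζm, Metric.mem_ball_self hδ⟩
  have hK₀ : K (t₀, ζ₀) = ψ w₀ := by
    simp only [hK]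
    rw [hφz, hw₀]
  have hgs := contDiffOn_of_leftInverse hJo hJn hUo hKs hinj hgK hp₀
  have hex := eventually_exists_eq hJo hJn hUo hKs hp₀ (hinj _ hp₀) one_pos
  rw [hK₀] at hgs hex
  have hJJ : J₁ ×ˢ univ ∈ 𝓝[J ×ˢ (univ : Set M)] (t₀, w₀) := by
    have : Metric.ball t₀ δ ×ˢ (univ : Set M) ∈ 𝓝 (t₀, w₀) :=
      prod_mem_nhds (Metric.ball_mem_nhds _ hδ) univ_mem
    filter_upwards [self_mem_nhdsWithin, mem_nhdsWithin_of_mem_nhds this] with p h1 h2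
    exact ⟨⟨h1.1, h2.1⟩, trivial⟩
  refine ContMDiffWithinAt.mono_of_mem_nhdsWithin ?_ hJJ
  have hg₀ : g (t₀, ψ w₀) = ζ₀ := by
    rw [← hK₀]
    exact hgK _ hp₀
  have h6 : ContMDiffWithinAt (𝓘(ℝ, ℝ).prod I) 𝓘(ℝ, E) ∞
      (fun p : ℝ × M => g (p.1, ψ p.2)) (J₁ ×ˢ univ) (t₀, w₀) :=
    contMDiffWithinAt_of_chart (hgs.mono (prod_mono_right (subset_univ _)))
  have h7 : ContMDiffAt 𝓘(ℝ, E) I ∞ φ.symm (g (t₀, ψ w₀)) := by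
    rw [hg₀]
    exact (contMDiffOn_extChartAt_symm z₀).contMDiffAt
      ((isOpen_extChartAt_target z₀).mem_nhds hζm)
  refine (h7.comp_contMDiffWithinAt (t₀, w₀) h6).congr_of_eventuallyEq ?_ ?_
  · have hcont : Tendsto (fun p : ℝ × M => (p.1, ψ p.2)) (𝓝[J₁ ×ˢ univ] (t₀, w₀))
        (𝓝[J₁ ×ˢ univ] (t₀, ψ w₀)) := by
      refine tendsto_nhdsWithin_of_tendsto_nhds_of_eventually_within _ ?_ ?_
      · refine Tendsto.mono_left ?_ nhdsWithin_le_nhds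
        exact continuousAt_fst.prodMk (ContinuousAt.comp (x := (t₀, w₀)) (g := ψ)
          (f := fun p : ℝ × M => p.2) (continuousAt_extChartAt w₀) continuousAt_snd)
      · filter_upwards [self_mem_nhdsWithin] with p hp
        exact ⟨hp.1, trivial⟩
    have hsr : ∀ᶠ p in 𝓝[J₁ ×ˢ univ] (t₀, w₀), p.1 ∈ J₁ ∧ p.2 ∈ ψ.source := by
      filter_upwards [prod_source_mem_nhdsWithin (J := J₁) (I := I) t₀ w₀] with p hp
      exact hp
    filter_upwards [hcont.eventually hex, hsr] with p ⟨z, hzU, _, hz⟩ hp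
    have h8 := hgi (p.1, z) ⟨hp.1, hzU⟩
    have h9 : (h p.1).symm p.2 = φ.symm z := by
      rw [← ψ.left_inv hp.2, ← h8, hz]
    have h10 : g (p.1, ψ p.2) = z := by
      have := hgK (p.1, z) ⟨hp.1, hzU⟩
      rwa [hz] at this
    simp only [Function.comp]
    rw [h9, h10]
  · change z₀ = φ.symm (g (t₀, ψ w₀))
    rw [hg₀, hφz]

end Inverse

section Velocity

variable {E : Type*} [NormedAddCommGroup E] [NormedSpace ℝ E] [FiniteDimensional ℝ E]
  {H : Type*} [TopologicalSpace H] {I : ModelWithCorners ℝ E H} [I.Boundaryless]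
  {M : Type*} [TopologicalSpace M] [ChartedSpace H M] [IsManifold I ∞ M]
  {J : Set ℝ}

theorem exists_chartFun [T2Space M] [SecondCountableTopology M] (x₀ : M) :
    ∃ f : M → E, ContMDiff I 𝓘(ℝ, E) ∞ f ∧ ∀ᶠ x in 𝓝 x₀, f x = extChartAt I x₀ x := by
  obtain ⟨χ, h1, hsupp⟩ := exists_bump (I := I) (isClosed_singleton (x := x₀))
    (chartAt H x₀).open_source (singleton_subset_iff.2 (mem_chart_source H x₀))
  rw [nhdsSet_singleton] at h1
  refine ⟨fun x => χ x • extChartAt I x₀ x, contMDiff_of_tsupport fun x hx => ?_, ?_⟩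
  · have hx' : x ∈ (chartAt H x₀).source :=
      hsupp (closure_mono (Function.support_smul_subset_left _ _) hx)
    exact χ.contMDiff.contMDiffAt.smul (contMDiffAt_extChartAt' hx')
  · filter_upwards [h1] with x hx
    rw [hx, one_smul]

theorem mvfderiv_of_eq_extChartAt {f : M → E} (hf : ContMDiff I 𝓘(ℝ, E) ∞ f) {x₀ x : M}
    (hx : x ∈ (extChartAt I x₀).source) (h : ∀ᶠ y in 𝓝 x, f y = extChartAt I x₀ y)
    (v : TangentSpace I x) :
    mvfderiv I f x v = (trivializationAt E (TangentSpace I) x₀ ⟨x, v⟩).2 := by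
  rw [mvfderiv_eq_chart hf hx]
  have h1 : HasFDerivAt (f ∘ (extChartAt I x₀).symm) (ContinuousLinearMap.id ℝ E)
      (extChartAt I x₀ x) := by
    refine (hasFDerivAt_id _).congr_of_eventuallyEq ?_
    have hc : Tendsto (extChartAt I x₀).symm (𝓝 (extChartAt I x₀ x)) (𝓝 x) := by
      have := (continuousAt_extChartAt_symm'' ((extChartAt I x₀).map_source hx)).tendsto
      rwa [(extChartAt I x₀).left_inv hx] at this
    filter_upwards [hc.eventually h, (isOpen_extChartAt_target x₀).mem_nhds
      ((extChartAt I x₀).map_source hx)] with z hz hz'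
    rw [Function.comp_apply, hz, (extChartAt I x₀).right_inv hz']
    rfl
  rw [h1.fderiv]
  rfl

theorem contMDiff_of_mvfderiv [T2Space M] [SecondCountableTopology M]
    {X : ∀ x : M, TangentSpace I x} (h : ∀ f : M → E, ContMDiff I 𝓘(ℝ, E) ∞ f →
      ContMDiff I 𝓘(ℝ, E) ∞ (fun x => (mvfderiv I f x (X x) : E))) :
    ContMDiff I (I.prod 𝓘(ℝ, E)) ∞ (fun x => (⟨x, X x⟩ : TangentBundle I M)) := by
  intro x₀
  obtain ⟨f, hf, hfx⟩ := exists_chartFun (I := I) x₀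
  refine contMDiffAt_totalSpace.2 ⟨contMDiffAt_id, ?_⟩
  refine (h f hf x₀).congr_of_eventuallyEq ?_
  filter_upwards [hfx.eventually_nhds, extChartAt_source_mem_nhds (I := I) x₀] with x hx hx'
  exact (mvfderiv_of_eq_extChartAt hf hx' hx _).symm

theorem trivializationAt_tangentSpace_self (x : M) (v : TangentSpace I x) :
    (trivializationAt E (TangentSpace I) x ⟨x, v⟩).2 = v := by
  rw [TangentBundle.trivializationAt_apply]
  exact (tangentBundleCore I M).coordChange_self (achart H x) x (mem_chart_source H x) v

/-- The velocity at time `t` of a family of maps that is the identity at time `t`. -/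
def velocity (I : ModelWithCorners ℝ E H) (J : Set ℝ) (t : ℝ) (ψ : ℝ × M → M) (x : M) :
    TangentSpace I x :=
  derivWithin (fun s => extChartAt I x (ψ (s, x))) J t

theorem hasDerivWithinAt_velocity [T2Space M] [SecondCountableTopology M] (hJ : J.OrdConnected)
    (hJ' : J.Nontrivial) {ψ : ℝ × M → M}
    (hψ : ContMDiffOn (𝓘(ℝ, ℝ).prod I) I ∞ ψ (J ×ˢ univ)) {t : ℝ} (ht : t ∈ J)
    (hid : ∀ x, ψ (t, x) = x) {G : Type*} [NormedAddCommGroup G] [NormedSpace ℝ G] {f : M → G}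
    (hf : ContMDiff I 𝓘(ℝ, G) ∞ f) (x : M) :
    HasDerivWithinAt (fun s => f (ψ (s, x))) (mvfderiv I f x (velocity I J t ψ x) : G) J t := by
  obtain ⟨u, hu, hux⟩ := exists_chartFun (I := I) x
  have hus : SmoothFun I J (fun p => u (ψ p)) := hu.comp_contMDiffOn hψ
  have h1 := hus.hasDerivWithinAt hJ hJ' ht x
  have hcont : ContinuousWithinAt (fun s => ψ (s, x)) J t := by
    refine ContinuousWithinAt.comp (t := J ×ˢ univ) (g := ψ) (f := fun s : ℝ => (s, x))
      (hψ.continuousOn (t, x) ⟨ht, trivial⟩) ?_ fun s hs => ⟨hs, trivial⟩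
    exact continuousWithinAt_id.prodMk continuousWithinAt_const
  rw [ContinuousWithinAt, hid x] at hcont
  have h2 : HasDerivWithinAt (fun s => extChartAt I x (ψ (s, x)))
      (tderiv J (fun p => u (ψ p)) (t, x)) J t := by
    refine h1.congr_of_eventuallyEq ?_ ?_
    · filter_upwards [hcont.eventually hux] with s hs using hs.symm
    · rw [hid x]
      exact hux.self_of_nhds.symm
  have h3 : velocity I J t ψ x = tderiv J (fun p => u (ψ p)) (t, x) :=
    h2.derivWithin (uniqueDiffOn_of_ordConnected hJ hJ' t ht)
  have hfd : DifferentiableAt ℝ (f ∘ (extChartAt I x).symm) (extChartAt I x x) := by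
    have := ((hf.contMDiffOn (s := univ)).comp (contMDiffOn_extChartAt_symm (n := ∞) x)
      fun _ _ => trivial) _ (mem_extChartAt_target x)
    exact (this.contMDiffAt ((isOpen_extChartAt_target' x).mem_nhds
      (mem_extChartAt_target x))).contDiffAt.differentiableAt (by simp)
  have h4 : HasFDerivAt (f ∘ (extChartAt I x).symm)
      (fderiv ℝ (f ∘ (extChartAt I x).symm) (extChartAt I x x))
      (extChartAt I x (ψ (t, x))) := by
    rw [hid x]
    exact hfd.hasFDerivAt
  have h5 := h4.comp_hasDerivWithinAt t h2
  rw [mvfderiv_eq_chart hf (mem_extChartAt_source x), trivializationAt_tangentSpace_self, h3]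
  refine h5.congr_of_eventuallyEq ?_ ?_
  · filter_upwards [hcont.eventually (extChartAt_source_mem_nhds (I := I) x)] with s hs
    simp only [Function.comp_apply, (extChartAt I x).left_inv hs]
  · simp only [Function.comp_apply, hid x, extChartAt_to_inv]
theorem exists_velocity [T2Space M] [SecondCountableTopology M] (hJ : J.OrdConnected)
    (hJ' : J.Nontrivial) {ψ : ℝ × M → M}
    (hψ : ContMDiffOn (𝓘(ℝ, ℝ).prod I) I ∞ ψ (J ×ˢ univ)) {t : ℝ} (ht : t ∈ J)
    (hid : ∀ x, ψ (t, x) = x) : ∃ X : VF I M, ∀ (f : Fun I M) (x : M),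
      HasDerivWithinAt (fun s => f (ψ (s, x))) (mvfderiv I f x (X x)) J t := by
  refine ⟨⟨velocity I J t ψ, contMDiff_of_mvfderiv fun f hf => ?_⟩,
    fun f x => hasDerivWithinAt_velocity hJ hJ' hψ ht hid f.contMDiff x⟩
  have hfs : SmoothFun I J (fun p => f (ψ p)) := hf.comp_contMDiffOn hψ
  refine ((hfs.tderiv hJ hJ').contMDiff ht).congr fun x => ?_
  exact (uniqueDiffOn_of_ordConnected hJ hJ' t ht).eq_deriv _
    (hasDerivWithinAt_velocity hJ hJ' hψ ht hid hf x) (hfs.hasDerivWithinAt hJ hJ' ht x)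

end Velocity

section BundleAutomorphisms

variable {E : Type*} [NormedAddCommGroup E] [NormedSpace ℝ E] [FiniteDimensional ℝ E]
  {H : Type*} [TopologicalSpace H] {I : ModelWithCorners ℝ E H} [I.Boundaryless]
  {M : Type*} [TopologicalSpace M] [ChartedSpace H M] [IsManifold I ∞ M]
  {J : Set ℝ}

variable {F : Type*} [NormedAddCommGroup F] [NormedSpace ℝ F] [FiniteDimensional ℝ F]
  {V : M → Type*} [TopologicalSpace (TotalSpace F V)]
  [∀ x, AddCommGroup (V x)] [∀ x, Module ℝ (V x)] [∀ x, TopologicalSpace (V x)]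
  [FiberBundle F V] [VectorBundle ℝ F V] [ContMDiffVectorBundle ∞ F V I]

namespace BundleAut

variable (h : BundleAut I F V)

theorem exists_base_eq (y : M) : ∃ x, h.base x = y :=
  ⟨h.base.symm y, h.base.apply_symm_apply y⟩

theorem fiber_bijective (x : M) : Function.Bijective (h.fiber x) := by
  refine ⟨fun v w hvw => ?_, fun w => ?_⟩
  · have h1 : h.total ⟨x, v⟩ = h.total ⟨x, w⟩ := by rw [h.total_mk, h.total_mk, hvw]
    have h2 := h.total.injective h1
    simpa using h2
  · obtain ⟨⟨y, v⟩, hq⟩ := h.total.symm.symm_apply_apply ⟨h.base x, w⟩ |> fun e => (⟨_, e⟩ : ∃ q, h.total q = _)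
    rw [h.total_mk] at hq
    have hy : y = x := h.base.injective (congrArg TotalSpace.proj hq)
    subst hy
    exact ⟨v, by simpa using hq⟩

/-- The action of a bundle automorphism on a fiber as a linear equivalence. -/
def fiberEquiv (x : M) : V x ≃ₗ[ℝ] V (h.base x) :=
  LinearEquiv.ofBijective (h.fiber x) (h.fiber_bijective x)

theorem fiberEquiv_symm_fiber (x : M) (v : V x) : (h.fiberEquiv x).symm (h.fiber x v) = v :=
  (h.fiberEquiv x).symm_apply_apply v

theorem fiber_fiberEquiv_symm (x : M) (v : V (h.base x)) :
    h.fiber x ((h.fiberEquiv x).symm v) = v :=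
  (h.fiberEquiv x).apply_symm_apply v

theorem total_symm_mk (x : M) (v : V (h.base x)) :
    h.total.symm ⟨h.base x, v⟩ = ⟨x, (h.fiberEquiv x).symm v⟩ := by
  have h1 := h.total.symm_apply_apply ⟨x, (h.fiberEquiv x).symm v⟩
  rwa [h.total_mk, fiber_fiberEquiv_symm] at h1

theorem exists_push (α : Sec I F V) : ∃ α' : Sec I F V, h.IsPushforward α α' := by
  have h1 : ∀ y : M, ∃ w : V y,
      (⟨y, w⟩ : TotalSpace F V) = h.total ⟨h.base.symm y, α (h.base.symm y)⟩ := by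
    intro y
    obtain ⟨x, rfl⟩ := h.exists_base_eq y
    exact ⟨h.fiber x (α x), by rw [h.base.symm_apply_apply, h.total_mk]⟩
  choose w hw using h1
  refine ⟨⟨w, ?_⟩, fun x => ?_⟩
  · have h2 : (fun y => (⟨y, w y⟩ : TotalSpace F V)) =
        fun y => h.total ⟨h.base.symm y, α (h.base.symm y)⟩ := funext hw
    rw [h2]
    exact h.total.contMDiff.comp (α.contMDiff.comp h.base.symm.contMDiff)
  · have h3 := hw (h.base x)
    rw [h.base.symm_apply_apply, h.total_mk] at h3
    simpa using h3

/-- The push-forward of a section by a bundle automorphism. -/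
def push (α : Sec I F V) : Sec I F V := Classical.choose (h.exists_push α)

theorem isPushforward_push (α : Sec I F V) : h.IsPushforward α (h.push α) :=
  Classical.choose_spec (h.exists_push α)

theorem push_apply (α : Sec I F V) (x : M) : h.push α (h.base x) = h.fiber x (α x) :=
  h.isPushforward_push α x

theorem IsPushforward.eq_push {h : BundleAut I F V} {α α' : Sec I F V}
    (hα : h.IsPushforward α α') : α' = h.push α := by
  ext y
  obtain ⟨x, rfl⟩ := h.exists_base_eq y
  rw [hα x, h.push_apply]

theorem mk_push (α : Sec I F V) (y : M) : (⟨y, h.push α y⟩ : TotalSpace F V) =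
    h.total ⟨h.base.symm y, α (h.base.symm y)⟩ := by
  obtain ⟨x, rfl⟩ := h.exists_base_eq y
  rw [h.base.symm_apply_apply, h.total_mk, h.push_apply]

/-- The pull-back of a section by a bundle automorphism. -/
def pull (β : Sec I F V) : Sec I F V :=
  ⟨fun x => (h.fiberEquiv x).symm (β (h.base x)), by
    have h1 : (fun x => (⟨x, (h.fiberEquiv x).symm (β (h.base x))⟩ : TotalSpace F V)) =
        fun x => h.total.symm ⟨h.base x, β (h.base x)⟩ :=
      funext fun x => (h.total_symm_mk x _).symm
    rw [h1]
    exact h.total.symm.contMDiff.comp (β.contMDiff.comp h.base.contMDiff)⟩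

theorem pull_apply (β : Sec I F V) (x : M) :
    h.pull β x = (h.fiberEquiv x).symm (β (h.base x)) := rfl

theorem isPushforward_pull (β : Sec I F V) : h.IsPushforward (h.pull β) β := fun x => by
  rw [pull_apply, fiber_fiberEquiv_symm]

theorem pull_push (α : Sec I F V) : h.pull (h.push α) = α := by
  ext x
  rw [pull_apply, push_apply, fiberEquiv_symm_fiber]

end BundleAut

section SmoothFamilies

variable {h : ℝ → BundleAut I F V}

variable (hs : ContMDiffOn (𝓘(ℝ, ℝ).prod (I.prod 𝓘(ℝ, F))) (I.prod 𝓘(ℝ, F)) ∞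
      (fun p : ℝ × TotalSpace F V => (h p.1).total p.2) (J ×ˢ univ))

include hs

theorem contMDiffOn_base :
    ContMDiffOn (𝓘(ℝ, ℝ).prod I) I ∞ (fun p : ℝ × M => (h p.1).base p.2) (J ×ˢ univ) := by
  have h1 : ContMDiffOn (𝓘(ℝ, ℝ).prod I) (I.prod 𝓘(ℝ, F)) ∞
      (fun p : ℝ × M => (h p.1).total ⟨p.2, 0⟩) (J ×ˢ univ) := by
    refine ContMDiffOn.comp (t := J ×ˢ univ)
      (f := fun p : ℝ × M => (p.1, (⟨p.2, 0⟩ : TotalSpace F V))) hs ?_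
      fun p hp => ⟨hp.1, trivial⟩
    exact contMDiffOn_fst.prodMk ((contMDiff_zeroSection ℝ V).comp_contMDiffOn contMDiffOn_snd)
  exact ((contMDiff_proj V).comp_contMDiffOn h1).congr fun p _ => by
    simp [(h p.1).total_mk]

theorem smoothFam_pull (hJ : J.OrdConnected) (hJ' : J.Nontrivial) {β : ℝ → Sec I F V}
    (hβ : SmoothFam I F J fun t x => β t x) : SmoothFam I F J fun t x => (h t).pull (β t) x := by
  have h1 := contMDiffOn_symm hJ hJ' (h := fun t => (h t).total) hs
  have h2 : ContMDiffOn (𝓘(ℝ, ℝ).prod I) (I.prod 𝓘(ℝ, F)) ∞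
      (fun p : ℝ × M => (⟨(h p.1).base p.2, β p.1 ((h p.1).base p.2)⟩ : TotalSpace F V))
      (J ×ˢ univ) :=
    ContMDiffOn.comp (t := J ×ˢ univ) (f := fun p : ℝ × M => (p.1, (h p.1).base p.2)) hβ
      (contMDiffOn_fst.prodMk (contMDiffOn_base hs)) fun p hp => ⟨hp.1, trivial⟩
  refine (ContMDiffOn.comp (t := J ×ˢ univ) h1 (contMDiffOn_fst.prodMk h2)
    fun p hp => ⟨hp.1, trivial⟩).congr fun p _ => ?_
  exact ((h p.1).total_symm_mk p.2 _).symm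

theorem contMDiffOn_push_apply (hJ : J.OrdConnected) (hJ' : J.Nontrivial) {β : ℝ → Sec I F V}
    (hβ : SmoothFam I F J fun t x => β t x)
    {E' : Type*} [NormedAddCommGroup E'] [NormedSpace ℝ E'] {H' : Type*} [TopologicalSpace H']
    {I' : ModelWithCorners ℝ E' H'} {N : Type*} [TopologicalSpace N] [ChartedSpace H' N]
    {S : Set N} {a b : N → ℝ} {y : N → M} (ha : ContMDiffOn I' 𝓘(ℝ, ℝ) ∞ a S)
    (hb : ContMDiffOn I' 𝓘(ℝ, ℝ) ∞ b S) (hy : ContMDiffOn I' I ∞ y S)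
    (haJ : ∀ q ∈ S, a q ∈ J) (hbJ : ∀ q ∈ S, b q ∈ J) :
    ContMDiffOn I' (I.prod 𝓘(ℝ, F)) ∞
      (fun q => (⟨y q, (h (a q)).push (β (b q)) (y q)⟩ : TotalSpace F V)) S := by
  have h0 := contMDiffOn_symm hJ hJ' (h := fun t => (h t).base) (contMDiffOn_base hs)
  have h1 : ContMDiffOn I' I ∞ (fun q => (h (a q)).base.symm (y q)) S :=
    ContMDiffOn.comp (t := J ×ˢ univ) (f := fun q => (a q, y q)) h0 (ha.prodMk hy)
      fun q hq => ⟨haJ q hq, trivial⟩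
  have h2 : ContMDiffOn I' (I.prod 𝓘(ℝ, F)) ∞ (fun q => (⟨(h (a q)).base.symm (y q),
      β (b q) ((h (a q)).base.symm (y q))⟩ : TotalSpace F V)) S :=
    ContMDiffOn.comp (t := J ×ˢ univ) (f := fun q => (b q, (h (a q)).base.symm (y q))) hβ
      (hb.prodMk h1) fun q hq => ⟨hbJ q hq, trivial⟩
  refine (ContMDiffOn.comp (t := J ×ˢ univ) hs (ha.prodMk h2)
    fun q hq => ⟨haJ q hq, trivial⟩).congr fun q _ => ?_
  exact (h (a q)).mk_push _ _

theorem smoothFam_push (hJ : J.OrdConnected) (hJ' : J.Nontrivial) {β : ℝ → Sec I F V}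
    (hβ : SmoothFam I F J fun t x => β t x) : SmoothFam I F J fun t x => (h t).push (β t) x :=
  contMDiffOn_push_apply hs hJ hJ' hβ contMDiffOn_fst contMDiffOn_fst contMDiffOn_snd
    (fun _ hq => hq.1) fun _ hq => hq.1

theorem wderiv_push (hJ : J.OrdConnected) (hJ' : J.Nontrivial) {m m' : ℝ → Sec I F V}
    (hm : SmoothFam I F J fun t x => m t x)
    (hm' : ∀ t ∈ J, ∀ x, WDeriv J t (fun s => m s x) (m' t x)) {t : ℝ} (ht : t ∈ J) {y : M}
    {b : V y} (hb : WDeriv J t (fun s => (h s).push (m t) y) b) :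
    WDeriv J t (fun s => (h s).push (m s) y) ((h t).push (m' t) y + b) := by
  intro φ
  set e := trivializationAt F V y with he
  have hye : y ∈ e.baseSet := mem_baseSet_trivializationAt F V y
  set L := e.continuousLinearEquivAt ℝ y hye
  set Q : ℝ × ℝ → ℝ := fun q => φ ((h q.1).push (m q.2) y) with hQ
  have hQs : ContMDiffOn 𝓘(ℝ, ℝ × ℝ) 𝓘(ℝ, ℝ) ∞ Q (J ×ˢ J) := by
    have h1 : ContMDiffOn 𝓘(ℝ, ℝ × ℝ) (I.prod 𝓘(ℝ, F)) ∞
        (fun q : ℝ × ℝ => (⟨y, (h q.1).push (m q.2) y⟩ : TotalSpace F V)) (J ×ˢ J) :=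
      contMDiffOn_push_apply hs hJ hJ' hm contDiff_fst.contMDiff.contMDiffOn
        contDiff_snd.contMDiff.contMDiffOn contMDiffOn_const (fun q hq => hq.1) fun q hq => hq.2
    intro q hq
    have h2 := (contMDiffWithinAt_totalSpace.1 (h1 q hq)).2
    have h3 := (LinearMap.toContinuousLinearMap
      (φ ∘ₗ (L.symm : F →L[ℝ] V y).toLinearMap)).contDiff.contMDiff.contMDiffAt
      |>.comp_contMDiffWithinAt q h2 (n := ∞)
    refine h3.congr (fun q' _ => ?_) ?_ <;>
    · simp only [hQ, Function.comp]
      change _ = φ (L.symm (L _))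
      rw [L.symm_apply_apply]
  have hQd : HasFDerivWithinAt Q (fderivWithin ℝ Q (J ×ˢ J) (t, t)) (J ×ˢ J) (t, t) :=
    ((hQs.contDiffOn (t, t) ⟨ht, ht⟩).differentiableWithinAt (by simp)).hasFDerivWithinAt
  set D := fderivWithin ℝ Q (J ×ˢ J) (t, t)
  have hu := uniqueDiffOn_of_ordConnected hJ hJ' t ht
  have hdiag : HasDerivWithinAt (fun s => Q (s, s)) (D (1, 1)) J t :=
    HasFDerivWithinAt.comp_hasDerivWithinAt (f := fun s : ℝ => (s, s)) (t := J ×ˢ J) t hQd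
      ((hasDerivWithinAt_id t J).prodMk (hasDerivWithinAt_id t J)) fun s hs => ⟨hs, hs⟩
  have h1 : HasDerivWithinAt (fun s => Q (s, t)) (D (1, 0)) J t :=
    HasFDerivWithinAt.comp_hasDerivWithinAt (f := fun s : ℝ => (s, t)) (t := J ×ˢ J) t hQd
      ((hasDerivWithinAt_id t J).prodMk (hasDerivWithinAt_const t J t)) fun s hs => ⟨hs, ht⟩
  have h2 : HasDerivWithinAt (fun s => Q (t, s)) (D (0, 1)) J t :=
    HasFDerivWithinAt.comp_hasDerivWithinAt (f := fun s : ℝ => (t, s)) (t := J ×ˢ J) t hQd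
      ((hasDerivWithinAt_const t J t).prodMk (hasDerivWithinAt_id t J)) fun s hs => ⟨ht, hs⟩
  have e1 : D (1, 0) = φ b := hu.eq_deriv _ h1 (hb φ)
  have e2 : D (0, 1) = φ ((h t).push (m' t) y) := by
    refine hu.eq_deriv _ h2 ?_
    obtain ⟨x, rfl⟩ := (h t).exists_base_eq y
    simp only [hQ, (h t).push_apply]
    exact (hm' t ht x).map ((h t).fiber x) φ
  have e3 : D (1, 1) = φ ((h t).push (m' t) y + b) := by
    rw [map_add, ← e1, ← e2, ← map_add]
    simp
  rw [← e3]
  exact hdiag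

end SmoothFamilies

section TrivialFamily

variable [T2Space M] [SecondCountableTopology M] {A : ℝ → LieAlgebroid I F V}
  {c : ℝ → Sec I F V →ₗ[ℝ] Sec I F V →ₗ[ℝ] Sec I F V}
  {σ : ℝ → Sec I F V →ₗ[Fun I M] VF I M}

theorem isDefCochain_altOne {D : Sec I F V →ₗ[ℝ] Sec I F V} {X : VF I M}
    (h : ∀ x, IsDerAt x (evalAt x ∘ₗ D) (X x)) : IsDefCochain (altOne D) :=
  ⟨AlternatingMap.constOfIsEmpty (Fun I M) (Sec I F V) (Fin 0) X, fun _ u f x => h x f u⟩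

theorem BracketDeriv.exists_cochain_of_isTrivialFamily (hc : BracketDeriv J A c σ)
    (hA : IsSmoothFamily J A) (hJ : J.OrdConnected) (hJ' : J.Nontrivial)
    (htriv : IsTrivialFamily J A) :
    ∃ D : ℝ → (Sec I F V [⋀^Fin 1]→ₗ[ℝ] Sec I F V), IsSmoothCochainFamily J D ∧
      ∀ t ∈ J, ∀ s : Fin 2 → Sec I F V, altTwo (c t) (hc.self t) s = (A t).delta (D t) s := by
  classical
  obtain ⟨B, h, hs, hiso⟩ := htriv
  have hu := uniqueDiffOn_of_ordConnected hJ hJ'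
  choose b hbs hb using fun α : Sec I F V => SmoothFam.exists_deriv hJ hJ'
    (smoothFam_push hs hJ hJ' (SmoothFam.const α))
  have hpush_add : ∀ s y (α β : Sec I F V),
      (h s).push (α + β) y = (h s).push α y + (h s).push β y := by
    intro s y α β
    obtain ⟨x, rfl⟩ := (h s).exists_base_eq y
    simp [(h s).push_apply]
  have hpush_smul : ∀ s y (r : ℝ) (α : Sec I F V),
      (h s).push (r • α) y = r • (h s).push α y := by
    intro s y r α
    obtain ⟨x, rfl⟩ := (h s).exists_base_eq y
    simp [(h s).push_apply]
  have hpush_fun : ∀ s y (f : Fun I M) (α : Sec I F V),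
      (h s).push (f • α) y = f ((h s).base.symm y) • (h s).push α y := by
    intro s y f α
    obtain ⟨x, rfl⟩ := (h s).exists_base_eq y
    simp [(h s).push_apply, (h s).base.symm_apply_apply]
  set D : ℝ → Sec I F V →ₗ[ℝ] Sec I F V := fun t => if ht : t ∈ J then
    { toFun := fun α => (h t).pull (b α t)
      map_add' := fun α β => by
        ext x
        have h1 := (hb (α + β) t ht ((h t).base x)).unique hu ht
          (((hb α t ht _).add (hb β t ht _)).congr ht fun s _ => hpush_add s _ α β)
        simp [BundleAut.pull_apply, h1]
      map_smul' := fun r α => by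
        ext x
        have h1 := (hb (r • α) t ht ((h t).base x)).unique hu ht
          (((hb α t ht _).const_smul r).congr ht fun s _ => hpush_smul s _ r α)
        simp [BundleAut.pull_apply, h1] } else 0 with hD
  have hDt : ∀ t ∈ J, ∀ α, D t α = (h t).pull (b α t) := fun t ht α => by
    simp only [hD, dif_pos ht]
    rfl
  have hbase := contMDiffOn_base hs
  have hbsymm := contMDiffOn_symm hJ hJ' (h := fun t => (h t).base) hbase
  have hX : ∀ t ∈ J, ∃ X : VF I M, ∀ (f : Fun I M) (x : M),
      HasDerivWithinAt (fun s => f ((h s).base.symm ((h t).base x))) (mvfderiv I f x (X x)) J t := by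
    intro t ht
    refine exists_velocity hJ hJ'
      (ψ := fun p : ℝ × M => (h p.1).base.symm ((h t).base p.2)) ?_ ht
      fun x => (h t).base.symm_apply_apply x
    exact ContMDiffOn.comp (t := J ×ˢ univ) (f := fun p : ℝ × M => (p.1, (h t).base p.2)) hbsymm
      (contMDiffOn_fst.prodMk ((h t).base.contMDiff.comp_contMDiffOn contMDiffOn_snd))
      fun p hp => ⟨hp.1, trivial⟩
  refine ⟨fun t => altOne (D t), ⟨fun t ht => ?_, fun s => ?_⟩, fun t ht s => ?_⟩
  · obtain ⟨X, hX⟩ := hX t ht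
    refine isDefCochain_altOne (X := X) fun x f α => ?_
    have h1 := WDeriv.smul (hX f x) (hb α t ht ((h t).base x))
    have h2 := (hb (f • α) t ht ((h t).base x)).unique hu ht
      (h1.congr ht fun s _ => hpush_fun s _ f α)
    simp only [LinearMap.comp_apply, evalAt_apply, hDt t ht, BundleAut.pull_apply, h2, map_add,
      map_smul, (h t).base.symm_apply_apply, (h t).push_apply, BundleAut.fiberEquiv_symm_fiber]
    rw [add_comm]
  · refine (smoothFam_pull hs hJ hJ' (hbs (s 0))).congr fun p hp => ?_
    simp only [altOne_apply, hDt p.1 hp.1]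
  · rw [LieAlgebroid.delta_one]
    simp only [altTwo_apply, altOne_apply, Matrix.cons_val_zero, hDt t ht]
    set α := s 0
    set β := s 1
    ext x
    have hB : BracketDeriv J (fun _ => B) 0 0 :=
      ⟨fun _ _ => rfl, fun _ _ _ _ _ => WDeriv.const _, fun _ _ _ _ => WDeriv.const _⟩
    have h1 := hB.wderiv_bracket_apply hJ hJ' ht
      (smoothFam_push hs hJ hJ' (SmoothFam.const α)) (fun t ht x => hb α t ht x)
      (smoothFam_push hs hJ hJ' (SmoothFam.const β)) (fun t ht x => hb β t ht x) ((h t).base x)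
    have h2 := wderiv_push hs hJ hJ' (m := fun s => (A s).bracket α β)
      (m' := fun s => c s α β) (hA.bracket α β) (fun t ht x => hc.wderiv_bracket t ht α β x) ht
      (hb ((A t).bracket α β) t ht ((h t).base x))
    have h3 : ∀ s ∈ J, (h s).push ((A s).bracket α β) = B.bracket ((h s).push α) ((h s).push β) :=
      fun s hs => (BundleAut.IsPushforward.eq_push ((hiso s hs).bracket _ _ _ _
        ((h s).isPushforward_push α) ((h s).isPushforward_push β))).symm
    have h4 := h2.unique hu ht (h1.congr ht fun s hs => by rw [h3 s hs])
    have h5 : ∀ P Q : Sec I F V, (h t).pull (B.bracket P Q) x =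
        (A t).bracket ((h t).pull P) ((h t).pull Q) x := by
      intro P Q
      rw [BundleAut.pull_apply, (hiso t ht).bracket _ _ P Q ((h t).isPushforward_pull P)
        ((h t).isPushforward_pull Q) x, BundleAut.fiberEquiv_symm_fiber]
    have h6 := congrArg ((h t).fiberEquiv x).symm h4
    simp only [map_add, (h t).push_apply, BundleAut.fiberEquiv_symm_fiber, ← BundleAut.pull_apply,
      h5, BundleAut.pull_push, LinearMap.zero_apply, Pi.zero_apply] at h6
    have h7 : (h t).pull 0 x = 0 := by simp [BundleAut.pull_apply]
    rw [h7, zero_add] at h6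
    rw [(A t).bracket_swap β]
    simp only [ContMDiffSection.coe_sub, ContMDiffSection.coe_neg, Pi.sub_apply, Pi.neg_apply]
    rw [eq_sub_iff_add_eq, h6]
    abel

end TrivialFamily

end BundleAutomorphisms

section ChartCovers

variable {E : Type*} [NormedAddCommGroup E] [NormedSpace ℝ E] [FiniteDimensional ℝ E]
  {H : Type*} [TopologicalSpace H] {I : ModelWithCorners ℝ E H} [I.Boundaryless]
  {M : Type*} [TopologicalSpace M] [ChartedSpace H M] [IsManifold I ∞ M]
  {J : Set ℝ}

variable [T2Space M] [SecondCountableTopology M]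

theorem exists_finite_partition [CompactSpace M] (U : M → Set M) (hU : ∀ x, U x ∈ 𝓝 x) :
    ∃ (T : Finset M) (ψ : T → Fun I M), (∀ x, ∑ i, ψ i x = 1) ∧
      ∀ i, ∀ x, ψ i x ≠ 0 → x ∈ interior (U i) := by
  obtain ⟨T, hT⟩ := isCompact_univ.elim_finite_subcover (fun x : M => interior (U x))
    (fun x => isOpen_interior)
    fun x _ => mem_iUnion.2 ⟨x, mem_interior_iff_mem_nhds.2 (hU x)⟩
  have : LocallyCompactSpace M := Manifold.locallyCompact_of_finiteDimensional I
  obtain ⟨ρ, hρ⟩ := SmoothPartitionOfUnity.exists_isSubordinate I (s := univ) isClosed_univ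
    (fun i : T => interior (U i)) (fun i => isOpen_interior) fun x hx => by
      obtain ⟨i, hi, hxi⟩ := mem_iUnion₂.1 (hT hx)
      exact mem_iUnion.2 ⟨⟨i, hi⟩, hxi⟩
  refine ⟨T, fun i => ρ i, fun x => ?_, fun i x hx => hρ i (subset_tsupport _ hx)⟩
  rw [← finsum_eq_sum_of_fintype]
  exact ρ.sum_eq_one (mem_univ x)

/-- A finite cover of `M` by charts together with a subordinate partition of unity `ψ`, global
functions `u` that agree with the charts near the support of `ψ`, and cut-off functions `η` on the
images of the charts. -/
structure ChartCover (I : ModelWithCorners ℝ E H) (M : Type*) [TopologicalSpace M]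
    [ChartedSpace H M] (ι : Type*) [Fintype ι] where
  center : ι → M
  ψ : ι → Fun I M
  u : ι → M → E
  η : ι → E → ℝ
  sum_ψ : ∀ x, ∑ i, ψ i x = 1
  contMDiff_u : ∀ i, ContMDiff I 𝓘(ℝ, E) ∞ (u i)
  contDiff_η : ∀ i, ContDiff ℝ ∞ (η i)
  mem_source : ∀ i x, ψ i x ≠ 0 → x ∈ (extChartAt I (center i)).source
  u_eq : ∀ i x, ψ i x ≠ 0 → u i x = extChartAt I (center i) x
  η_eq : ∀ i x, ψ i x ≠ 0 → η i (extChartAt I (center i) x) = 1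
  tsupport_η : ∀ i, tsupport (η i) ⊆ (extChartAt I (center i)).target

theorem exists_contDiff_bump {G : Type*} [NormedAddCommGroup G] [NormedSpace ℝ G]
    [FiniteDimensional ℝ G] {C U : Set G} (hC : IsClosed C) (hU : IsOpen U) (h : C ⊆ U) :
    ∃ η : G → ℝ, ContDiff ℝ ∞ η ∧ (∀ᶠ z in 𝓝ˢ C, η z = 1) ∧ tsupport η ⊆ U := by
  have : SecondCountableTopology G := by
    have := FiniteDimensional.proper ℝ G
    infer_instance
  obtain ⟨χ, h1, h2⟩ := exists_bump (I := 𝓘(ℝ, G)) hC hU h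
  exact ⟨χ, χ.contMDiff.contDiff, h1, h2⟩

theorem exists_chartCover [CompactSpace M] :
    ∃ T : Finset M, Nonempty (ChartCover I M T) := by
  choose f hf hfx using fun x₀ : M => exists_chartFun (I := I) x₀
  have hη := fun x₀ : M => exists_contDiff_bump (isClosed_singleton (x := extChartAt I x₀ x₀))
    (isOpen_extChartAt_target (I := I) x₀) (singleton_subset_iff.2 (mem_extChartAt_target x₀))
  choose η hηs hη1 hηt using hη
  have hU : ∀ x₀ : M, {x | x ∈ (extChartAt I x₀).source ∧ f x₀ x = extChartAt I x₀ x ∧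
      η x₀ (extChartAt I x₀ x) = 1} ∈ 𝓝 x₀ := by
    intro x₀
    have h1 := hη1 x₀
    rw [nhdsSet_singleton] at h1
    filter_upwards [hfx x₀, extChartAt_source_mem_nhds (I := I) x₀,
      (continuousAt_extChartAt (I := I) x₀).eventually h1] with x h1 h2 h3
    exact ⟨h2, h1, h3⟩
  obtain ⟨T, ψ, hψ, hψU⟩ := exists_finite_partition (I := I) _ hU
  exact ⟨T, ⟨{
    center := fun i => i
    ψ := ψ
    u := fun i => f i
    η := fun i => η i
    sum_ψ := hψ
    contMDiff_u := fun i => hf i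
    contDiff_η := fun i => hηs i
    mem_source := fun i x hx => (interior_subset (hψU i x hx)).1
    u_eq := fun i x hx => (interior_subset (hψU i x hx)).2.1
    η_eq := fun i x hx => (interior_subset (hψU i x hx)).2.2
    tsupport_η := fun i => hηt i }⟩⟩

theorem contDiffOn_cutoff_chartRead {G : Type*} [NormedAddCommGroup G] [NormedSpace ℝ G]
    {g : ℝ × M → G} (hg : SmoothFun I J g) {x₀ : M} {η : E → ℝ} (hη : ContDiff ℝ ∞ η)
    (hηs : tsupport η ⊆ (extChartAt I x₀).target) :
    ContDiffOn ℝ ∞ (fun q : ℝ × E => η q.2 • g (q.1, (extChartAt I x₀).symm q.2))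
      (J ×ˢ univ) := by
  rintro ⟨t, z⟩ ⟨ht, -⟩
  by_cases hz : z ∈ (extChartAt I x₀).target
  · have h1 : J ×ˢ (extChartAt I x₀).target ∈ 𝓝[J ×ˢ univ] (t, z) := by
      have : (univ : Set ℝ) ×ˢ (extChartAt I x₀).target ∈ 𝓝 (t, z) :=
        prod_mem_nhds univ_mem ((isOpen_extChartAt_target x₀).mem_nhds hz)
      filter_upwards [self_mem_nhdsWithin, mem_nhdsWithin_of_mem_nhds this] with p h1 h2
      exact ⟨h1.1, h2.2⟩
    refine ContDiffWithinAt.mono_of_mem_nhdsWithin ?_ h1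
    exact (hη.comp contDiff_snd).contDiffWithinAt.smul
      (hg.contDiffOn_chartRead x₀ (t, z) ⟨ht, hz⟩)
  · have h1 : ∀ᶠ q : ℝ × E in 𝓝 (t, z), η q.2 = 0 := by
      have h2 : ∀ᶠ w in 𝓝 z, η w = 0 :=
        notMem_tsupport_iff_eventuallyEq.1 fun h => hz (hηs h)
      have h3 : Tendsto (fun q : ℝ × E => q.2) (𝓝 (t, z)) (𝓝 z) := continuous_snd.continuousAt
      exact h3.eventually h2
    refine (contDiffWithinAt_const (c := (0 : G))).congr_of_eventuallyEq
      (mem_nhdsWithin_of_mem_nhds (h1.mono fun q hq => ?_)) ?_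
    · simp only [hq, zero_smul]
    · simp only [h1.self_of_nhds, zero_smul]

theorem exists_bound_of_tsupport {G G' : Type*} [NormedAddCommGroup G] [NormedSpace ℝ G]
    [FiniteDimensional ℝ G] [NormedAddCommGroup G'] [NormedSpace ℝ G'] {g : ℝ × G → G'}
    (hg : ContinuousOn g (J ×ˢ univ)) {z₀ : G} {R : ℝ}
    (h : ∀ t z, z ∉ Metric.closedBall z₀ R → g (t, z) = 0) {a b : ℝ} (hab : Icc a b ⊆ J) :
    ∃ C, 0 ≤ C ∧ ∀ t ∈ Icc a b, ∀ z, ‖g (t, z)‖ ≤ C := by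
  have := FiniteDimensional.proper ℝ G
  obtain ⟨C, hC⟩ := (isCompact_Icc.prod (isCompact_closedBall z₀ R)).exists_bound_of_continuousOn
    (hg.mono (prod_mono hab (subset_univ _)) :
      ContinuousOn g (Icc a b ×ˢ Metric.closedBall z₀ R))
  refine ⟨max C 0, le_max_right _ _, fun t ht z => ?_⟩
  by_cases hz : z ∈ Metric.closedBall z₀ R
  · exact (hC (t, z) ⟨ht, hz⟩).trans (le_max_left _ _)
  · rw [h t z hz, norm_zero]
    exact le_max_right _ _

namespace ChartCover

variable {ι : Type*} [Fintype ι] (K : ChartCover I M ι)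

/-- The embedding of `M` into a Euclidean space defined by a finite cover by charts. -/
def y (x : M) (i : ι) : E × ℝ := (K.u i x, K.ψ i x)

theorem contMDiff_y : ContMDiff I 𝓘(ℝ, ι → E × ℝ) ∞ K.y :=
  contMDiff_pi_space.2 fun i => (K.contMDiff_u i).prodMk_space (K.ψ i).contMDiff

theorem exists_ψ_ne_zero (x : M) : ∃ i, K.ψ i x ≠ 0 := by
  by_contra! h
  have := K.sum_ψ x
  simp [h] at this

theorem symm_u {i : ι} {x : M} (h : K.ψ i x ≠ 0) :
    (extChartAt I (K.center i)).symm (K.u i x) = x := by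
  rw [K.u_eq i x h, PartialEquiv.left_inv _ (K.mem_source i x h)]

theorem y_injective : Function.Injective K.y := by
  intro x x' h
  obtain ⟨i, hi⟩ := K.exists_ψ_ne_zero x
  have h1 : K.u i x = K.u i x' := congrArg Prod.fst (congrFun h i)
  have h2 : K.ψ i x = K.ψ i x' := congrArg Prod.snd (congrFun h i)
  rw [← K.symm_u hi, h1, K.symm_u (h2 ▸ hi)]

theorem contMDiffWithinAt_of_y {E' : Type*} [NormedAddCommGroup E'] [NormedSpace ℝ E']
    {H' : Type*} [TopologicalSpace H'] {I' : ModelWithCorners ℝ E' H'} {N : Type*}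
    [TopologicalSpace N] [ChartedSpace H' N] {γ : N → M} {S : Set N} {q₀ : N}
    (h : ContMDiffWithinAt I' 𝓘(ℝ, ι → E × ℝ) ∞ (fun q => K.y (γ q)) S q₀) :
    ContMDiffWithinAt I' I ∞ γ S q₀ := by
  obtain ⟨i, hi⟩ := K.exists_ψ_ne_zero (γ q₀)
  have h1 := contMDiffWithinAt_pi_space.1 h i
  have hu : ContMDiffWithinAt I' 𝓘(ℝ, E) ∞ (fun q => K.u i (γ q)) S q₀ :=
    contDiff_fst.contMDiff.contMDiffAt.comp_contMDiffWithinAt q₀ h1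
  have hψ : ContMDiffWithinAt I' 𝓘(ℝ, ℝ) ∞ (fun q => K.ψ i (γ q)) S q₀ :=
    contDiff_snd.contMDiff.contMDiffAt.comp_contMDiffWithinAt q₀ h1
  have h2 : ContMDiffAt 𝓘(ℝ, E) I ∞ (extChartAt I (K.center i)).symm (K.u i (γ q₀)) := by
    refine (contMDiffOn_extChartAt_symm _).contMDiffAt
      ((isOpen_extChartAt_target (K.center i)).mem_nhds ?_)
    rw [K.u_eq i _ hi]
    exact (extChartAt I _).map_source (K.mem_source i _ hi)
  refine (h2.comp_contMDiffWithinAt q₀ hu).congr_of_eventuallyEq ?_ (K.symm_u hi).symm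
  filter_upwards [hψ.continuousWithinAt.eventually (isOpen_ne.mem_nhds hi)] with q hq
  exact (K.symm_u hq).symm

theorem exists_extension [CompactSpace M] {G : Type*} [NormedAddCommGroup G] [NormedSpace ℝ G]
    {g : ℝ × M → G} (hg : SmoothFun I J g) : ∃ g' : ℝ × (ι → E × ℝ) → G,
      ContDiffOn ℝ ∞ g' (J ×ˢ univ) ∧ (∀ t x, g' (t, K.y x) = g (t, x)) ∧
      ∀ a b, Icc a b ⊆ J → ∃ C, 0 ≤ C ∧ ∀ t ∈ Icc a b, ∀ Y, ‖g' (t, Y)‖ ≤ C := by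
  have hcomp : IsCompact (range K.y) := isCompact_range K.contMDiff_y.continuous
  obtain ⟨R, hR⟩ := hcomp.isBounded.subset_ball 0
  obtain ⟨B, hB, hB1, hBt⟩ := exists_contDiff_bump hcomp.isClosed Metric.isOpen_ball hR
  set g' : ℝ × (ι → E × ℝ) → G := fun p => B p.2 • ∑ i, (p.2 i).2 •
    (K.η i (p.2 i).1 • g (p.1, (extChartAt I (K.center i)).symm (p.2 i).1)) with hg'
  have hsm : ContDiffOn ℝ ∞ g' (J ×ˢ univ) := by
    refine (hB.comp contDiff_snd).contDiffOn.smul (ContDiffOn.sum fun i _ => ?_)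
    have h1 : ContDiff ℝ ∞ (fun p : ℝ × (ι → E × ℝ) => p.2 i) :=
      (contDiff_apply ℝ (E × ℝ) i).comp contDiff_snd
    refine (contDiff_snd.comp h1).contDiffOn.smul ?_
    exact ContDiffOn.comp (t := J ×ˢ univ) (f := fun p : ℝ × (ι → E × ℝ) => (p.1, (p.2 i).1))
      (contDiffOn_cutoff_chartRead hg (K.contDiff_η i) (K.tsupport_η i))
      (contDiff_fst.prodMk (contDiff_fst.comp h1)).contDiffOn fun p hp => ⟨hp.1, trivial⟩
  refine ⟨g', hsm, fun t x => ?_, fun a b hab => exists_bound_of_tsupport hsm.continuousOn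
    (z₀ := 0) (R := R) (fun t z hz => ?_) hab⟩
  · have h1 : B (K.y x) = 1 := hB1.self_of_nhdsSet _ (mem_range_self x)
    have h2 : ∀ i, (K.y x i).2 • (K.η i (K.y x i).1 •
        g (t, (extChartAt I (K.center i)).symm (K.y x i).1)) = K.ψ i x • g (t, x) := by
      intro i
      by_cases hi : K.ψ i x = 0
      · simp [y, hi]
      · simp only [y, K.symm_u hi]
        rw [K.u_eq i x hi, K.η_eq i x hi, one_smul]
    simp only [hg', h1, one_smul, h2]
    rw [← Finset.sum_smul, K.sum_ψ, one_smul]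
  · have : B z = 0 := image_eq_zero_of_notMem_tsupport fun h =>
      hz (Metric.ball_subset_closedBall (hBt h))
    simp only [hg', this, zero_smul]

end ChartCover

end ChartCovers

section WeakCurves

variable {E : Type*} [NormedAddCommGroup E] [NormedSpace ℝ E] [FiniteDimensional ℝ E]
  {H : Type*} [TopologicalSpace H] {I : ModelWithCorners ℝ E H} [I.Boundaryless]
  {M : Type*} [TopologicalSpace M] [ChartedSpace H M] [IsManifold I ∞ M]
  {J : Set ℝ}

variable [T2Space M] [SecondCountableTopology M] {X : ℝ → VF I M}

section Calculus

variable {G : Type*} [NormedAddCommGroup G] [NormedSpace ℝ G] {G' : Type*} [NormedAddCommGroup G']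
  [NormedSpace ℝ G']

theorem mvfderiv_comp_apply {f : M → G} {x : M} (hf : ContMDiff I 𝓘(ℝ, G) ∞ f) {h : G → G'}
    (hh : DifferentiableAt ℝ h (f x)) (v : TangentSpace I x) :
    mvfderiv I (h ∘ f) x v = fderiv ℝ h (f x) (mvfderiv I f x v) := by
  have h1 : MDifferentiableAt 𝓘(ℝ, G) 𝓘(ℝ, G') h (f x) := hh.mdifferentiableAt
  have h2 : MDifferentiableAt I 𝓘(ℝ, G) f x := hf.mdifferentiable (by simp) x
  unfold mvfderiv
  rw [mfderiv_comp x h1 h2, mfderiv_eq_fderiv]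
  rfl

variable [FiniteDimensional ℝ G]

theorem mvfderiv_dual_comp {f : M → G} (hf : ContMDiff I 𝓘(ℝ, G) ∞ f) (φ : G →ₗ[ℝ] ℝ) (x : M)
    (v : TangentSpace I x) : mvfderiv I (fun y => φ (f y)) x v = φ (mvfderiv I f x v) := by
  have h := mvfderiv_comp_apply (x := x) hf
    (LinearMap.toContinuousLinearMap φ).differentiableAt v
  rw [(LinearMap.toContinuousLinearMap φ).fderiv] at h
  exact h

theorem smoothFun_of_dual {g : ℝ × M → G} (h : ∀ φ : G →ₗ[ℝ] ℝ, SmoothFun I J fun p => φ (g p)) :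
    SmoothFun I J g := by
  have b := Module.finBasis ℝ G
  have h1 : SmoothFun I J fun p => ∑ k, b.coord k (g p) • b k :=
    fun p hp => ContMDiffWithinAt.sum fun k _ =>
      (h (b.coord k) p hp).smul contMDiffWithinAt_const
  refine h1.congr fun p _ => ?_
  simp [b.sum_repr]

theorem contMDiff_dual_comp {f : M → G} (hf : ContMDiff I 𝓘(ℝ, G) ∞ f) (φ : G →ₗ[ℝ] ℝ) :
    ContMDiff I 𝓘(ℝ, ℝ) ∞ fun x => φ (f x) :=
  (LinearMap.toContinuousLinearMap φ).contDiff.contMDiff.comp hf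

/-- The vector fields `X t` depend smoothly on `t ∈ J`, tested on functions. -/
def SmoothVF (J : Set ℝ) (X : ℝ → VF I M) : Prop :=
  ∀ f : Fun I M, SmoothFun I J fun p => (mvfderiv I f p.2 (X p.1 p.2) : ℝ)

theorem SmoothVF.mvfderiv (hX : SmoothVF J X) {f : M → G} (hf : ContMDiff I 𝓘(ℝ, G) ∞ f) :
    SmoothFun I J fun p => (_root_.mvfderiv I f p.2 (X p.1 p.2) : G) :=
  smoothFun_of_dual fun φ => by
    refine (hX ⟨fun x => φ (f x), contMDiff_dual_comp hf φ⟩).congr fun p _ => ?_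
    exact (mvfderiv_dual_comp hf φ p.2 _).symm

/-- `γ` is an integral curve on `J` of the time-dependent vector field `X`, tested on functions. -/
def IsWeakCurve (J : Set ℝ) (X : ℝ → VF I M) (γ : ℝ → M) : Prop :=
  ∀ f : Fun I M, ∀ t ∈ J, HasDerivWithinAt (fun s => f (γ s)) (mvfderiv I f (γ t) (X t (γ t))) J t

theorem IsWeakCurve.hasDerivWithinAt {γ : ℝ → M} (hγ : IsWeakCurve J X γ) {f : M → G}
    (hf : ContMDiff I 𝓘(ℝ, G) ∞ f) {t : ℝ} (ht : t ∈ J) :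
    HasDerivWithinAt (fun s => f (γ s)) (mvfderiv I f (γ t) (X t (γ t)) : G) J t := by
  refine WDeriv.hasDerivWithinAt fun φ => ?_
  have h := hγ ⟨fun x => φ (f x), contMDiff_dual_comp hf φ⟩ t ht
  have h2 := mvfderiv_dual_comp hf φ (γ t) (X t (γ t))
  rw [← h2]
  exact h

end Calculus

theorem exists_local_isWeakCurve (hX : SmoothVF J X) (hJ : J.OrdConnected) (hJ' : J.Nontrivial)
    {t₁ : ℝ} (ht₁ : t₁ ∈ J) (x₁ : M) :
    ∃ δ > 0, ∃ γ : ℝ → M, γ t₁ = x₁ ∧ IsWeakCurve (J ∩ Metric.ball t₁ δ) X γ := by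
  set φ := extChartAt I x₁ with hφ
  obtain ⟨f, hf, hfx⟩ := exists_chartFun (I := I) x₁
  have hopen : IsOpen (φ.target ∩ Metric.ball (φ x₁) 1) :=
    (isOpen_extChartAt_target x₁).inter Metric.isOpen_ball
  obtain ⟨η, hη, hη1, hηt⟩ := exists_contDiff_bump (isClosed_singleton (x := φ x₁)) hopen
    (singleton_subset_iff.2 ⟨mem_extChartAt_target x₁, Metric.mem_ball_self one_pos⟩)
  rw [nhdsSet_singleton] at hη1
  set Z : ℝ → E → E := fun t z => η z • mvfderiv I f (φ.symm z) (X t (φ.symm z)) with hZ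
  have hZs : ContDiffOn ℝ ∞ (fun q : ℝ × E => Z q.1 q.2) (J ×ˢ univ) :=
    contDiffOn_cutoff_chartRead (hX.mvfderiv hf) hη (hηt.trans inter_subset_left)
  have hZg : LinearGrowth J Z := by
    intro a ha b hb
    obtain ⟨C, hC0, hC⟩ := exists_bound_of_tsupport hZs.continuousOn (z₀ := φ x₁) (R := 1)
      (fun t z hz => by
        have : η z = 0 := image_eq_zero_of_notMem_tsupport fun h =>
          hz (Metric.ball_subset_closedBall (hηt h).2)
        simp only [hZ, this, zero_smul]) (hJ.out ha hb)
    refine ⟨C, fun t ht z => (hC t ht z).trans ?_⟩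
    have := norm_nonneg z
    nlinarith
  obtain ⟨Φ, hΦ⟩ := exists_isFlow hJ hJ' ht₁ hZs hZg
  set z : ℝ → E := fun t => Φ t (φ x₁) with hz
  have hz1 : z t₁ = φ x₁ := hΦ.init _
  have hzc := hΦ.curve (φ x₁)
  have hx1 : φ.symm (φ x₁) = x₁ := extChartAt_to_inv x₁
  have hW : ∀ᶠ w in 𝓝 (φ x₁), w ∈ φ.target ∧ η w = 1 ∧
      ∀ᶠ y in 𝓝 (φ.symm w), f y = φ y := by
    have h1 : Tendsto φ.symm (𝓝 (φ x₁)) (𝓝 x₁) := by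
      have := (continuousAt_extChartAt_symm (I := I) x₁).tendsto
      rwa [extChartAt_to_inv] at this
    filter_upwards [(isOpen_extChartAt_target x₁).mem_nhds (mem_extChartAt_target x₁), hη1,
      h1.eventually hfx.eventually_nhds] with w h1 h2 h3
    exact ⟨h1, h2, h3⟩
  have hcont : ContinuousWithinAt z J t₁ := (hzc t₁ ht₁).continuousWithinAt
  rw [ContinuousWithinAt, hz1] at hcont
  obtain ⟨δ, hδ, hδW⟩ := Metric.mem_nhdsWithin_iff.1 (hcont.eventually hW)
  refine ⟨δ, hδ, fun t => φ.symm (z t), (congrArg φ.symm hz1).trans hx1, fun h t ht => ?_⟩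
  obtain ⟨hm, h1, hev⟩ := hδW ⟨ht.2, ht.1⟩
  have hd : HasDerivWithinAt z (Z t (z t)) (J ∩ Metric.ball t₁ δ) t :=
    (hzc t ht.1).mono inter_subset_left
  have hsrc : φ.symm (z t) ∈ (extChartAt I x₁).source := φ.map_target hm
  have hZt : Z t (z t) = (trivializationAt E (TangentSpace I) x₁
      ⟨φ.symm (z t), X t (φ.symm (z t))⟩).2 := by
    simp only [hZ, h1, one_smul]
    exact mvfderiv_of_eq_extChartAt hf hsrc hev _
  have hfd : DifferentiableAt ℝ (h ∘ φ.symm) (z t) := by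
    have := ((h.contMDiff.contMDiffOn (s := univ)).comp (contMDiffOn_extChartAt_symm (n := ∞) x₁)
      fun _ _ => trivial) _ hm
    exact (this.contMDiffAt ((isOpen_extChartAt_target' x₁).mem_nhds
      hm)).contDiffAt.differentiableAt (by simp)
  have h2 := hfd.hasFDerivAt.comp_hasDerivWithinAt t hd
  rw [hZt] at h2
  rw [mvfderiv_eq_chart h.contMDiff hsrc, ← hφ, φ.right_inv hm]
  exact h2

namespace ChartCover

variable {ι : Type*} [Fintype ι] (K : ChartCover I M ι)

/-- Time-dependent vector fields on the ambient space that extend `X`. -/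
def Extends (J : Set ℝ) (X : ℝ → VF I M) (X' : ℝ → (ι → E × ℝ) → (ι → E × ℝ)) : Prop :=
  ∀ t ∈ J, ∀ x, X' t (K.y x) = (mvfderiv I K.y x (X t x) : ι → E × ℝ)

variable {K}

theorem Extends.isIntegralCurveOn {X' : ℝ → (ι → E × ℝ) → (ι → E × ℝ)} {J' : Set ℝ}
    (h : K.Extends J X X') (hJ' : J' ⊆ J) {γ : ℝ → M} (hγ : IsWeakCurve J' X γ) :
    IsIntegralCurveOn (fun t => K.y (γ t)) X' J' := fun t ht => by
  rw [h t (hJ' ht)]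
  exact hγ.hasDerivWithinAt K.contMDiff_y ht

variable (K)

theorem Extends.exists_local {X' : ℝ → (ι → E × ℝ) → (ι → E × ℝ)} (h : K.Extends J X X')
    (hX : SmoothVF J X) (hJ : J.OrdConnected) (hJ' : J.Nontrivial)
    (hX' : LocLip J X') {z : ℝ → ι → E × ℝ} (hz : IsIntegralCurveOn z X' J) {t₁ : ℝ} (ht₁ : t₁ ∈ J)
    {x₁ : M} (hx₁ : z t₁ = K.y x₁) :
    ∃ δ > 0, ∃ γ : ℝ → M, γ t₁ = x₁ ∧ IsWeakCurve (J ∩ Metric.ball t₁ δ) X γ ∧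
      ∀ t ∈ J ∩ Metric.ball t₁ δ, z t = K.y (γ t) := by
  obtain ⟨δ, hδ, γ, hγ1, hγ⟩ := exists_local_isWeakCurve hX hJ hJ' ht₁ x₁
  obtain ⟨hJo, -⟩ := inter_ball_of_ordConnected hJ hJ' ht₁ hδ
  refine ⟨δ, hδ, γ, hγ1, hγ, fun t ht => ?_⟩
  refine (hX'.mono inter_subset_left).eq_of_isIntegralCurveOn hJo
    (hz.mono inter_subset_left) (h.isIntegralCurveOn inter_subset_left hγ)
    ⟨ht₁, Metric.mem_ball_self hδ⟩ ?_ ht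
  rw [hx₁, hγ1]

theorem Extends.exists_isWeakCurve [CompactSpace M] {X' : ℝ → (ι → E × ℝ) → (ι → E × ℝ)}
    (h : K.Extends J X X') (hX : SmoothVF J X) (hJ : J.OrdConnected) (hJ' : J.Nontrivial)
    (hX' : LocLip J X') {z : ℝ → ι → E × ℝ} (hz : IsIntegralCurveOn z X' J) {t₀ : ℝ} (ht₀ : t₀ ∈ J)
    {x₀ : M} (hx₀ : z t₀ = K.y x₀) :
    ∃ γ : ℝ → M, γ t₀ = x₀ ∧ IsWeakCurve J X γ ∧ ∀ t ∈ J, z t = K.y (γ t) := by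
  have hrange : ∀ t ∈ J, z t ∈ range K.y := by
    have : PreconnectedSpace J := isPreconnected_iff_preconnectedSpace.1 hJ.isPreconnected
    set S : Set J := {t | z t ∈ range K.y} with hS
    have hcl : IsClosed S :=
      ((isCompact_range K.contMDiff_y.continuous).isClosed).preimage
        (continuousOn_iff_continuous_domRestrict.1 hz.continuousOn)
    have hop : IsOpen S := by
      rw [isOpen_iff_mem_nhds]
      rintro ⟨t₁, ht₁⟩ ⟨x₁, hx₁⟩
      obtain ⟨δ, hδ, γ, -, -, hzγ⟩ := h.exists_local K hX hJ hJ' hX' hz ht₁ hx₁.symm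
      have h1 : Subtype.val ⁻¹' Metric.ball t₁ δ ∈ 𝓝 (⟨t₁, ht₁⟩ : J) :=
        continuous_subtype_val.continuousAt.preimage_mem_nhds (Metric.ball_mem_nhds _ hδ)
      filter_upwards [h1] with t ht
      exact ⟨γ t, (hzγ t ⟨t.2, ht⟩).symm⟩
    have huniv : S = univ := IsClopen.eq_univ ⟨hcl, hop⟩ ⟨⟨t₀, ht₀⟩, ⟨x₀, hx₀.symm⟩⟩
    intro t ht
    have : (⟨t, ht⟩ : J) ∈ S := huniv ▸ mem_univ _
    exact this
  have hex : ∀ t, ∃ x, t ∈ J → K.y x = z t := fun t => by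
    by_cases ht : t ∈ J
    · obtain ⟨x, hx⟩ := hrange t ht
      exact ⟨x, fun _ => hx⟩
    · exact ⟨x₀, fun h => absurd h ht⟩
  choose γ hγ using hex
  refine ⟨γ, K.y_injective ((hγ t₀ ht₀).trans hx₀), fun f t₁ ht₁ => ?_, fun t ht => (hγ t ht).symm⟩
  obtain ⟨δ, hδ, γ', hγ'1, hγ', hzγ⟩ := h.exists_local K hX hJ hJ' hX' hz ht₁ (hγ t₁ ht₁).symm
  have hmem : t₁ ∈ J ∩ Metric.ball t₁ δ := ⟨ht₁, Metric.mem_ball_self hδ⟩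
  have heq : ∀ t ∈ J ∩ Metric.ball t₁ δ, γ t = γ' t := fun t ht =>
    K.y_injective ((hγ t ht.1).trans (hzγ t ht))
  have h1 := (hγ' f t₁ hmem).congr (fun t ht => congrArg f (heq t ht)) (congrArg f (heq t₁ hmem))
  rw [← heq t₁ hmem] at h1
  exact h1.mono_of_mem_nhdsWithin (inter_mem_nhdsWithin J (Metric.ball_mem_nhds _ hδ))

end ChartCover

end WeakCurves

section FrameAlgebra

variable {E : Type*} [NormedAddCommGroup E] [NormedSpace ℝ E] [FiniteDimensional ℝ E]
  {H : Type*} [TopologicalSpace H] {I : ModelWithCorners ℝ E H} [I.Boundaryless]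
  {M : Type*} [TopologicalSpace M] [ChartedSpace H M] [IsManifold I ∞ M]
  {J : Set ℝ}

variable {F : Type*} [NormedAddCommGroup F] [NormedSpace ℝ F] [FiniteDimensional ℝ F]
  {V : M → Type*} [TopologicalSpace (TotalSpace F V)]
  [∀ x, AddCommGroup (V x)] [∀ x, Module ℝ (V x)] [∀ x, TopologicalSpace (V x)]
  [FiberBundle F V] [VectorBundle ℝ F V] [ContMDiffVectorBundle ∞ F V I]

variable [T2Space M] [SecondCountableTopology M] {X : ℝ → VF I M}

theorem exists_globalFrame [CompactSpace M] : ∃ (n : ℕ) (s : Fin n → Sec I F V)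
    (ξ : Fin n → ∀ x : M, V x →ₗ[ℝ] ℝ), FrameOn univ s ξ := by
  choose U hU hxU n s ξ hfr using fun x₀ : M => exists_frameOn (I := I) (F := F) (V := V) x₀
  obtain ⟨T, ψ, hψ, hψU⟩ := exists_finite_partition (I := I) U fun x => (hU x).mem_nhds (hxU x)
  set e := Fintype.equivFin (Σ j : T, Fin (n j))
  refine ⟨_, fun i => s (e.symm i).1 (e.symm i).2,
    fun i x => ψ (e.symm i).1 x • ξ (e.symm i).1 (e.symm i).2 x, fun i => ?_, fun x _ v => ?_⟩
  · simp only [LinearMap.smul_apply]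
    exact ((ψ _).contMDiff.comp (contMDiff_proj V)).smul ((hfr _).smooth _)
  · rw [Equiv.sum_comp e.symm
      fun j : Σ j : T, Fin (n j) => (ψ j.1 x • ξ j.1 j.2 x) v • s j.1 j.2 x, Fintype.sum_sigma]
    have h1 : ∀ j : T, ∑ k, (ψ j x • ξ j k x) v • s j k x = ψ j x • v := by
      intro j
      by_cases hj : ψ j x = 0
      · simp [hj]
      · simp only [LinearMap.smul_apply, smul_assoc]
        rw [← Finset.smul_sum, (hfr j).sum x (interior_subset (hψU j x hj))]
    simp only [h1]
    rw [← Finset.sum_smul, hψ, one_smul]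

/-- The operators `D t` are derivations of `Γ(A)` with symbols `X t`, smooth in `t`. -/
structure DerivationFamily (J : Set ℝ) (D : ℝ → Sec I F V →ₗ[ℝ] Sec I F V) (X : ℝ → VF I M) :
    Prop where
  isDerAt : ∀ t ∈ J, ∀ x, IsDerAt x (evalAt x ∘ₗ D t) (X t x)
  smooth : ∀ α, SmoothFam I F J fun t x => D t α x
  smoothVF : SmoothVF J X

variable {κ : Type*} [Fintype κ] {s : κ → Sec I F V} {ξ : κ → ∀ x : M, V x →ₗ[ℝ] ℝ}
  {D : ℝ → Sec I F V →ₗ[ℝ] Sec I F V}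

/-- The components of a vector with respect to a frame. -/
def coeffs (ξ : κ → ∀ x : M, V x →ₗ[ℝ] ℝ) {x : M} (v : V x) : κ → ℝ := fun l => ξ l x v

namespace FrameOn

variable (hfr : FrameOn (univ : Set M) s ξ)

/-- The components of the members of a frame. -/
def proj (x : M) : Matrix κ κ ℝ := Matrix.of fun k l => coeffFun (hfr.smooth l) (s k) x

/-- The derivatives along `X t` of the components of the members of a frame. -/
def dproj (X : ℝ → VF I M) (t : ℝ) (x : M) : Matrix κ κ ℝ :=
  Matrix.of fun k l => mvfderiv I (coeffFun (hfr.smooth l) (s k)) x (X t x)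

/-- The components of the derivatives of the members of a frame. -/
def conn (_ : FrameOn (univ : Set M) s ξ) (D : ℝ → Sec I F V →ₗ[ℝ] Sec I F V) (t : ℝ) (x : M) :
    Matrix κ κ ℝ :=
  Matrix.of fun k l => ξ l x (D t (s k) x)

/-- The coefficients of the equation of parallel transport. -/
def transportMatrix (D : ℝ → Sec I F V →ₗ[ℝ] Sec I F V) (X : ℝ → VF I M) (t : ℝ) (x : M) :
    Matrix κ κ ℝ :=
  hfr.proj x * hfr.dproj X t x - hfr.conn D t x

theorem coeffs_vecMul_proj {x : M} (v : V x) :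
    Matrix.vecMul (coeffs ξ v) (hfr.proj x) = coeffs ξ v := by
  ext l
  conv_rhs => rw [coeffs, ← hfr.sum x trivial v]
  simp [Matrix.vecMul, dotProduct, coeffs, proj]

theorem coeffs_sum {x : M} (c : κ → ℝ) :
    coeffs ξ (∑ k, c k • s k x) = Matrix.vecMul c (hfr.proj x) := by
  ext l
  simp [Matrix.vecMul, dotProduct, coeffs, proj]

include hfr in
theorem eq_of_coeffs_eq {x : M} {v w : V x} (h : coeffs ξ v = coeffs ξ w) : v = w := by
  rw [← hfr.sum x trivial v, ← hfr.sum x trivial w]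
  exact Finset.sum_congr rfl fun k _ => congrArg (· • s k x) (congrFun h k)

theorem coeffs_vecMul_transportMatrix {t : ℝ} {x : M} (v : V x) :
    Matrix.vecMul (coeffs ξ v) (hfr.transportMatrix D X t x) =
      Matrix.vecMul (coeffs ξ v) (hfr.dproj X t x) -
        Matrix.vecMul (coeffs ξ v) (hfr.conn D t x) := by
  rw [transportMatrix, Matrix.vecMul_sub, ← Matrix.vecMul_vecMul, coeffs_vecMul_proj]

theorem mvfderiv_coeffs_eq (α : Sec I F V) (x : M) (v : TangentSpace I x) (t : ℝ)
    (hv : v = X t x) : (fun l => (mvfderiv I (fun y => ξ l y (α y)) x v : ℝ)) =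
      Matrix.vecMul (fun k => (mvfderiv I (fun y => ξ k y (α y)) x v : ℝ)) (hfr.proj x) +
        Matrix.vecMul (coeffs ξ (α x)) (hfr.dproj X t x) := by
  ext l
  have h1 : (fun y => ξ l y (α y)) =
      fun y => ∑ k, coeffFun (hfr.smooth k) α y * coeffFun (hfr.smooth l) (s k) y := by
    funext y
    conv_lhs => rw [← hfr.sum y trivial (α y)]
    simp
  set f : M → (κ → ℝ) × (κ → ℝ) := fun y =>
    (fun k => coeffFun (hfr.smooth k) α y, fun k => coeffFun (hfr.smooth l) (s k) y) with hf
  have hfs : ContMDiff I 𝓘(ℝ, (κ → ℝ) × (κ → ℝ)) ∞ f :=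
    ContMDiff.prodMk_space (contMDiff_pi_space.2 fun k => (coeffFun (hfr.smooth k) α).contMDiff)
      (contMDiff_pi_space.2 fun k => (coeffFun (hfr.smooth l) (s k)).contMDiff)
  have hd : HasFDerivAt (fun p : (κ → ℝ) × (κ → ℝ) => ∑ k, p.1 k * p.2 k)
      (∑ k, ((f x).1 k • ((ContinuousLinearMap.proj (R := ℝ) (φ := fun _ : κ => ℝ) k).comp
        (ContinuousLinearMap.snd ℝ (κ → ℝ) (κ → ℝ))) + (f x).2 k •
        ((ContinuousLinearMap.proj (R := ℝ) (φ := fun _ : κ => ℝ) k).comp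
        (ContinuousLinearMap.fst ℝ (κ → ℝ) (κ → ℝ))))) (f x) :=
    HasFDerivAt.fun_sum fun k _ =>
      HasFDerivAt.fun_mul ((ContinuousLinearMap.proj (R := ℝ) (φ := fun _ : κ => ℝ) k).comp
        (ContinuousLinearMap.fst ℝ (κ → ℝ) (κ → ℝ))).hasFDerivAt
      ((ContinuousLinearMap.proj (R := ℝ) (φ := fun _ : κ => ℝ) k).comp
        (ContinuousLinearMap.snd ℝ (κ → ℝ) (κ → ℝ))).hasFDerivAt
  have h2 := mvfderiv_comp_apply hfs hd.differentiableAt v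
  have e1 : ∀ k, (mvfderiv I f x v : (κ → ℝ) × (κ → ℝ)).1 k =
      mvfderiv I (fun y => ξ k y (α y)) x v := fun k =>
    (mvfderiv_dual_comp hfs ((LinearMap.proj k).comp (LinearMap.fst ℝ (κ → ℝ) (κ → ℝ))) x v).symm
  have e2 : ∀ k, (mvfderiv I f x v : (κ → ℝ) × (κ → ℝ)).2 k =
      mvfderiv I (coeffFun (hfr.smooth l) (s k)) x v := fun k =>
    (mvfderiv_dual_comp hfs ((LinearMap.proj k).comp (LinearMap.snd ℝ (κ → ℝ) (κ → ℝ))) x v).symm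
  rw [h1]
  refine h2.trans ?_
  rw [hd.fderiv]
  subst hv
  simp only [_root_.sum_apply, _root_.add_apply,
    _root_.smul_apply, ContinuousLinearMap.comp_apply, ContinuousLinearMap.coe_fst',
    ContinuousLinearMap.coe_snd', ContinuousLinearMap.proj_apply, smul_eq_mul,
    Finset.sum_add_distrib, Pi.add_apply, Matrix.vecMul, dotProduct, proj, dproj, coeffs,
    Matrix.of_apply]
  rw [add_comm]
  exact congrArg₂ (· + ·)
    (Finset.sum_congr rfl fun k _ => (congrArg ((f x).2 k * ·) (e1 k)).trans (mul_comm _ _))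
    (Finset.sum_congr rfl fun k _ => congrArg ((f x).1 k * ·) (e2 k))

end FrameOn

theorem DerivationFamily.coeffs_apply (hD : DerivationFamily J D X)
    (hfr : FrameOn (univ : Set M) s ξ) {t : ℝ} (ht : t ∈ J) (α : Sec I F V) (x : M) :
    coeffs ξ (D t α x) = Matrix.vecMul (coeffs ξ (α x)) (hfr.conn D t x) +
      Matrix.vecMul (fun k => (mvfderiv I (fun y => ξ k y (α y)) x (X t x) : ℝ))
        (hfr.proj x) := by
  ext l
  have h1 := (hD.isDerAt t ht x).eq_sum (U := univ) univ_mem hfr α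
  simp only [LinearMap.comp_apply, evalAt_apply] at h1
  rw [coeffs, h1]
  simp [Matrix.vecMul, dotProduct, coeffs, FrameOn.proj, FrameOn.conn, Finset.sum_add_distrib]

theorem DerivationFamily.mvfderiv_coeffs (hD : DerivationFamily J D X)
    (hfr : FrameOn (univ : Set M) s ξ) {t : ℝ} (ht : t ∈ J) (α : Sec I F V) (x : M) :
    (fun l => (mvfderiv I (fun y => ξ l y (α y)) x (X t x) : ℝ)) = coeffs ξ (D t α x) +
      Matrix.vecMul (coeffs ξ (α x)) (hfr.transportMatrix D X t x) := by
  rw [hfr.mvfderiv_coeffs_eq α x (X t x) t rfl, hfr.coeffs_vecMul_transportMatrix,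
    hD.coeffs_apply hfr ht α x]
  abel

theorem DerivationFamily.proj_mul_transportMatrix (hD : DerivationFamily J D X)
    (hfr : FrameOn (univ : Set M) s ξ) {t : ℝ} (ht : t ∈ J) (x : M) :
    hfr.transportMatrix D X t x * hfr.proj x + hfr.dproj X t x =
      hfr.proj x * hfr.transportMatrix D X t x := by
  set P := hfr.proj x with hP
  set Q := hfr.dproj X t x with hQ
  set C := hfr.conn D t x with hC
  have e1 : P * P = P := by
    ext k l
    exact congrFun (hfr.coeffs_vecMul_proj (s k x)) l
  have e2 : Q = Q * P + P * Q := by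
    ext k l
    exact congrFun (hfr.mvfderiv_coeffs_eq (s k) x (X t x) t rfl) l
  have e3 : C * P = C := by
    ext k l
    exact congrFun (hfr.coeffs_vecMul_proj (D t (s k) x)) l
  have e4 : Q = C + P * hfr.transportMatrix D X t x := by
    ext k l
    exact congrFun (hD.mvfderiv_coeffs hfr ht (s k) x) l
  have e5 : P * Q * P = 0 := by
    have h := congrArg (P * ·) e2
    simp only [mul_add] at h
    rw [← mul_assoc P P, e1, ← mul_assoc] at h
    exact left_eq_add.1 ((add_comm _ _).trans h.symm).symm
  rw [FrameOn.transportMatrix, ← hP, ← hQ, ← hC, sub_mul, e5, e3] at *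
  rw [zero_sub]
  nth_rewrite 1 [e4]
  abel

end FrameAlgebra

section ChainRule

variable {E : Type*} [NormedAddCommGroup E] [NormedSpace ℝ E] [FiniteDimensional ℝ E]
  {H : Type*} [TopologicalSpace H] {I : ModelWithCorners ℝ E H} [I.Boundaryless]
  {M : Type*} [TopologicalSpace M] [ChartedSpace H M] [IsManifold I ∞ M]
  {J : Set ℝ} [T2Space M] [SecondCountableTopology M] {X : ℝ → VF I M}

theorem IsWeakCurve.hasDerivWithinAt_smoothFun [CompactSpace M] {γ : ℝ → M}
    (hγ : IsWeakCurve J X γ) (hJ : J.OrdConnected) (hJ' : J.Nontrivial) {g : ℝ × M → ℝ}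
    (hg : SmoothFun I J g) {t : ℝ} (ht : t ∈ J) :
    HasDerivWithinAt (fun r => g (r, γ r))
      (tderiv J g (t, γ t) + mvfderiv I (fun y => g (t, y)) (γ t) (X t (γ t))) J t := by
  obtain ⟨T, ⟨K⟩⟩ := exists_chartCover (I := I) (M := M)
  obtain ⟨g', hg', hgy, -⟩ := K.exists_extension hg
  set Y' : T → E × ℝ := mvfderiv I K.y (γ t) (X t (γ t))
  have hY : HasDerivWithinAt (fun r => K.y (γ r)) Y' J t := hγ.hasDerivWithinAt K.contMDiff_y ht
  have hm : (t, K.y (γ t)) ∈ J ×ˢ (univ : Set (T → E × ℝ)) := ⟨ht, trivial⟩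
  have hd := hg'.differentiableOn (by simp) _ hm
  have h1 := HasFDerivWithinAt.comp_hasDerivWithinAt (f := fun r : ℝ => (r, K.y (γ r)))
    (t := J ×ˢ univ) t hd.hasFDerivWithinAt ((hasDerivWithinAt_id t J).prodMk hY)
    fun r hr => ⟨hr, trivial⟩
  have h2 : timeDeriv J univ g' (t, K.y (γ t)) = tderiv J g (t, γ t) := by
    refine (uniqueDiffOn_of_ordConnected hJ hJ' t ht).eq_deriv _
      (hasDerivWithinAt_timeDeriv hd hm) ?_
    simp only [hgy]
    exact hg.hasDerivWithinAt hJ hJ' ht _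
  have h3 : spaceDeriv J univ g' (t, K.y (γ t)) Y' =
      mvfderiv I (fun y => g (t, y)) (γ t) (X t (γ t)) := by
    have h4 := hasFDerivAt_spaceDeriv isOpen_univ hd hm
    have h5 := mvfderiv_comp_apply (x := γ t) K.contMDiff_y h4.differentiableAt (X t (γ t))
    rw [h4.fderiv] at h5
    rw [← h5]
    congr 2
    funext x
    exact hgy t x
  have h6 : (fderivWithin ℝ g' (J ×ˢ univ) (t, K.y (γ t))) (1, Y') =
      timeDeriv J univ g' (t, K.y (γ t)) + spaceDeriv J univ g' (t, K.y (γ t)) Y' := by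
    rw [timeDeriv, spaceDeriv, ContinuousLinearMap.comp_apply, ← map_add]
    simp
  rw [← h2, ← h3, ← h6]
  refine h1.congr (fun r _ => (hgy r _).symm) (hgy t _).symm

end ChainRule

section Transport

variable {E : Type*} [NormedAddCommGroup E] [NormedSpace ℝ E] [FiniteDimensional ℝ E]
  {H : Type*} [TopologicalSpace H] {I : ModelWithCorners ℝ E H} [I.Boundaryless]
  {M : Type*} [TopologicalSpace M] [ChartedSpace H M] [IsManifold I ∞ M]
  {J : Set ℝ}

variable {F : Type*} [NormedAddCommGroup F] [NormedSpace ℝ F] [FiniteDimensional ℝ F]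
  {V : M → Type*} [TopologicalSpace (TotalSpace F V)]
  [∀ x, AddCommGroup (V x)] [∀ x, Module ℝ (V x)] [∀ x, TopologicalSpace (V x)]
  [FiberBundle F V] [VectorBundle ℝ F V] [ContMDiffVectorBundle ∞ F V I]

variable [T2Space M] [SecondCountableTopology M] [CompactSpace M] {X : ℝ → VF I M}
  {κ : Type*} [Fintype κ] {s : κ → Sec I F V} {ξ : κ → ∀ x : M, V x →ₗ[ℝ] ℝ}
  {D : ℝ → Sec I F V →ₗ[ℝ] Sec I F V} {ι : Type*} [Fintype ι]

theorem DerivationFamily.smoothFun_transportMatrix (hD : DerivationFamily J D X)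
    (hfr : FrameOn (univ : Set M) s ξ) : SmoothFun I J fun p : ℝ × M =>
      ((fun k l => hfr.transportMatrix D X p.1 p.2 k l : κ → κ → ℝ)) := by
  refine contMDiffOn_pi_space.2 fun k => contMDiffOn_pi_space.2 fun l => ?_
  have h1 : ∀ f : Fun I M, SmoothFun I J fun p : ℝ × M => f p.2 := fun f =>
    f.contMDiff.comp_contMDiffOn contMDiffOn_snd
  have h2 : SmoothFun I J fun p : ℝ × M => hfr.conn D p.1 p.2 k l :=
    (hD.smooth (s k)).coeff (hfr.smooth l)
  refine ContMDiffOn.sub (contMDiffOn_finsetSum fun j _ => ?_) h2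
  exact (h1 (coeffFun (hfr.smooth j) (s k))).mul (hD.smoothVF (coeffFun (hfr.smooth l) (s j)))

/-- `f` is a field on the ambient space which restricts to the equations of parallel transport. -/
structure ChartCover.IsTransportField (K : ChartCover I M ι) (hfr : FrameOn (univ : Set M) s ξ)
    (J : Set ℝ) (D : ℝ → Sec I F V →ₗ[ℝ] Sec I F V) (X : ℝ → VF I M)
    (X' : ℝ → (ι → E × ℝ) → (ι → E × ℝ))
    (f : ℝ → (ι → E × ℝ) × (κ → ℝ) → (ι → E × ℝ) × (κ → ℝ)) : Prop where
  extends_base : K.Extends J X X'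
  locLip_base : LocLip J X'
  fst_apply : ∀ t q, (f t q).1 = X' t q.1
  snd_apply : ∀ t x c, (f t (K.y x, c)).2 = Matrix.vecMul c (hfr.transportMatrix D X t x)
  contDiffOn : ContDiffOn ℝ ∞ (fun p : ℝ × ((ι → E × ℝ) × (κ → ℝ)) => f p.1 p.2) (J ×ˢ univ)
  linearGrowth : LinearGrowth J f

theorem DerivationFamily.exists_isTransportField (hD : DerivationFamily J D X)
    (K : ChartCover I M ι) (hfr : FrameOn (univ : Set M) s ξ) (hJ : J.OrdConnected)
    (hJ' : J.Nontrivial) : ∃ X' f, K.IsTransportField hfr J D X X' f := by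
  obtain ⟨X', hX', hXy, hXb⟩ := K.exists_extension (hD.smoothVF.mvfderiv K.contMDiff_y)
  obtain ⟨N', hN', hNy, hNb⟩ := K.exists_extension (hD.smoothFun_transportMatrix hfr)
  have hloc : LocLip J fun t Y => X' (t, Y) :=
    locLip_of_contDiffOn hJ hJ' (hX'.of_le (by exact_mod_cast le_top))
  refine ⟨fun t Y => X' (t, Y),
    fun t q => (X' (t, q.1), fun l => ∑ k, q.2 k * N' (t, q.1) k l),
    fun t _ x => hXy t x, hloc, fun t q => rfl, fun t x c => ?_, ?_, ?_⟩
  · funext l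
    simp only [hNy]
    rfl
  · have hm : MapsTo (fun p : ℝ × ((ι → E × ℝ) × (κ → ℝ)) => (p.1, p.2.1)) (J ×ˢ univ)
        (J ×ˢ univ) := fun p hp => ⟨hp.1, trivial⟩
    have hp : ContDiff ℝ ∞ fun p : ℝ × ((ι → E × ℝ) × (κ → ℝ)) => (p.1, p.2.1) := by fun_prop
    refine (hX'.comp hp.contDiffOn hm).prodMk (contDiffOn_pi.2 fun l =>
      ContDiffOn.sum fun k _ => ContDiffOn.mul ?_ ?_)
    · have : ContDiff ℝ ∞ fun p : ℝ × ((ι → E × ℝ) × (κ → ℝ)) => p.2.2 k := by fun_prop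
      exact this.contDiffOn
    · exact contDiffOn_pi.1 (contDiffOn_pi.1 (hN'.comp hp.contDiffOn hm) k) l
  · intro a ha b hb
    obtain ⟨C₁, hC₁, h₁⟩ := hXb a b (hJ.out ha hb)
    obtain ⟨C₂, hC₂, h₂⟩ := hNb a b (hJ.out ha hb)
    refine ⟨C₁ + Fintype.card κ * C₂, fun t ht q => ?_⟩
    have e1 : ‖X' (t, q.1)‖ ≤ C₁ := h₁ t ht q.1
    have e2 : ‖fun l => ∑ k, q.2 k * N' (t, q.1) k l‖ ≤ Fintype.card κ * C₂ * ‖q‖ := by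
      refine (pi_norm_le_iff_of_nonneg (by positivity)).2 fun l => ?_
      refine (norm_sum_le _ _).trans ?_
      have : ∀ k ∈ (Finset.univ : Finset κ), ‖q.2 k * N' (t, q.1) k l‖ ≤ C₂ * ‖q‖ := fun k _ => by
        rw [norm_mul, mul_comm]
        refine mul_le_mul (((norm_le_pi_norm _ l).trans (norm_le_pi_norm _ k)).trans
          (h₂ t ht q.1)) ((norm_le_pi_norm _ k).trans (norm_snd_le q)) (norm_nonneg _) hC₂
      refine (Finset.sum_le_card_nsmul _ _ _ this).trans ?_
      simp [mul_assoc]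
    have hq := norm_nonneg q
    have hκ : (0 : ℝ) ≤ Fintype.card κ * C₂ := by positivity
    rw [Prod.norm_mk]
    refine max_le ?_ ?_
    · nlinarith [mul_nonneg hC₁ hq, mul_nonneg hκ hq]
    · nlinarith [mul_nonneg hC₁ hq, mul_nonneg hκ hq]

/-- The curve `c` of coefficients along `γ` solves the equation of parallel transport. -/
def FrameOn.IsParallel (hfr : FrameOn (univ : Set M) s ξ) (J : Set ℝ)
    (D : ℝ → Sec I F V →ₗ[ℝ] Sec I F V) (X : ℝ → VF I M) (γ : ℝ → M) (c : ℝ → κ → ℝ) : Prop :=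
  ∀ t ∈ J, HasDerivWithinAt c (Matrix.vecMul (c t) (hfr.transportMatrix D X t (γ t))) J t

namespace ChartCover.IsTransportField

variable {K : ChartCover I M ι} {hfr : FrameOn (univ : Set M) s ξ}
  {X' : ℝ → (ι → E × ℝ) → (ι → E × ℝ)}
  {f : ℝ → (ι → E × ℝ) × (κ → ℝ) → (ι → E × ℝ) × (κ → ℝ)}

theorem locLip (hf : K.IsTransportField hfr J D X X' f) (hJ : J.OrdConnected)
    (hJ' : J.Nontrivial) : LocLip J f :=
  locLip_of_contDiffOn hJ hJ' (hf.contDiffOn.of_le (by exact_mod_cast le_top))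

theorem isIntegralCurveOn (hf : K.IsTransportField hfr J D X X' f) {γ : ℝ → M}
    (hγ : IsWeakCurve J X γ) {c : ℝ → κ → ℝ} (hc : hfr.IsParallel J D X γ c) :
    IsIntegralCurveOn (fun t => (K.y (γ t), c t)) f J := fun t ht => by
  have h1 := hf.extends_base.isIntegralCurveOn subset_rfl hγ t ht
  have h2 := h1.prodMk (hc t ht)
  have e : f t (K.y (γ t), c t) = (X' t (K.y (γ t)),
      Matrix.vecMul (c t) (hfr.transportMatrix D X t (γ t))) :=
    Prod.ext (hf.fst_apply _ _) (hf.snd_apply _ _ _)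
  change HasDerivWithinAt _ (f t (K.y (γ t), c t)) J t
  rw [e]
  exact h2

theorem eq_of_isParallel (hf : K.IsTransportField hfr J D X X' f) (hJ : J.OrdConnected)
    (hJ' : J.Nontrivial) {γ γ₁ : ℝ → M} {c c₁ : ℝ → κ → ℝ} (hγ : IsWeakCurve J X γ)
    (hγ₁ : IsWeakCurve J X γ₁) (hc : hfr.IsParallel J D X γ c) (hc₁ : hfr.IsParallel J D X γ₁ c₁)
    {t₀ : ℝ} (ht₀ : t₀ ∈ J) (h : γ t₀ = γ₁ t₀) (h' : c t₀ = c₁ t₀) {t : ℝ} (ht : t ∈ J) :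
    γ t = γ₁ t ∧ c t = c₁ t := by
  have h1 := (hf.locLip hJ hJ').eq_of_isIntegralCurveOn hJ (hf.isIntegralCurveOn hγ hc)
    (hf.isIntegralCurveOn hγ₁ hc₁) ht₀ (by simp [h, h']) ht
  exact ⟨K.y_injective (congrArg Prod.fst h1), congrArg Prod.snd h1⟩

theorem isIntegralCurveOn_fst (hf : K.IsTransportField hfr J D X X' f) {t₀ : ℝ}
    {Φ : ℝ → (ι → E × ℝ) × (κ → ℝ) → (ι → E × ℝ) × (κ → ℝ)} (hΦ : IsFlow J t₀ f Φ)
    (q : (ι → E × ℝ) × (κ → ℝ)) : IsIntegralCurveOn (fun t => (Φ t q).1) X' J := fun t ht => by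
  have h1 := (hasFDerivAt_fst (𝕜 := ℝ) (p := Φ t q)).comp_hasDerivWithinAt t (hΦ.curve q t ht)
  rw [ContinuousLinearMap.coe_fst', hf.fst_apply] at h1
  exact h1

theorem exists_isWeakCurve (hf : K.IsTransportField hfr J D X X' f) (hD : DerivationFamily J D X)
    (hJ : J.OrdConnected) (hJ' : J.Nontrivial) {t₀ : ℝ} (ht₀ : t₀ ∈ J)
    {Φ : ℝ → (ι → E × ℝ) × (κ → ℝ) → (ι → E × ℝ) × (κ → ℝ)} (hΦ : IsFlow J t₀ f Φ) (x : M) :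
    ∃ γ : ℝ → M, γ t₀ = x ∧ IsWeakCurve J X γ := by
  obtain ⟨γ, h1, h2, -⟩ := hf.extends_base.exists_isWeakCurve K hD.smoothVF hJ hJ'
    hf.locLip_base (hf.isIntegralCurveOn_fst hΦ (K.y x, 0)) ht₀ (x₀ := x) (by simp only [hΦ.init])
  exact ⟨γ, h1, h2⟩

theorem exists_parallel (hf : K.IsTransportField hfr J D X X' f) (hD : DerivationFamily J D X)
    (hJ : J.OrdConnected) (hJ' : J.Nontrivial) {t₀ : ℝ} (ht₀ : t₀ ∈ J)
    {Φ : ℝ → (ι → E × ℝ) × (κ → ℝ) → (ι → E × ℝ) × (κ → ℝ)} (hΦ : IsFlow J t₀ f Φ) {x : M}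
    {γ : ℝ → M} (hγ0 : γ t₀ = x) (hγ : IsWeakCurve J X γ) (v : V x) : ∃ w : ∀ t, V (γ t),
      coeffs ξ (w t₀) = coeffs ξ v ∧ hfr.IsParallel J D X γ (fun t => coeffs ξ (w t)) ∧
      ∀ t ∈ J, (K.y (γ t), coeffs ξ (w t)) = Φ t (K.y x, coeffs ξ v) := by
  set q : (ι → E × ℝ) × (κ → ℝ) := (K.y x, coeffs ξ v)
  have hint := hΦ.curve q
  have hzγ : ∀ t ∈ J, (Φ t q).1 = K.y (γ t) := fun t ht =>
    hf.locLip_base.eq_of_isIntegralCurveOn hJ (hf.isIntegralCurveOn_fst hΦ q)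
      (hf.extends_base.isIntegralCurveOn subset_rfl hγ) ht₀ (by simp only [hΦ.init, hγ0]; rfl) ht
  set c : ℝ → κ → ℝ := fun t => (Φ t q).2
  have hq : ∀ t ∈ J, Φ t q = (K.y (γ t), c t) := fun t ht => Prod.ext (hzγ t ht) rfl
  have hc : hfr.IsParallel J D X γ c := fun t ht => by
    have h1 := (hasFDerivAt_snd (𝕜 := ℝ) (p := Φ t q)).comp_hasDerivWithinAt t (hint t ht)
    simp only [ContinuousLinearMap.coe_snd', hq t ht, hf.snd_apply] at h1
    exact h1
  set c₁ : ℝ → κ → ℝ := fun t => Matrix.vecMul (c t) (hfr.proj (γ t))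
  have hc₁ : hfr.IsParallel J D X γ c₁ := fun t ht => by
    have h1 : HasDerivWithinAt c₁ (Matrix.vecMul
        (Matrix.vecMul (c t) (hfr.transportMatrix D X t (γ t))) (hfr.proj (γ t)) +
        Matrix.vecMul (c t) (hfr.dproj X t (γ t))) J t := by
      refine hasDerivWithinAt_pi.2 fun l => ?_
      have h2 : ∀ k, HasDerivWithinAt (fun r => c r k * hfr.proj (γ r) k l)
          (Matrix.vecMul (c t) (hfr.transportMatrix D X t (γ t)) k * hfr.proj (γ t) k l +
            c t k * hfr.dproj X t (γ t) k l) J t := fun k =>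
        (hasDerivWithinAt_pi.1 (hc t ht) k).mul (hγ (coeffFun (hfr.smooth l) (s k)) t ht)
      have h3 := HasDerivWithinAt.fun_sum fun k (_ : k ∈ Finset.univ) => h2 k
      rw [Finset.sum_add_distrib] at h3
      exact h3
    rw [Matrix.vecMul_vecMul, ← Matrix.vecMul_add, hD.proj_mul_transportMatrix hfr ht,
      ← Matrix.vecMul_vecMul] at h1
    exact h1
  have h0 : c t₀ = coeffs ξ v := by
    simp only [c, hΦ.init]
    rfl
  have h0' : c₁ t₀ = c t₀ := by
    simp only [c₁, h0, hγ0]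
    exact hfr.coeffs_vecMul_proj v
  have hcc : ∀ t ∈ J, c₁ t = c t := fun t ht =>
    (hf.eq_of_isParallel hJ hJ' hγ hγ hc₁ hc ht₀ rfl h0' ht).2
  have hw : ∀ t, coeffs ξ (∑ k, c t k • s k (γ t)) = c₁ t := fun t => hfr.coeffs_sum (c t)
  refine ⟨fun t => ∑ k, c t k • s k (γ t), ?_, ?_, fun t ht => ?_⟩
  · rw [hw, h0', h0]
  · simp only [hw]
    exact hc₁
  · rw [hw, hcc t ht, hq t ht]

end ChartCover.IsTransportField

end Transport

section TransportMaps

variable {E : Type*} [NormedAddCommGroup E] [NormedSpace ℝ E] [FiniteDimensional ℝ E]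
  {H : Type*} [TopologicalSpace H] {I : ModelWithCorners ℝ E H} [I.Boundaryless]
  {M : Type*} [TopologicalSpace M] [ChartedSpace H M] [IsManifold I ∞ M]
  {J : Set ℝ}

variable {F : Type*} [NormedAddCommGroup F] [NormedSpace ℝ F] [FiniteDimensional ℝ F]
  {V : M → Type*} [TopologicalSpace (TotalSpace F V)]
  [∀ x, AddCommGroup (V x)] [∀ x, Module ℝ (V x)] [∀ x, TopologicalSpace (V x)]
  [FiberBundle F V] [VectorBundle ℝ F V] [ContMDiffVectorBundle ∞ F V I]

variable [T2Space M] [SecondCountableTopology M] [CompactSpace M] {X : ℝ → VF I M}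
  {κ : Type*} [Fintype κ] {s : κ → Sec I F V} {ξ : κ → ∀ x : M, V x →ₗ[ℝ] ℝ}
  {D : ℝ → Sec I F V →ₗ[ℝ] Sec I F V}

theorem DerivationFamily.hasDerivWithinAt_coeffs (hD : DerivationFamily J D X)
    (hfr : FrameOn (univ : Set M) s ξ) (hJ : J.OrdConnected) (hJ' : J.Nontrivial) {γ : ℝ → M}
    (hγ : IsWeakCurve J X γ) {d : ℝ → Sec I F V} (hd : SmoothFam I F J fun t x => d t x) {t : ℝ}
    (ht : t ∈ J) : HasDerivWithinAt (fun r => coeffs ξ (d r (γ r)))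
      ((fun l => tderiv J (fun p : ℝ × M => ξ l p.2 (d p.1 p.2)) (t, γ t)) +
        (coeffs ξ (D t (d t) (γ t)) +
          Matrix.vecMul (coeffs ξ (d t (γ t))) (hfr.transportMatrix D X t (γ t)))) J t := by
  rw [← hD.mvfderiv_coeffs hfr ht (d t) (γ t)]
  exact hasDerivWithinAt_pi.2 fun l =>
    hγ.hasDerivWithinAt_smoothFun hJ hJ' (hd.coeff (hfr.smooth l)) ht

theorem FrameOn.mk_eq_mk (hfr : FrameOn (univ : Set M) s ξ) {x y : M} (h : x = y) {v : V x}
    {w : V y} (hc : coeffs ξ v = coeffs ξ w) : (⟨x, v⟩ : TotalSpace F V) = ⟨y, w⟩ := by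
  subst h
  rw [hfr.eq_of_coeffs_eq hc]

/-- `L r t` is the parallel transport from time `t` to time `r` of the equation `a' = -D a`,
covering the flow `B r t` of the symbol of `D`. -/
structure IsTransport (J : Set ℝ) (D : ℝ → Sec I F V →ₗ[ℝ] Sec I F V) (B : ℝ → ℝ → M → M)
    (L : ∀ (r t : ℝ) (x : M), V x →ₗ[ℝ] V (B r t x)) : Prop where
  mk_self : ∀ t ∈ J, ∀ x v, (⟨B t t x, L t t x v⟩ : TotalSpace F V) = ⟨x, v⟩
  mk_comp : ∀ q ∈ J, ∀ r ∈ J, ∀ t ∈ J, ∀ x v,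
    (⟨B q r (B r t x), L q r (B r t x) (L r t x v)⟩ : TotalSpace F V) = ⟨B q t x, L q t x v⟩
  smooth : ∀ t ∈ J, ContMDiffOn (𝓘(ℝ, ℝ).prod (I.prod 𝓘(ℝ, F))) (I.prod 𝓘(ℝ, F)) ∞
    (fun p : ℝ × TotalSpace F V =>
      (⟨B p.1 t p.2.1, L p.1 t p.2.1 p.2.2⟩ : TotalSpace F V)) (J ×ˢ univ)
  apply_of_wderiv : ∀ d : ℝ → Sec I F V, SmoothFam I F J (fun t x => d t x) →
    (∀ t ∈ J, ∀ x, WDeriv J t (fun r => d r x) (-(D t (d t) x))) →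
    ∀ r ∈ J, ∀ t ∈ J, ∀ x, d r (B r t x) = L r t x (d t x)
  wderiv_of_apply : ∀ d : ℝ → Sec I F V, SmoothFam I F J (fun t x => d t x) → ∀ t₀ ∈ J,
    (∀ r ∈ J, ∀ x, d r (B r t₀ x) = L r t₀ x (d t₀ x)) →
    ∀ t ∈ J, ∀ x, WDeriv J t (fun r => d r x) (-(D t (d t) x))

theorem DerivationFamily.exists_isTransport (hD : DerivationFamily J D X) (hJ : J.OrdConnected)
    (hJ' : J.Nontrivial) : ∃ B L, IsTransport (I := I) (F := F) (V := V) J D B L := by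
  obtain ⟨n, s, ξ, hfr⟩ := exists_globalFrame (I := I) (F := F) (V := V)
  obtain ⟨T, ⟨K⟩⟩ := exists_chartCover (I := I) (M := M)
  obtain ⟨X', f, hf⟩ := hD.exists_isTransportField K hfr hJ hJ'
  have hΦ : ∀ t, ∃ Φ, t ∈ J → IsFlow J t f Φ := fun t => by
    by_cases ht : t ∈ J
    · obtain ⟨Φ, h⟩ := exists_isFlow hJ hJ' ht hf.contDiffOn hf.linearGrowth
      exact ⟨Φ, fun _ => h⟩
    · exact ⟨fun _ x => x, fun h => absurd h ht⟩
  choose Φ hΦ using hΦ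
  have hβ : ∀ t x, ∃ γ : ℝ → M, t ∈ J → γ t = x ∧ IsWeakCurve J X γ := fun t x => by
    by_cases ht : t ∈ J
    · obtain ⟨γ, h⟩ := hf.exists_isWeakCurve hD hJ hJ' ht (hΦ t ht) x
      exact ⟨γ, fun _ => h⟩
    · exact ⟨fun _ => x, fun h => absurd h ht⟩
  choose β hβ using hβ
  have hw : ∀ t x (v : V x), ∃ w : ∀ r, V (β t x r), t ∈ J → coeffs ξ (w t) = coeffs ξ v ∧
      hfr.IsParallel J D X (β t x) (fun r => coeffs ξ (w r)) ∧
      ∀ r ∈ J, (K.y (β t x r), coeffs ξ (w r)) = Φ t r (K.y x, coeffs ξ v) := fun t x v => by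
    by_cases ht : t ∈ J
    · obtain ⟨w, h⟩ := hf.exists_parallel hD hJ hJ' ht (hΦ t ht) (hβ t x ht).1 (hβ t x ht).2 v
      exact ⟨w, fun _ => h⟩
    · exact ⟨fun _ => 0, fun h => absurd h ht⟩
  choose w hw using hw
  have hL : ∀ r t x, ∃ L : V x →ₗ[ℝ] V (β t x r), r ∈ J → t ∈ J → ∀ v, L v = w t x v r := by
    intro r t x
    by_cases h : r ∈ J ∧ t ∈ J
    · obtain ⟨hr, ht⟩ := h
      refine ⟨⟨⟨fun v => w t x v r, fun v v' => ?_⟩, fun a v => ?_⟩, fun _ _ _ => rfl⟩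
      · refine hfr.eq_of_coeffs_eq ?_
        have e : coeffs ξ (w t x v r + w t x v' r) =
            coeffs ξ (w t x v r) + coeffs ξ (w t x v' r) := by
          ext l; simp [coeffs]
        rw [e]
        refine (hf.eq_of_isParallel hJ hJ' (hβ t x ht).2 (hβ t x ht).2 (hw t x (v + v') ht).2.1
          (c₁ := fun r => coeffs ξ (w t x v r) + coeffs ξ (w t x v' r)) (fun q hq => ?_) ht rfl
          ?_ hr).2
        · rw [Matrix.add_vecMul]
          exact ((hw t x v ht).2.1 q hq).add ((hw t x v' ht).2.1 q hq)
        · simp only [(hw t x _ ht).1]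
          ext l; simp [coeffs]
      · refine hfr.eq_of_coeffs_eq ?_
        have e : coeffs ξ (a • w t x v r) = a • coeffs ξ (w t x v r) := by
          ext l; simp [coeffs]
        simp only [RingHom.id_apply]
        rw [e]
        refine (hf.eq_of_isParallel hJ hJ' (hβ t x ht).2 (hβ t x ht).2 (hw t x (a • v) ht).2.1
          (c₁ := fun r => a • coeffs ξ (w t x v r)) (fun q hq => ?_) ht rfl
          ?_ hr).2
        · rw [Matrix.smul_vecMul]
          exact ((hw t x v ht).2.1 q hq).const_smul a
        · simp only [(hw t x _ ht).1]
          ext l; simp [coeffs]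
    · exact ⟨0, fun hr ht => absurd ⟨hr, ht⟩ h⟩
  choose L hL using hL
  have hself : ∀ t ∈ J, ∀ x v, (⟨β t x t, L t t x v⟩ : TotalSpace F V) = ⟨x, v⟩ :=
    fun t ht x v => by
      rw [hL t t x ht ht]
      exact hfr.mk_eq_mk (hβ t x ht).1 (hw t x v ht).1
  have hcomp : ∀ q ∈ J, ∀ r ∈ J, ∀ t ∈ J, ∀ x v,
      (⟨β r (β t x r) q, L q r (β t x r) (L r t x v)⟩ : TotalSpace F V) =
        ⟨β t x q, L q t x v⟩ := by
    intro q hq r hr t ht x v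
    rw [hL q r _ hq hr, hL r t _ hr ht, hL q t _ hq ht]
    have h1 := hf.eq_of_isParallel hJ hJ' (hβ r (β t x r) hr).2 (hβ t x ht).2
      (hw r (β t x r) (w t x v r) hr).2.1 (hw t x v ht).2.1 hr (hβ r _ hr).1
      (hw r (β t x r) (w t x v r) hr).1 hq
    exact hfr.mk_eq_mk h1.1 h1.2
  have hder : ∀ d : ℝ → Sec I F V, SmoothFam I F J (fun t x => d t x) → ∀ t ∈ J, ∀ x l,
      HasDerivWithinAt (fun r => ξ l x (d r x))
        (tderiv J (fun p : ℝ × M => ξ l p.2 (d p.1 p.2)) (t, x)) J t := fun d hd t ht x l =>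
    (hd.coeff (hfr.smooth l)).hasDerivWithinAt hJ hJ' ht x
  refine ⟨fun r t x => β t x r, L, hself, hcomp, fun t ht => ?_, fun d hd hd' r hr t ht x => ?_,
    fun d hd t₀ ht₀ h t ht x => ?_⟩
  · have hcoe : ContMDiff (I.prod 𝓘(ℝ, F)) 𝓘(ℝ, (T → E × ℝ) × (Fin n → ℝ)) ∞
        fun p : TotalSpace F V => (K.y p.1, coeffs ξ p.2) :=
      (K.contMDiff_y.comp (contMDiff_proj V)).prodMk_space
        (contMDiff_pi_space.2 fun k => hfr.smooth k)
    have h1 : ContMDiffOn (𝓘(ℝ, ℝ).prod (I.prod 𝓘(ℝ, F))) 𝓘(ℝ, (T → E × ℝ) × (Fin n → ℝ)) ∞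
        (fun p : ℝ × TotalSpace F V => Φ t p.1 (K.y p.2.1, coeffs ξ p.2.2)) (J ×ˢ univ) :=
      ((hΦ t ht).contDiffOn hJ hJ' ht hf.contDiffOn).contMDiffOn.comp
        (contMDiff_fst.prodMk_space (hcoe.comp contMDiff_snd)).contMDiffOn
        fun p hp => ⟨hp.1, trivial⟩
    have h2 : ContMDiffOn (𝓘(ℝ, ℝ).prod (I.prod 𝓘(ℝ, F))) 𝓘(ℝ, (T → E × ℝ) × (Fin n → ℝ)) ∞
        (fun p : ℝ × TotalSpace F V => (K.y (β t p.2.1 p.1), coeffs ξ (L p.1 t p.2.1 p.2.2)))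
        (J ×ˢ univ) := h1.congr fun p hp => by
      rw [hL p.1 t _ hp.1 ht]
      exact (hw t p.2.1 p.2.2 ht).2.2 p.1 hp.1
    intro p hp
    refine hfr.contMDiffWithinAt univ_mem (K.contMDiffWithinAt_of_y ?_) fun k => ?_
    · exact (contDiff_fst (𝕜 := ℝ)).contMDiff.contMDiffAt.comp_contMDiffWithinAt p (h2 p hp)
    · exact contMDiffWithinAt_pi_space.1
        ((contDiff_snd (𝕜 := ℝ)).contMDiff.contMDiffAt.comp_contMDiffWithinAt p (h2 p hp)) k
  · have h1 : hfr.IsParallel J D X (β t x) (fun r => coeffs ξ (d r (β t x r))) := fun q hq => by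
      have h2 := hD.hasDerivWithinAt_coeffs hfr hJ hJ' (hβ t x ht).2 hd hq
      convert h2 using 1
      have h3 : (fun l => tderiv J (fun p : ℝ × M => ξ l p.2 (d p.1 p.2)) (q, β t x q)) =
          -coeffs ξ (D q (d q) (β t x q)) := by
        funext l
        refine (uniqueDiffOn_of_ordConnected hJ hJ' q hq).eq_deriv _ (hder d hd q hq _ l) ?_
        have h4 := hd' q hq (β t x q) (ξ l _)
        rw [map_neg] at h4
        exact h4
      rw [h3]
      abel
    rw [hL r t x hr ht]
    refine hfr.eq_of_coeffs_eq ?_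
    refine (hf.eq_of_isParallel hJ hJ' (hβ t x ht).2 (hβ t x ht).2 h1 (hw t x _ ht).2.1 ht rfl
      ?_ hr).2
    rw [(hw t x _ ht).1, (hβ t x ht).1]
  · obtain ⟨x₁, rfl⟩ : ∃ x₁, x = β t₀ x₁ t := ⟨β t x t₀,
      ((congrArg TotalSpace.proj (hcomp t ht t₀ ht₀ t ht x 0)).trans
        (congrArg TotalSpace.proj (hself t ht x 0))).symm⟩
    have h1 := hD.hasDerivWithinAt_coeffs hfr hJ hJ' (hβ t₀ x₁ ht₀).2 hd ht
    have h2 : HasDerivWithinAt (fun r => coeffs ξ (w t₀ x₁ (d t₀ x₁) r))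
      (Matrix.vecMul (coeffs ξ (w t₀ x₁ (d t₀ x₁) t))
        (hfr.transportMatrix D X t (β t₀ x₁ t))) J t := (hw t₀ x₁ (d t₀ x₁) ht₀).2.1 t ht
    have h3 : ∀ r ∈ J, coeffs ξ (d r (β t₀ x₁ r)) = coeffs ξ (w t₀ x₁ (d t₀ x₁) r) :=
      fun r hr => by rw [h r hr x₁, hL r t₀ x₁ hr ht₀]
    have h4 := (uniqueDiffOn_of_ordConnected hJ hJ' t ht).eq_deriv _ h1
      (h2.congr (fun r hr => h3 r hr) (h3 t ht))
    rw [← h3 t ht, ← add_assoc, add_eq_right] at h4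
    intro φ
    have e : ∀ v : V (β t₀ x₁ t), φ v = ∑ k, ξ k _ v * φ (s k _) := fun v => by
      conv_lhs => rw [← hfr.sum _ trivial v]
      simp
    have h5 : ∀ l, HasDerivWithinAt (fun r => ξ l (β t₀ x₁ t) (d r (β t₀ x₁ t)))
        (ξ l _ (-(D t (d t) (β t₀ x₁ t)))) J t := fun l => by
      have h6 := hder d hd t ht (β t₀ x₁ t) l
      have h7 := congrFun h4 l
      have h8 : ξ l _ (-(D t (d t) (β t₀ x₁ t))) =
          tderiv J (fun p : ℝ × M => ξ l p.2 (d p.1 p.2)) (t, β t₀ x₁ t) := by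
        rw [map_neg]
        exact neg_eq_of_add_eq_zero_left h7
      rw [h8]
      exact h6
    have h9 := HasDerivWithinAt.fun_sum fun l (_ : l ∈ Finset.univ) =>
      (h5 l).mul_const (φ (s l (β t₀ x₁ t)))
    rw [e (-_)]
    exact h9.congr (fun r _ => e _) (e _)

end TransportMaps

section TransportAutomorphisms

variable {E : Type*} [NormedAddCommGroup E] [NormedSpace ℝ E] [FiniteDimensional ℝ E]
  {H : Type*} [TopologicalSpace H] {I : ModelWithCorners ℝ E H} [I.Boundaryless]
  {M : Type*} [TopologicalSpace M] [ChartedSpace H M] [IsManifold I ∞ M]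
  {J : Set ℝ}

variable {F : Type*} [NormedAddCommGroup F] [NormedSpace ℝ F] [FiniteDimensional ℝ F]
  {V : M → Type*} [TopologicalSpace (TotalSpace F V)]
  [∀ x, AddCommGroup (V x)] [∀ x, Module ℝ (V x)] [∀ x, TopologicalSpace (V x)]
  [FiberBundle F V] [VectorBundle ℝ F V] [ContMDiffVectorBundle ∞ F V I]

variable {X : ℝ → VF I M} {D : ℝ → Sec I F V →ₗ[ℝ] Sec I F V} {B : ℝ → ℝ → M → M}
  {L : ∀ (r t : ℝ) (x : M), V x →ₗ[ℝ] V (B r t x)}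

namespace IsTransport

theorem base_comp (hT : IsTransport (I := I) (F := F) (V := V) J D B L) {r t : ℝ} (hr : r ∈ J)
    (ht : t ∈ J) (x : M) : B t r (B r t x) = x :=
  (congrArg TotalSpace.proj (hT.mk_comp t ht r hr t ht x 0)).trans
    (congrArg TotalSpace.proj (hT.mk_self t ht x 0))

theorem contMDiff_mk (hT : IsTransport (I := I) (F := F) (V := V) J D B L) {r t : ℝ} (hr : r ∈ J)
    (ht : t ∈ J) : ContMDiff (I.prod 𝓘(ℝ, F)) (I.prod 𝓘(ℝ, F)) ∞
      (fun p : TotalSpace F V => (⟨B r t p.1, L r t p.1 p.2⟩ : TotalSpace F V)) :=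
  contMDiffOn_univ.1 ((hT.smooth t ht).comp (contMDiff_const.prodMk contMDiff_id).contMDiffOn
    fun _ _ => ⟨hr, trivial⟩)

theorem contMDiff_base (hT : IsTransport (I := I) (F := F) (V := V) J D B L) {r t : ℝ} (hr : r ∈ J)
    (ht : t ∈ J) : ContMDiff I I ∞ (B r t) :=
  (contMDiff_proj V).comp ((hT.contMDiff_mk hr ht).comp (0 : Sec I F V).contMDiff)

/-- The transport maps as automorphisms of the vector bundle. -/
def bundleAut (hT : IsTransport (I := I) (F := F) (V := V) J D B L) {r t : ℝ} (hr : r ∈ J)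
    (ht : t ∈ J) : BundleAut I F V where
  base :=
    { toFun := B r t
      invFun := B t r
      left_inv := hT.base_comp hr ht
      right_inv := hT.base_comp ht hr
      contMDiff_toFun := hT.contMDiff_base hr ht
      contMDiff_invFun := hT.contMDiff_base ht hr }
  total :=
    { toFun := fun p => ⟨B r t p.1, L r t p.1 p.2⟩
      invFun := fun p => ⟨B t r p.1, L t r p.1 p.2⟩
      left_inv := fun p => (hT.mk_comp t ht r hr t ht p.1 p.2).trans (hT.mk_self t ht p.1 p.2)
      right_inv := fun p => (hT.mk_comp r hr t ht r hr p.1 p.2).trans (hT.mk_self r hr p.1 p.2)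
      contMDiff_toFun := hT.contMDiff_mk hr ht
      contMDiff_invFun := hT.contMDiff_mk ht hr }
  fiber := L r t
  total_mk _ _ := rfl

end IsTransport

theorem BundleAut.isPushforward_of_total_mk {h : BundleAut I F V} {α α' : Sec I F V} {y : M → M}
    (H : ∀ x, h.total ⟨x, α x⟩ = ⟨y x, α' (y x)⟩) : h.IsPushforward α α' := fun x => by
  have h1 := H x
  rw [h.total_mk] at h1
  generalize y x = z at h1
  obtain rfl : h.base x = z := congrArg TotalSpace.proj h1
  simpa using h1.symm

variable [T2Space M] [SecondCountableTopology M]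

theorem DerivationFamily.exists_bundleAut [CompactSpace M] (hD : DerivationFamily J D X)
    (hJ : J.OrdConnected) (hJ' : J.Nontrivial) {t₀ : ℝ} (ht₀ : t₀ ∈ J) :
    ∃ h : ℝ → BundleAut I F V,
      ContMDiffOn (𝓘(ℝ, ℝ).prod (I.prod 𝓘(ℝ, F))) (I.prod 𝓘(ℝ, F)) ∞
        (fun p : ℝ × TotalSpace F V => (h p.1).total p.2) (J ×ˢ univ) ∧
      (∀ d : ℝ → Sec I F V, SmoothFam I F J (fun t x => d t x) →
        (∀ t ∈ J, ∀ x, WDeriv J t (fun r => d r x) (-(D t (d t) x))) →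
        ∀ t ∈ J, (h t).IsPushforward (d t) (d t₀)) ∧
      ∀ a : Sec I F V, ∃ d : ℝ → Sec I F V, SmoothFam I F J (fun t x => d t x) ∧
        (∀ t ∈ J, ∀ x, WDeriv J t (fun r => d r x) (-(D t (d t) x))) ∧ d t₀ = a := by
  classical
  obtain ⟨B, L, hT⟩ := hD.exists_isTransport hJ hJ'
  set k : ℝ → BundleAut I F V := fun r =>
    if hr : r ∈ J then hT.bundleAut hr ht₀ else hT.bundleAut ht₀ ht₀
  set h : ℝ → BundleAut I F V := fun r =>
    if hr : r ∈ J then hT.bundleAut ht₀ hr else hT.bundleAut ht₀ ht₀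
  have hk : ∀ r (hr : r ∈ J), k r = hT.bundleAut hr ht₀ := fun r hr => dif_pos hr
  have hh : ∀ r (hr : r ∈ J), h r = hT.bundleAut ht₀ hr := fun r hr => dif_pos hr
  have hks : ContMDiffOn (𝓘(ℝ, ℝ).prod (I.prod 𝓘(ℝ, F))) (I.prod 𝓘(ℝ, F)) ∞
      (fun p : ℝ × TotalSpace F V => (k p.1).total p.2) (J ×ˢ univ) :=
    (hT.smooth t₀ ht₀).congr fun p hp => by rw [hk p.1 hp.1]; rfl
  have h0 : ∀ a, (k t₀).push a = a := fun a => by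
    refine (BundleAut.IsPushforward.eq_push
      (BundleAut.isPushforward_of_total_mk (y := id) fun x => ?_)).symm
    rw [hk t₀ ht₀]
    exact hT.mk_self t₀ ht₀ x (a x)
  have hsm : ∀ a, SmoothFam I F J fun t x => (k t).push a x := fun a =>
    smoothFam_push hks hJ hJ' (β := fun _ => a)
      (a.contMDiff.comp_contMDiffOn contMDiffOn_snd)
  refine ⟨h, ?_, fun d hd hd' t ht => ?_, fun a => ⟨fun t => (k t).push a, hsm a,
    hT.wderiv_of_apply _ (hsm a) t₀ ht₀ fun r hr x => ?_, h0 a⟩⟩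
  · refine (contMDiffOn_symm hJ hJ' (h := fun t => (k t).total) hks).congr fun p hp => ?_
    simp only [hk p.1 hp.1, hh p.1 hp.1]
    rfl
  · refine BundleAut.isPushforward_of_total_mk (y := B t₀ t) fun x => ?_
    rw [hh t ht, hT.apply_of_wderiv d hd hd' t₀ ht₀ t ht x]
    rfl
  · rw [h0, hk r hr]
    exact (hT.bundleAut hr ht₀).push_apply a x

end TransportAutomorphisms

section Triviality

variable {E : Type*} [NormedAddCommGroup E] [NormedSpace ℝ E] [FiniteDimensional ℝ E]
  {H : Type*} [TopologicalSpace H] {I : ModelWithCorners ℝ E H} [I.Boundaryless]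
  {M : Type*} [TopologicalSpace M] [ChartedSpace H M] [IsManifold I ∞ M]
  {J : Set ℝ}

variable {F : Type*} [NormedAddCommGroup F] [NormedSpace ℝ F] [FiniteDimensional ℝ F]
  {V : M → Type*} [TopologicalSpace (TotalSpace F V)]
  [∀ x, AddCommGroup (V x)] [∀ x, Module ℝ (V x)] [∀ x, TopologicalSpace (V x)]
  [FiberBundle F V] [VectorBundle ℝ F V] [ContMDiffVectorBundle ∞ F V I]

variable [T2Space M] [SecondCountableTopology M]

theorem eq_of_forall_mvfderiv_eq {x : M} {v w : TangentSpace I x}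
    (h : ∀ f : Fun I M, (mvfderiv I f x v : ℝ) = mvfderiv I f x w) : v = w := by
  obtain ⟨f, hf, hfx⟩ := exists_chartFun (I := I) x
  have h1 : (mvfderiv I f x v : E) = mvfderiv I f x w := eq_of_forall_dual fun φ => by
    rw [← mvfderiv_dual_comp hf φ x v, ← mvfderiv_dual_comp hf φ x w]
    exact h ⟨fun x => φ (f x), contMDiff_dual_comp hf φ⟩
  rw [mvfderiv_of_eq_extChartAt hf (mem_extChartAt_source x) hfx,
    mvfderiv_of_eq_extChartAt hf (mem_extChartAt_source x) hfx,
    trivializationAt_tangentSpace_self, trivializationAt_tangentSpace_self] at h1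
  exact h1

theorem BundleAut.isLieAlgebroidIso_of_bracket {h : BundleAut I F V} {A A' : LieAlgebroid I F V}
    (hb : ∀ α β α' β' : Sec I F V, h.IsPushforward α α' → h.IsPushforward β β' →
      h.IsPushforward (A.bracket α β) (A'.bracket α' β')) : h.IsLieAlgebroidIso A A' := by
  refine ⟨hb, fun x v => ?_⟩
  by_cases hv : v = 0
  · subst hv; simp
  obtain ⟨α, hα⟩ := exists_sec_apply_eq (I := I) (F := F) v
  refine eq_of_forall_mvfderiv_eq fun f => ?_
  set g : Fun I M := ⟨fun y => f (h.base y), f.contMDiff.comp h.base.contMDiff⟩ with hg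
  have hpush := h.isPushforward_push α
  have h1 : h.IsPushforward (g • α) (f • h.push α) := fun y => by
    rw [fun_smul_apply, fun_smul_apply, h.push_apply, map_smul]
    rfl
  have h2 := hb α (g • α) _ _ hpush h1 x
  have h3 := hb α α _ _ hpush hpush x
  rw [A.leibniz, A'.leibniz, h3, map_add, map_smul, map_smul, h.push_apply, hα] at h2
  have h4 := add_left_cancel (a := f (h.base x) • h.fiber x (A.bracket α α x)) h2
  have hv' : h.fiber x v ≠ 0 := fun h0 => hv ((h.fiber_bijective x).1 (h0.trans (map_zero _).symm))
  rw [smul_left_injective ℝ hv' h4]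
  have h5 : MDifferentiableAt I 𝓘(ℝ, ℝ) f (h.base x) := f.contMDiff.mdifferentiable (by simp) _
  have h6 : MDifferentiableAt I I h.base x := h.base.contMDiff.mdifferentiable (by simp) _
  exact _root_.mvfderiv_comp_apply x h5 h6 _

theorem smoothVF_of_isDerAt {X : ℝ → VF I M} {D : ℝ → Sec I F V →ₗ[ℝ] Sec I F V}
    [Nontrivial F]
    (hD : ∀ t ∈ J, ∀ x, IsDerAt x (evalAt x ∘ₗ D t) (X t x))
    (hs : ∀ α, SmoothFam I F J fun t x => D t α x) : SmoothVF J X := by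
  rintro f ⟨t₀, x₀⟩ hp
  obtain ⟨U, hU, hxU, n, s, ξ, hfr⟩ := exists_frameOn (I := I) (F := F) (V := V) x₀
  obtain ⟨v, hv⟩ : ∃ v : V x₀, v ≠ 0 := by
    have : Nontrivial (V x₀) :=
      ((trivializationAt F V x₀).continuousLinearEquivAt ℝ x₀
        (mem_baseSet_trivializationAt F V x₀)).toEquiv.nontrivial
    exact exists_ne 0
  obtain ⟨k, hk⟩ : ∃ k, ξ k x₀ v ≠ 0 := by
    by_contra! h0
    refine hv ?_
    rw [← hfr.sum x₀ hxU v]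
    simp [h0]
  obtain ⟨u, rfl⟩ := exists_sec_apply_eq (I := I) (F := F) v
  have h1 : ∀ w : Sec I F V, SmoothFun I J fun p : ℝ × M => ξ k p.2 (D p.1 w p.2) :=
    fun w => (hs w).coeff (hfr.smooth k)
  have h2 : ∀ g : Fun I M, SmoothFun I J fun p : ℝ × M => g p.2 := fun g =>
    g.contMDiff.comp_contMDiffOn contMDiffOn_snd
  have h3 : ContMDiffWithinAt (𝓘(ℝ, ℝ).prod I) 𝓘(ℝ, ℝ) ∞ (fun p : ℝ × M =>
      (ξ k p.2 (D p.1 (f • u) p.2) - f p.2 * ξ k p.2 (D p.1 u p.2)) /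
        coeffFun (hfr.smooth k) u p.2) (J ×ˢ univ) (t₀, x₀) :=
    ((h1 _ _ hp).sub ((h2 f _ hp).mul (h1 u _ hp))).div₀ (h2 _ _ hp) hk
  refine h3.congr_of_eventuallyEq_of_mem ?_ hp
  have h4 : ∀ᶠ p : ℝ × M in 𝓝 (t₀, x₀), coeffFun (hfr.smooth k) u p.2 ≠ 0 :=
    ((coeffFun (hfr.smooth k) u).contMDiff.continuous.comp
      continuous_snd).continuousAt.eventually_ne hk
  filter_upwards [mem_nhdsWithin_of_mem_nhds h4, self_mem_nhdsWithin] with p hp1 hp2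
  have h5 := hD p.1 hp2.1 p.2 f u
  simp only [LinearMap.comp_apply, evalAt_apply] at h5
  rw [eq_div_iff hp1, h5, map_add, map_smul, map_smul]
  simp

theorem IsSmoothCochainFamily.exists_derivationFamily
    {D : ℝ → (Sec I F V [⋀^Fin 1]→ₗ[ℝ] Sec I F V)} (hD : IsSmoothCochainFamily J D) :
    ∃ (D₁ : ℝ → Sec I F V →ₗ[ℝ] Sec I F V) (X : ℝ → VF I M), DerivationFamily J D₁ X ∧
      ∀ t α, D t ![α] = D₁ t α := by
  have hsub : ∀ t, ∃ X : VF I M, t ∈ J → ∀ (u : Sec I F V) (f : Fun I M) (x : M),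
      D t ![f • u] x = f x • D t ![u] x + mvfderiv I f x (X x) • u x := by
    intro t
    by_cases ht : t ∈ J
    · obtain ⟨σ, hσ⟩ := hD.isDefCochain t ht
      refine ⟨σ ![], fun _ u f x => ?_⟩
      have e : ∀ w : Sec I F V, Fin.snoc (α := fun _ => Sec I F V) ![] w = ![w] := fun w => by
        funext i
        fin_cases i
        rfl
      have h1 := hσ ![] u f x
      rwa [e, e] at h1
    · exact ⟨0, fun h => absurd h ht⟩
  choose X hX using hsub
  have hup : ∀ w : Sec I F V, Function.update (![0] : Fin 1 → Sec I F V) 0 w = ![w] := fun w => by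
    funext i
    fin_cases i
    rfl
  set D₁ : ℝ → Sec I F V →ₗ[ℝ] Sec I F V := fun t =>
    { toFun := fun α => D t ![α]
      map_add' := fun α β => by
        have h := (D t).map_update_add ![0] 0 α β
        rwa [hup, hup, hup] at h
      map_smul' := fun a α => by
        have h := (D t).map_update_smul ![0] 0 a α
        rwa [hup, hup] at h }
  rcases subsingleton_or_nontrivial F with hF | hF
  · have hV : ∀ x, Subsingleton (V x) := fun x =>
      ((trivializationAt F V x).continuousLinearEquivAt ℝ x
        (mem_baseSet_trivializationAt F V x)).toEquiv.subsingleton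
    refine ⟨D₁, fun _ => 0, ⟨fun t ht x f β => Subsingleton.elim _ _, fun α => hD.smooth ![α],
      fun f => ?_⟩, fun t α => rfl⟩
    have : (fun p : ℝ × M => (mvfderiv I f p.2 ((0 : VF I M) p.2) : ℝ)) = fun _ => 0 := by
      funext p
      exact map_zero _
    rw [this]
    exact contMDiffOn_const
  · have h1 : ∀ t ∈ J, ∀ x, IsDerAt x (evalAt x ∘ₗ D₁ t) (X t x) :=
      fun t ht x f β => hX t ht β f x
    exact ⟨D₁, X, ⟨h1, fun α => hD.smooth ![α],
      smoothVF_of_isDerAt h1 fun α => hD.smooth ![α]⟩, fun t α => rfl⟩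

theorem BracketDeriv.isTrivialFamily_of_cochain [CompactSpace M] {A : ℝ → LieAlgebroid I F V}
    {c : ℝ → Sec I F V →ₗ[ℝ] Sec I F V →ₗ[ℝ] Sec I F V} {σ : ℝ → Sec I F V →ₗ[Fun I M] VF I M}
    (hc : BracketDeriv J A c σ) (hA : IsSmoothFamily J A) (hJ : J.OrdConnected)
    (hJ' : J.Nontrivial) {D : ℝ → (Sec I F V [⋀^Fin 1]→ₗ[ℝ] Sec I F V)}
    (hD : IsSmoothCochainFamily J D)
    (hcD : ∀ t ∈ J, ∀ s : Fin 2 → Sec I F V, altTwo (c t) (hc.self t) s = (A t).delta (D t) s) :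
    IsTrivialFamily J A := by
  obtain ⟨t₀, ht₀⟩ := hJ'.nonempty
  obtain ⟨D₁, X, hD₁, hDD⟩ := hD.exists_derivationFamily
  obtain ⟨h, hh, hpush, hex⟩ := hD₁.exists_bundleAut hJ hJ' ht₀
  have hc' : ∀ t ∈ J, ∀ α β, c t α β = (A t).bracket α (D₁ t β) - (A t).bracket β (D₁ t α) -
      D₁ t ((A t).bracket α β) := fun t ht α β => by
    have h1 := hcD t ht ![α, β]
    rw [LieAlgebroid.delta_one] at h1
    simp only [hDD] at h1
    exact h1
  refine ⟨A t₀, h, hh, fun t ht => BundleAut.isLieAlgebroidIso_of_bracket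
    fun α β α' β' hα hβ => ?_⟩
  obtain ⟨a, ha, ha', rfl⟩ := hex α'
  obtain ⟨b, hb, hb', rfl⟩ := hex β'
  have hαa : α = a t := by
    rw [← (h t).pull_push α, ← hα.eq_push, (hpush a ha ha' t ht).eq_push, (h t).pull_push]
  have hβb : β = b t := by
    rw [← (h t).pull_push β, ← hβ.eq_push, (hpush b hb hb' t ht).eq_push, (h t).pull_push]
  rw [hαa, hβb]
  refine hpush (fun r => (A r).bracket (a r) (b r)) (hA.smoothFam_bracket hJ hJ' ha hb)
    (fun r hr x => ?_) t ht
  have h1 := hc.wderiv_bracket_apply hJ hJ' hr (α' := fun r => -D₁ r (a r))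
    (β' := fun r => -D₁ r (b r)) ha (fun t ht x => ha' t ht x) hb (fun t ht x => hb' t ht x) x
  convert h1 using 1
  have h2 := congrArg (fun s : Sec I F V => s x) ((A r).bracket_swap (b r) (D₁ r (a r)))
  simp only [ContMDiffSection.coe_neg, Pi.neg_apply] at h2
  rw [hc' r hr]
  simp only [map_neg, LinearMap.neg_apply, ContMDiffSection.coe_sub, ContMDiffSection.coe_neg,
    Pi.sub_apply, Pi.neg_apply, h2]
  abel

end Triviality

end LieAlgd

end

end

theorem mainTheorem2
    {E : Type*} [NormedAddCommGroup E] [NormedSpace ℝ E] [FiniteDimensional ℝ E]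
    {H : Type*} [TopologicalSpace H] (I : ModelWithCorners ℝ E H) [I.Boundaryless]
    {M : Type*} [TopologicalSpace M] [ChartedSpace H M] [IsManifold I ∞ M]
    [T2Space M] [SecondCountableTopology M]
    (F : Type*) [NormedAddCommGroup F] [NormedSpace ℝ F] [FiniteDimensional ℝ F]
    (V : M → Type*) [TopologicalSpace (TotalSpace F V)]
    [∀ x, AddCommGroup (V x)] [∀ x, Module ℝ (V x)] [∀ x, TopologicalSpace (V x)]
    [∀ x, IsTopologicalAddGroup (V x)] [∀ x, ContinuousSMul ℝ (V x)]
    [FiberBundle F V] [VectorBundle ℝ F V] [ContMDiffVectorBundle ∞ F V I]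
    (J : Set ℝ) (hJ : J.OrdConnected) (hJ' : J.Nontrivial)
    (A : ℝ → LieAlgd.LieAlgebroid I F V) (hA : LieAlgd.IsSmoothFamily J A) :
    ∃ c : ℝ → (LieAlgd.Sec I F V [⋀^Fin 2]→ₗ[ℝ] LieAlgd.Sec I F V),
      LieAlgd.IsBracketDerivative J A c ∧
      (∀ t ∈ J, (A t).IsDefCocycle (c t)) ∧
      (CompactSpace M →
        (LieAlgd.IsTrivialFamily J A ↔
          ∃ D : ℝ → (LieAlgd.Sec I F V [⋀^Fin 1]→ₗ[ℝ] LieAlgd.Sec I F V),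
            LieAlgd.IsSmoothCochainFamily J D ∧
            ∀ t ∈ J, ∀ s : Fin 2 → LieAlgd.Sec I F V, c t s = (A t).delta (D t) s)) := by
  obtain ⟨c, σ, hc⟩ := hA.exists_bracketDeriv hJ hJ'
  refine ⟨fun t => LieAlgd.altTwo (c t) (hc.self t), hc.isBracketDerivative,
    fun t ht => hc.isDefCocycle hA hJ hJ' ht, fun _ => ⟨fun h => ?_, fun ⟨D, hD, hcD⟩ => ?_⟩⟩
  · exact hc.exists_cochain_of_isTrivialFamily hA hJ hJ' h
  · exact hc.isTrivialFamily_of_cochain hA hJ hJ' hD hcD
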